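/- Let $k$ be a field of characteristic $0$, $A$ an associative unital $k$-algebra, $V$ a finite-dimensional $k$-vector space, $\mathfrak g=\mathrm{End}(V)=\mathrm{Lie}\,GL(V)$. Let $\mathrm{Rep}(A,V)$ be the affine scheme representing $W\mapsto \mathrm{Hom}_{k\text{-alg}}(A,\mathrm{End}(V)\otimes W)$ on commutative $k$-algebras, and $a\mapsto\hat a\in \mathrm{End}(V)\otimes k[\mathrm{Rep}(A,V)]$ the universal (evaluation) homomorphism. Let $\Omega^\bullet(\mathrm{Rep}(A,V))$ be the algebra of Kähler differential forms, with de Rham differential $d_{DR}$. For $x\in\mathfrak g$ let $\vec x$ be the vector field on $\mathrm{Rep}(A,V)$ generating the conjugation action $\rho\mapsto g\rho g^{-1}$, that is $\vec x(\hat a)=[x,\hat a]$, and let $i_{\vec x}$, $L_{\vec x}$ be its contraction and Lie derivative. A form $\omega$ is basic if $i_{\vec x}\omega=L_{\vec x}\omega=0$ for all $x\in\mathfrak g$. Let $(\Omega(\mathrm{Rep}(A,V))\otimes k[\mathfrak g])^{\mathfrak g}$ be the invariants of the diagonal action (with the infinitesimal adjoint action on polynomial functions on $\mathfrak g$, linear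 functions having degree $2$), with the operators $d_{DR}=d_{DR}\otimes\mathrm{id}$ and $d_{\mathfrak g}(\omega\otimes f)=\sum_r i_{\vec e_r}\omega\otimes e_r^*f$ for dual bases $\{e_r\}$, $\{e_r^*\}$ of $\mathfrak g$, $\mathfrak g^*$. (i) Connes' operator $B$ on Hochschild chains induces a differential on Hochschild homology $H_\bullet(A,A)$, $d_{DR}$ preserves basic forms, and the assignment $a_0\otimes\dots\otimes a_n\mapsto \mathrm{Tr}(\hat a_0\,d_{DR}\hat a_1\cdots d_{DR}\hat a_n)$ induces linear maps $\mathrm{ev}:H_n(A,A)\to\Omega^n_{\mathrm{basic}}(\mathrm{Rep}(A,V))$, $n\ge 0$, such that $\mathrm{ev}(B\,h)=(n+1)\,d_{DR}\,\mathrm{ev}(h)$ for all $h\in H_n(A,A)$. That is, $\mathrm{ev}$ is a morphism of complexes from $(H_\bullet(A,A),B)$ to the basic forms with the differential equal to $(n+1)\,d_{DR}$ on $n$-forms. (ii) Let $A_t=A*k[t]$ and let $\Omega_tA=\Omega_{k[t]}(A_t)$ be the algebra of noncommutative differential forms on $A_t$ relative to $k[t]$, bigraded by twice the number of $t$'s and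 by the degree of forms. Let $DR_tA=\Omega_tA/[\Omega_tA,\Omega_tA]$ be its super-commutator quotient, with the de Rham differential $d$ and the contraction $i_\Delta$ induced by the graded derivation of $\Omega_tA$ with $b\mapsto 0$, $db\mapsto tb-bt$ for $b\in A_t$. Then $d+i_\Delta$ squares to zero on $DR_tA$, $d_{DR}+d_{\mathfrak g}$ preserves and squares to zero on $(\Omega(\mathrm{Rep}(A,V))\otimes k[\mathfrak g])^{\mathfrak g}$, and, with $\hat t=\sum_r e_r\otimes e_r^*$, the assignment $b_0\,db_1\cdots db_n\mapsto \mathrm{Tr}(\hat b_0\,d_{DR}\hat b_1\cdots d_{DR}\hat b_n)$, $b_i\in A_t$, induces a linear map $$DR_tA\to(\Omega(\mathrm{Rep}(A,V))\otimes k[\mathfrak g])^{\mathfrak g}$$ which respects the bigradings (and so the total degrees) and is a morphism of complexes from $(DR_tA,\ d+i_\Delta)$ to the $\mathfrak g$-equivariant algebraic de Rham complex with differential $d_{DR}+d_{\mathfrak g}$. -/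

import Mathlib

open scoped TensorProduct

noncomputable section

namespace NCRep

/-! ### Free products of algebras -/

section FreeProduct

variable (k A B : Type*) [Field k] [Ring A] [Algebra k A] [Ring B] [Algebra k B]

/-- The relations making both sets of generators into unital `k`-subalgebra images. -/
inductive FreeProd.Rel : FreeAlgebra k (A ⊕ B) → FreeAlgebra k (A ⊕ B) → Prop
  | inl_add (a a' : A) : Rel (FreeAlgebra.ι k (.inl (a + a')))
      (FreeAlgebra.ι k (.inl a) + FreeAlgebra.ι k (.inl a'))
  | inl_mul (a a' : A) : Rel (FreeAlgebra.ι k (.inl (a * a')))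
      (FreeAlgebra.ι k (.inl a) * FreeAlgebra.ι k (.inl a'))
  | inl_algebraMap (c : k) : Rel (FreeAlgebra.ι k (.inl (algebraMap k A c)))
      (algebraMap k (FreeAlgebra k (A ⊕ B)) c)
  | inr_add (b b' : B) : Rel (FreeAlgebra.ι k (.inr (b + b')))
      (FreeAlgebra.ι k (.inr b) + FreeAlgebra.ι k (.inr b'))
  | inr_mul (b b' : B) : Rel (FreeAlgebra.ι k (.inr (b * b')))
      (FreeAlgebra.ι k (.inr b) * FreeAlgebra.ι k (.inr b'))
  | inr_algebraMap (c : k) : Rel (FreeAlgebra.ι k (.inr (algebraMap k B c)))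
      (algebraMap k (FreeAlgebra k (A ⊕ B)) c)

/-- The free product `A * B` (coproduct of unital associative `k`-algebras). -/
def FreeProd : Type _ := RingQuot (FreeProd.Rel k A B)

instance : Ring (FreeProd k A B) := inferInstanceAs (Ring (RingQuot (FreeProd.Rel k A B)))
instance : Algebra k (FreeProd k A B) :=
  inferInstanceAs (Algebra k (RingQuot (FreeProd.Rel k A B)))

namespace FreeProd

/-- The quotient map from the free algebra on `A ⊕ B`. -/
def mk : FreeAlgebra k (A ⊕ B) →ₐ[k] FreeProd k A B := RingQuot.mkAlgHom k (Rel k A B)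

variable {k A B} in
theorem mk_eq {x y : FreeAlgebra k (A ⊕ B)} (h : Rel k A B x y) : mk k A B x = mk k A B y :=
  RingQuot.mkAlgHom_rel k h

/-- The inclusion `A → A * B`. -/
def inl : A →ₐ[k] FreeProd k A B where
  toFun a := mk k A B (FreeAlgebra.ι k (.inl a))
  map_one' := by
    have := mk_eq (k := k) (B := B) (Rel.inl_algebraMap (A := A) (1 : k))
    simpa using this
  map_mul' a a' := by rw [mk_eq (Rel.inl_mul a a'), map_mul]
  map_zero' := by
    have := mk_eq (k := k) (B := B) (Rel.inl_algebraMap (A := A) (0 : k))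
    simpa using this
  map_add' a a' := by rw [mk_eq (Rel.inl_add a a'), map_add]
  commutes' c := by rw [mk_eq (Rel.inl_algebraMap c)]; exact (mk k A B).commutes c

/-- The inclusion `B → A * B`. -/
def inr : B →ₐ[k] FreeProd k A B where
  toFun b := mk k A B (FreeAlgebra.ι k (.inr b))
  map_one' := by
    have := mk_eq (k := k) (A := A) (Rel.inr_algebraMap (B := B) (1 : k))
    simpa using this
  map_mul' b b' := by rw [mk_eq (Rel.inr_mul b b'), map_mul]
  map_zero' := by
    have := mk_eq (k := k) (A := A) (Rel.inr_algebraMap (B := B) (0 : k))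
    simpa using this
  map_add' b b' := by rw [mk_eq (Rel.inr_add b b'), map_add]
  commutes' c := by rw [mk_eq (Rel.inr_algebraMap c)]; exact (mk k A B).commutes c

variable {k A B}
variable {C : Type*} [Ring C] [Algebra k C]

/-- The universal property of the free product. -/
def lift (f : A →ₐ[k] C) (g : B →ₐ[k] C) : FreeProd k A B →ₐ[k] C :=
  RingQuot.liftAlgHom k ⟨FreeAlgebra.lift k (Sum.elim f g), by
    intro x y h
    cases h <;> simp⟩

@[simp] theorem lift_inl (f : A →ₐ[k] C) (g : B →ₐ[k] C) (a : A) :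
    lift f g (inl k A B a) = f a := by
  change RingQuot.liftAlgHom k _ (RingQuot.mkAlgHom k _ _) = _
  simp

@[simp] theorem lift_inr (f : A →ₐ[k] C) (g : B →ₐ[k] C) (b : B) :
    lift f g (inr k A B b) = g b := by
  change RingQuot.liftAlgHom k _ (RingQuot.mkAlgHom k _ _) = _
  simp

theorem hom_ext {f g : FreeProd k A B →ₐ[k] C} (h₁ : ∀ a, f (inl k A B a) = g (inl k A B a))
    (h₂ : ∀ b, f (inr k A B b) = g (inr k A B b)) : f = g := by
  refine RingQuot.ringQuot_ext' k f g (FreeAlgebra.hom_ext (funext fun x => ?_))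
  cases x with
  | inl a => exact h₁ a
  | inr b => exact h₂ b

end FreeProd

end FreeProduct

/-! ### Relative noncommutative differential forms -/

section Forms

variable {k B : Type*} [Field k] [Ring B] [Algebra k B] (S : Subalgebra k B)

/-- The defining relations of the algebra of noncommutative forms; the generator `Sum.inl b`
stands for `b` and `Sum.inr b` for the symbol `db`. -/
inductive NCForms.Rel : FreeAlgebra k (B ⊕ B) → FreeAlgebra k (B ⊕ B) → Prop
  | add (b b' : B) : Rel (FreeAlgebra.ι k (.inl (b + b')))
      (FreeAlgebra.ι k (.inl b) + FreeAlgebra.ι k (.inl b'))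
  | mul (b b' : B) : Rel (FreeAlgebra.ι k (.inl (b * b')))
      (FreeAlgebra.ι k (.inl b) * FreeAlgebra.ι k (.inl b'))
  | algebraMap (c : k) : Rel (FreeAlgebra.ι k (.inl (algebraMap k B c)))
      (algebraMap k (FreeAlgebra k (B ⊕ B)) c)
  | d_add (b b' : B) : Rel (FreeAlgebra.ι k (.inr (b + b')))
      (FreeAlgebra.ι k (.inr b) + FreeAlgebra.ι k (.inr b'))
  | d_smul (c : k) (b : B) : Rel (FreeAlgebra.ι k (.inr (c • b))) (c • FreeAlgebra.ι k (.inr b))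
  | d_mul (b b' : B) : Rel (FreeAlgebra.ι k (.inr (b * b')))
      (FreeAlgebra.ι k (.inr b) * FreeAlgebra.ι k (.inl b')
        + FreeAlgebra.ι k (.inl b) * FreeAlgebra.ι k (.inr b'))
  | d_mem (s : B) (hs : s ∈ S) : Rel (FreeAlgebra.ι k (.inr s)) 0

/-- The algebra `Ω_S B` of noncommutative differential forms on `B` relative to the subalgebra
`S`: the algebra generated by `B` and the symbols `db`, where `b ↦ db` is a `k`-linear derivation
on `B` that kills `S`.  (An algebra map out of it is an algebra map `f` on `B` together with an
`S`-relative derivation along `f`, which is the universal property of the tensor algebra over `B`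
of the bimodule of relative one-forms.) -/
def NCForms : Type _ := RingQuot (NCForms.Rel S)

instance : Ring (NCForms S) := inferInstanceAs (Ring (RingQuot (NCForms.Rel S)))
instance : Algebra k (NCForms S) := inferInstanceAs (Algebra k (RingQuot (NCForms.Rel S)))

/-- A derivation of `B` relative to the subalgebra `S`, with values in `B`. -/
structure RelDer where
  /-- The underlying linear map. -/
  toFun : B →ₗ[k] B
  leibniz : ∀ b b', toFun (b * b') = toFun b * b' + b * toFun b'
  map_mem : ∀ s ∈ S, toFun s = 0

namespace NCForms

/-- The quotient map from the free algebra. -/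
def mk : FreeAlgebra k (B ⊕ B) →ₐ[k] NCForms S := RingQuot.mkAlgHom k (Rel S)

variable {S} in
theorem mk_eq {x y : FreeAlgebra k (B ⊕ B)} (h : Rel S x y) : mk S x = mk S y :=
  RingQuot.mkAlgHom_rel k h

/-- Zero-forms: the algebra map `B → Ω_S B`. -/
def of : B →ₐ[k] NCForms S where
  toFun b := mk S (FreeAlgebra.ι k (.inl b))
  map_one' := by simpa using mk_eq (Rel.algebraMap (S := S) (1 : k))
  map_mul' a a' := by rw [mk_eq (Rel.mul a a'), map_mul]
  map_zero' := by simpa using mk_eq (Rel.algebraMap (S := S) (0 : k))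
  map_add' a a' := by rw [mk_eq (Rel.add a a'), map_add]
  commutes' c := by rw [mk_eq (Rel.algebraMap c)]; exact (mk S).commutes c

/-- The universal derivation `b ↦ db`. -/
def dOf : B →ₗ[k] NCForms S where
  toFun b := mk S (FreeAlgebra.ι k (.inr b))
  map_add' a a' := by rw [mk_eq (Rel.d_add a a'), map_add]
  map_smul' c a := by rw [mk_eq (Rel.d_smul c a), map_smul]; rfl

theorem dOf_mul (b b' : B) : dOf S (b * b') = dOf S b * of S b' + of S b * dOf S b' := by
  change mk S _ = mk S _ * mk S _ + mk S _ * mk S _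
  rw [mk_eq (Rel.d_mul b b'), map_add, map_mul, map_mul]

theorem dOf_mem {s : B} (hs : s ∈ S) : dOf S s = 0 := by
  change mk S _ = 0
  rw [mk_eq (Rel.d_mem s hs), map_zero]

variable {S}
variable {C : Type*} [Ring C] [Algebra k C]

/-- The universal property of `Ω_S B`. -/
def lift (f : B →ₐ[k] C) (g : B →ₗ[k] C) (hg : ∀ b b', g (b * b') = g b * f b' + f b * g b')
    (hS : ∀ s ∈ S, g s = 0) : NCForms S →ₐ[k] C :=
  RingQuot.liftAlgHom k ⟨FreeAlgebra.lift k (Sum.elim f g), by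
    intro x y h
    cases h with
    | d_mul b b' => simp [hg]
    | d_mem s hs => simp [hS s hs]
    | _ => simp⟩

section
variable (f : B →ₐ[k] C) (g : B →ₗ[k] C) (hg : ∀ b b', g (b * b') = g b * f b' + f b * g b')
    (hS : ∀ s ∈ S, g s = 0)

@[simp] theorem lift_of (b : B) : lift f g hg hS (of S b) = f b := by
  change RingQuot.liftAlgHom k _ (RingQuot.mkAlgHom k _ _) = _
  simp

@[simp] theorem lift_dOf (b : B) : lift f g hg hS (dOf S b) = g b := by
  change RingQuot.liftAlgHom k _ (RingQuot.mkAlgHom k _ _) = _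
  simp
end

theorem hom_ext {f g : NCForms S →ₐ[k] C} (h₁ : ∀ b, f (of S b) = g (of S b))
    (h₂ : ∀ b, f (dOf S b) = g (dOf S b)) : f = g := by
  refine RingQuot.ringQuot_ext' k f g (FreeAlgebra.hom_ext (funext fun x => ?_))
  cases x with
  | inl a => exact h₁ a
  | inr b => exact h₂ b

variable (S)

/-- The sign involution, `(-1)^n` on `n`-forms. -/
def invol : NCForms S →ₐ[k] NCForms S :=
  lift (of S) (-dOf S) (by intro b b'; simp [dOf_mul, add_comm]) (by
    intro s hs; simp [dOf_mem S hs])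

@[simp] theorem invol_of (b : B) : invol S (of S b) = of S b := by simp [invol]
@[simp] theorem invol_dOf (b : B) : invol S (dOf S b) = -dOf S b := by simp [invol]

/-- A graded derivation `D` of odd degree is encoded by the algebra map
`ω ↦ (±ω, Dω; 0, ω)` into upper triangular matrices. -/
def dHom : NCForms S →ₐ[k] Matrix (Fin 2) (Fin 2) (NCForms S) :=
  lift
    { toFun := fun b => !![of S b, dOf S b; 0, of S b]
      map_one' := by
        rw [map_one, show dOf S 1 = 0 from dOf_mem S (one_mem S)]; exact Matrix.one_fin_two.symm
      map_mul' := fun b b' => by simp [dOf_mul, add_comm]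
      map_zero' := by ext i j; fin_cases i <;> fin_cases j <;> simp
      map_add' := fun b b' => by simp
      commutes' := fun c => by
        have h : dOf S (algebraMap k B c) = 0 := dOf_mem S (S.algebraMap_mem c)
        ext i j; fin_cases i <;> fin_cases j <;> simp [h, Matrix.algebraMap_matrix_apply] }
    { toFun := fun b => !![-dOf S b, 0; 0, dOf S b]
      map_add' := fun b b' => by
        ext i j; fin_cases i <;> fin_cases j <;> simp [add_comm]
      map_smul' := fun c b => by
        ext i j; fin_cases i <;> fin_cases j <;> simp }
    (by intro b b'; simp [dOf_mul]; abel)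
    (by intro s hs; ext i j; fin_cases i <;> fin_cases j <;> simp [dOf_mem S hs])

/-- The matrix-valued algebra map encoding the contraction with `θ`. -/
def iHom (θ : RelDer S) : NCForms S →ₐ[k] Matrix (Fin 2) (Fin 2) (NCForms S) :=
  lift
    { toFun := fun b => !![of S b, 0; 0, of S b]
      map_one' := by rw [map_one]; exact Matrix.one_fin_two.symm
      map_mul' := fun b b' => by simp
      map_zero' := by ext i j; fin_cases i <;> fin_cases j <;> simp
      map_add' := fun b b' => by simp
      commutes' := fun c => by
        ext i j; fin_cases i <;> fin_cases j <;> simp [Matrix.algebraMap_matrix_apply] }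
    { toFun := fun b => !![-dOf S b, of S (θ.toFun b); 0, dOf S b]
      map_add' := fun b b' => by
        ext i j; fin_cases i <;> fin_cases j <;> simp [add_comm]
      map_smul' := fun c b => by
        ext i j; fin_cases i <;> fin_cases j <;> simp }
    (by intro b b'; simp [dOf_mul, θ.leibniz]; abel)
    (by intro s hs; ext i j; fin_cases i <;> fin_cases j <;> simp [dOf_mem S hs, θ.map_mem s hs])

/-- The de Rham differential on `Ω_S B`: the graded derivation of degree `1` with `b ↦ db`
and `db ↦ 0`. -/
def d : NCForms S →ₗ[k] NCForms S where
  toFun ω := dHom S ω 0 1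
  map_add' x y := by simp
  map_smul' c x := by simp

/-- The contraction `i_θ`: the graded derivation of degree `-1` with `b ↦ 0`, `db ↦ θ(b)`. -/
def contr (θ : RelDer S) : NCForms S →ₗ[k] NCForms S where
  toFun ω := iHom S θ ω 0 1
  map_add' x y := by simp
  map_smul' c x := by simp

theorem induction {P : NCForms S → Prop} (hof : ∀ b, P (of S b)) (hd : ∀ b, P (dOf S b))
    (hadd : ∀ x y, P x → P y → P (x + y)) (hmul : ∀ x y, P x → P y → P (x * y)) (ω : NCForms S) :
    P ω := by
  obtain ⟨x, rfl⟩ := RingQuot.mkAlgHom_surjective k (Rel S) ω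
  change P (mk S x)
  induction x using FreeAlgebra.induction with
  | grade0 c => rw [AlgHom.commutes, ← (of S).commutes]; exact hof _
  | grade1 x =>
    cases x with
    | inl b => exact hof b
    | inr b => exact hd b
  | mul x y hx hy => rw [map_mul]; exact hmul _ _ hx hy
  | add x y hx hy => rw [map_add]; exact hadd _ _ hx hy

theorem dHom_of (b : B) : dHom S (of S b) = !![of S b, dOf S b; 0, of S b] := lift_of _ _ _ _ b

theorem dHom_dOf (b : B) : dHom S (dOf S b) = !![-dOf S b, 0; 0, dOf S b] := lift_dOf _ _ _ _ b

theorem iHom_of (θ : RelDer S) (b : B) : iHom S θ (of S b) = !![of S b, 0; 0, of S b] :=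
  lift_of _ _ _ _ b

theorem iHom_dOf (θ : RelDer S) (b : B) :
    iHom S θ (dOf S b) = !![-dOf S b, of S (θ.toFun b); 0, dOf S b] := lift_dOf _ _ _ _ b

theorem dHom_eq (ω : NCForms S) : dHom S ω = !![invol S ω, d S ω; 0, ω] := by
  have h : dHom S ω 0 0 = invol S ω ∧ dHom S ω 1 0 = 0 ∧ dHom S ω 1 1 = ω := by
    induction ω using induction with
    | hof b => simp [dHom_of]
    | hd b => simp [dHom_dOf]
    | hadd x y hx hy => simp [hx, hy]
    | hmul x y hx hy => simp [Matrix.mul_apply, Fin.sum_univ_two, hx, hy]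
  ext i j; fin_cases i <;> fin_cases j <;> simp [h, d]

theorem iHom_eq (θ : RelDer S) (ω : NCForms S) :
    iHom S θ ω = !![invol S ω, contr S θ ω; 0, ω] := by
  have h : iHom S θ ω 0 0 = invol S ω ∧ iHom S θ ω 1 0 = 0 ∧ iHom S θ ω 1 1 = ω := by
    induction ω using induction with
    | hof b => simp [iHom_of]
    | hd b => simp [iHom_dOf]
    | hadd x y hx hy => simp [hx, hy]
    | hmul x y hx hy => simp [Matrix.mul_apply, Fin.sum_univ_two, hx, hy]
  ext i j; fin_cases i <;> fin_cases j <;> simp [h, contr]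

@[simp] theorem d_of (b : B) : d S (of S b) = dOf S b := by simp [d, dHom_of]
@[simp] theorem d_dOf (b : B) : d S (dOf S b) = 0 := by simp [d, dHom_dOf]
@[simp] theorem contr_of (θ : RelDer S) (b : B) : contr S θ (of S b) = 0 := by
  simp [contr, iHom_of]
@[simp] theorem contr_dOf (θ : RelDer S) (b : B) :
    contr S θ (dOf S b) = of S (θ.toFun b) := by simp [contr, iHom_dOf]

theorem d_mul (x y : NCForms S) : d S (x * y) = d S x * y + invol S x * d S y := by
  have := congrFun (congrFun (map_mul (dHom S) x y) 0) 1
  rw [dHom_eq, dHom_eq, dHom_eq] at this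
  simpa [Matrix.mul_apply, Fin.sum_univ_two, add_comm] using this

theorem contr_mul (θ : RelDer S) (x y : NCForms S) :
    contr S θ (x * y) = contr S θ x * y + invol S x * contr S θ y := by
  have := congrFun (congrFun (map_mul (iHom S θ) x y) 0) 1
  rw [iHom_eq, iHom_eq, iHom_eq] at this
  simpa [Matrix.mul_apply, Fin.sum_univ_two, add_comm] using this

/-- The value of a word in the generators `b` and `db`. -/
def word (l : List (B ⊕ B)) : NCForms S := (l.map (Sum.elim (of S) (dOf S))).prod

/-- The space of `n`-forms: the span of all words in which exactly `n` letters have the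
form `db`. -/
def deg (n : ℕ) : Submodule k (NCForms S) :=
  Submodule.span k {ω | ∃ l : List (B ⊕ B), l.countP Sum.isRight = n ∧ ω = word S l}

theorem mul_mem_deg {p q : ℕ} {x y : NCForms S} (hx : x ∈ deg S p) (hy : y ∈ deg S q) :
    x * y ∈ deg S (p + q) := by
  induction hx, hy using Submodule.span_induction₂ with
  | mem_mem x y hx hy =>
    obtain ⟨l, rfl, rfl⟩ := hx
    obtain ⟨m, rfl, rfl⟩ := hy
    exact Submodule.subset_span ⟨l ++ m, by simp, by simp [word]⟩
  | zero_left => simp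
  | zero_right => simp
  | add_left x y z _ _ _ h₁ h₂ => rw [add_mul]; exact add_mem h₁ h₂
  | add_right x y z _ _ _ h₁ h₂ => rw [mul_add]; exact add_mem h₁ h₂
  | smul_left r x y _ _ h => rw [smul_mul_assoc]; exact Submodule.smul_mem _ _ h
  | smul_right r x y _ _ h => rw [mul_smul_comm]; exact Submodule.smul_mem _ _ h

theorem of_mem_deg (b : B) : of S b ∈ deg S 0 :=
  Submodule.subset_span ⟨[.inl b], by simp, by simp [word]⟩

theorem dOf_mem_deg (b : B) : dOf S b ∈ deg S 1 :=
  Submodule.subset_span ⟨[.inr b], by simp, by simp [word]⟩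

theorem word_mem_deg (l : List (B ⊕ B)) : word S l ∈ deg S (l.countP Sum.isRight) :=
  Submodule.subset_span ⟨l, rfl, rfl⟩

theorem invol_of_mem {n : ℕ} {x : NCForms S} (hx : x ∈ deg S n) :
    invol S x = (-1 : k) ^ n • x := by
  induction hx using Submodule.span_induction with
  | mem x hx =>
    obtain ⟨l, rfl, rfl⟩ := hx
    induction l with
    | nil => simp [word]
    | cons a l ih =>
      have e : word S (a :: l) = Sum.elim (of S) (dOf S) a * word S l := by simp [word]
      rw [e, map_mul, ih]
      cases a <;> simp [List.countP_cons, pow_succ]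
  | zero => simp
  | add x y _ _ h₁ h₂ => rw [map_add, h₁, h₂, smul_add]
  | smul c x _ h => rw [map_smul, h, smul_comm]

theorem d_mem_deg {n : ℕ} {x : NCForms S} (hx : x ∈ deg S n) : d S x ∈ deg S (n + 1) := by
  induction hx using Submodule.span_induction with
  | mem x hx =>
    obtain ⟨l, rfl, rfl⟩ := hx
    induction l with
    | nil =>
      have h : d S (word S []) = 0 := by
        have : word S ([] : List (B ⊕ B)) = of S 1 := by simp [word]
        rw [this, d_of]; exact dOf_mem S (one_mem S)
      rw [h]; exact zero_mem _
    | cons a l ih =>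
      have e : word S (a :: l) = Sum.elim (of S) (dOf S) a * word S l := by simp [word]
      rw [e, d_mul]
      cases a with
      | inl b =>
        have h₁ := mul_mem_deg S (dOf_mem_deg S b) (word_mem_deg S l)
        have h₂ := mul_mem_deg S (of_mem_deg S b) ih
        simp only [Sum.elim_inl, d_of, invol_of]
        simp only [List.countP_cons, Sum.isRight_inl, Bool.false_eq_true, if_false, add_zero]
        rw [add_comm] at h₁
        rw [zero_add] at h₂
        exact add_mem h₁ h₂
      | inr b =>
        have h₂ := mul_mem_deg S (dOf_mem_deg S b) ih
        simp only [Sum.elim_inr, d_dOf, invol_dOf, zero_mul, zero_add, neg_mul]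
        simp only [List.countP_cons, Sum.isRight_inr, if_true]
        rw [add_comm] at h₂
        exact neg_mem h₂
  | zero => simp
  | add x y _ _ h₁ h₂ => rw [map_add]; exact add_mem h₁ h₂
  | smul c x _ h => rw [map_smul]; exact Submodule.smul_mem _ _ h

theorem contr_mem_deg (θ : RelDer S) {n : ℕ} {x : NCForms S} (hx : x ∈ deg S n) :
    (n = 0 → contr S θ x = 0) ∧ contr S θ x ∈ deg S (n - 1) := by
  induction hx using Submodule.span_induction with
  | mem x hx =>
    obtain ⟨l, rfl, rfl⟩ := hx
    induction l with
    | nil =>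
      have h : contr S θ (word S []) = 0 := by
        have : word S ([] : List (B ⊕ B)) = of S 1 := by simp [word]
        rw [this, contr_of]
      rw [h]; exact ⟨fun _ => rfl, zero_mem _⟩
    | cons a l ih =>
      have e : word S (a :: l) = Sum.elim (of S) (dOf S) a * word S l := by simp [word]
      rw [e, contr_mul]
      obtain ⟨ih₀, ih⟩ := ih
      cases a with
      | inl b =>
        have h₂ := mul_mem_deg S (of_mem_deg S b) ih
        simp only [Sum.elim_inl, contr_of, invol_of, zero_mul, zero_add]
        simp only [List.countP_cons, Sum.isRight_inl, Bool.false_eq_true, if_false, add_zero]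
        rw [zero_add] at h₂
        exact ⟨fun h => by rw [ih₀ h, mul_zero], h₂⟩
      | inr b =>
        have h₁ := mul_mem_deg S (of_mem_deg S (θ.toFun b)) (word_mem_deg S l)
        have h₂ := mul_mem_deg S (dOf_mem_deg S b) ih
        simp only [Sum.elim_inr, contr_dOf, invol_dOf, neg_mul]
        simp only [List.countP_cons, Sum.isRight_inr, if_true, Nat.add_sub_cancel]
        rw [zero_add] at h₁
        refine ⟨fun h => absurd h (by omega), add_mem h₁ (neg_mem ?_)⟩
        by_cases h0 : l.countP Sum.isRight = 0
        · rw [ih₀ h0, mul_zero]; exact zero_mem _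
        · have : 1 + (l.countP Sum.isRight - 1) = l.countP Sum.isRight := by omega
          rwa [this] at h₂
  | zero => simp
  | add x y _ _ h₁ h₂ =>
    rw [map_add]
    exact ⟨fun h => by rw [h₁.1 h, h₂.1 h, add_zero], add_mem h₁.2 h₂.2⟩
  | smul c x _ h =>
    rw [map_smul]
    exact ⟨fun h' => by rw [h.1 h', smul_zero], Submodule.smul_mem _ _ h.2⟩

/-- The super-commutator space `[Ω, Ω]`, the span of all `uv - (-1)^{pq} vu` with `u` a `p`-form
and `v` a `q`-form. -/
def comm : Submodule k (NCForms S) :=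
  Submodule.span k {ω | ∃ (p q : ℕ) (u v : NCForms S), u ∈ deg S p ∧ v ∈ deg S q ∧
    ω = u * v - (-1 : k) ^ (p * q) • (v * u)}

theorem map_comm_of_odd (D : NCForms S →ₗ[k] NCForms S)
    (hmul : ∀ x y, D (x * y) = D x * y + invol S x * D y)
    (hdeg : ∀ (p : ℕ) (x : NCForms S), x ∈ deg S p →
      ∃ p' : ℕ, Odd (p + p') ∧ D x ∈ deg S p') :
    comm S ≤ (comm S).comap D := by
  refine Submodule.span_le.2 ?_
  rintro _ ⟨p, q, u, v, hu, hv, rfl⟩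
  obtain ⟨p', hp, hu'⟩ := hdeg p u hu
  obtain ⟨q', hq, hv'⟩ := hdeg q v hv
  have h₁ : D u * v - (-1 : k) ^ (p' * q) • (v * D u) ∈ comm S :=
    Submodule.subset_span ⟨p', q, _, _, hu', hv, rfl⟩
  have h₂ : u * D v - (-1 : k) ^ (p * q') • (D v * u) ∈ comm S :=
    Submodule.subset_span ⟨p, q', _, _, hu, hv', rfl⟩
  have h := add_mem h₁ (Submodule.smul_mem _ ((-1 : k) ^ p) h₂)
  have sgn : ∀ {a b : ℕ}, Odd (a + b) → (-1 : k) ^ b = -(-1) ^ a := by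
    intro a b hab
    have h : (-1 : k) ^ a * (-1) ^ b = -1 := by rw [← pow_add, hab.neg_one_pow]
    have h' : (-1 : k) ^ a * (-1) ^ a = 1 := by
      rw [← pow_add, Even.neg_one_pow ⟨a, rfl⟩]
    linear_combination (-1 : k) ^ a * h - (-1 : k) ^ b * h'
  have s₁ : (-1 : k) ^ (p' * q) = (-1 : k) ^ (p * q) * (-1 : k) ^ q := by
    rw [pow_mul, sgn hp, pow_mul, neg_pow, mul_comm]
  have s₂ : (-1 : k) ^ p * (-1 : k) ^ (p * q') = (-1 : k) ^ (p * q) := by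
    have h' : (-1 : k) ^ p * (-1) ^ p = 1 := by
      rw [← pow_add, Even.neg_one_pow ⟨p, rfl⟩]
    rw [mul_comm p q', pow_mul, sgn hq, neg_pow ((-1 : k) ^ q), mul_comm p q,
      pow_mul, ← mul_assoc, h', one_mul]
  have e : D (u * v - (-1 : k) ^ (p * q) • (v * u)) =
      (D u * v - (-1 : k) ^ (p' * q) • (v * D u)) +
        (-1 : k) ^ p • (u * D v - (-1 : k) ^ (p * q') • (D v * u)) := by
    rw [map_sub, map_smul, hmul, hmul, invol_of_mem S hu, invol_of_mem S hv, smul_sub, smul_smul,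
      s₂, s₁, mul_smul, smul_mul_assoc, smul_mul_assoc, smul_add]
    abel
  change D _ ∈ comm S
  rw [e]
  exact h

theorem d_comm : comm S ≤ (comm S).comap (d S) :=
  map_comm_of_odd S (d S) (d_mul S) fun p _ hx => ⟨p + 1, ⟨p, by ring⟩, d_mem_deg S hx⟩

theorem contr_comm (θ : RelDer S) : comm S ≤ (comm S).comap (contr S θ) := by
  refine map_comm_of_odd S (contr S θ) (contr_mul S θ) fun p x hx => ?_
  obtain ⟨h₀, h⟩ := contr_mem_deg S θ hx
  rcases p with _ | p
  · exact ⟨1, ⟨0, rfl⟩, by rw [h₀ rfl]; exact zero_mem _⟩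
  · exact ⟨p, ⟨p, by ring⟩, h⟩

end NCForms

/-- The (relative) Karoubi-de Rham space `DR_S B = Ω_S B / [Ω_S B, Ω_S B]`. -/
abbrev DR : Type _ := NCForms S ⧸ NCForms.comm S

/-- The de Rham differential on `DR_S B`. -/
def DR.d : DR S →ₗ[k] DR S := (NCForms.comm S).mapQ _ (NCForms.d S) (NCForms.d_comm S)

/-- The contraction with a relative derivation on `DR_S B`. -/
def DR.contr (θ : RelDer S) : DR S →ₗ[k] DR S :=
  (NCForms.comm S).mapQ _ (NCForms.contr S θ) (NCForms.contr_comm S θ)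

end Forms

/-! ### The extended de Rham complex -/

section Extended

open Polynomial

variable (k A : Type*) [Field k] [Ring A] [Algebra k A]

/-- `A_t = A * k[t]`. -/
abbrev At : Type _ := FreeProd k A k[X]

/-- The variable `t` of `A_t`. -/
def tVar : At k A := FreeProd.inr k A k[X] X

/-- The subalgebra `k[t]` of `A_t`. -/
def kt : Subalgebra k (At k A) := (FreeProd.inr k A k[X]).range

/-- `Ω_t A = Ω_{k[t]}(A_t)`. -/
abbrev OmegaT : Type _ := NCForms (kt k A)

/-- The extended de Rham space `DR_t A = DR_{k[t]}(A_t)`. -/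
abbrev DRt : Type _ := DR (kt k A)

/-- The derivation `Δ_t = ad t : u ↦ tu - ut` of `A_t` relative to `k[t]`; it is the derivation
that extends `a ↦ 1·t·a - a·t·1`, i.e. the one associated with the double derivation
`Δ : a ↦ 1 ⊗ a - a ⊗ 1`. -/
def adT : RelDer (kt k A) where
  toFun := LinearMap.mulLeft k (tVar k A) - LinearMap.mulRight k (tVar k A)
  leibniz b b' := by simp [sub_mul, mul_sub, mul_assoc]
  map_mem := by
    rintro _ ⟨p, rfl⟩
    change tVar k A * FreeProd.inr k A k[X] p - FreeProd.inr k A k[X] p * tVar k A = 0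
    rw [tVar, ← map_mul, ← map_mul, mul_comm, sub_self]

/-- The differential `d + i_Δ` of the noncommutative equivariant de Rham complex. -/
def DRt.diff : DRt k A →ₗ[k] DRt k A := DR.d (kt k A) + DR.contr (kt k A) (adT k A)

/-- The letters `a`, `t`, `da` (`a ∈ A`) that generate `Ω_t A`. -/
inductive Letter (A : Type*)
  | const (a : A)
  | t
  | diff (a : A)

/-- The number of `t`'s in a letter. -/
def Letter.tCount {A : Type*} : Letter A → ℕ
  | .t => 1
  | _ => 0

/-- The number of `d`'s in a letter. -/
def Letter.dCount {A : Type*} : Letter A → ℕ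
  | .diff _ => 1
  | _ => 0

/-- The element of `Ω_t A` denoted by a letter. -/
def Letter.val {A : Type*} [Ring A] [Algebra k A] : Letter A → OmegaT k A
  | .const a => NCForms.of (kt k A) (FreeProd.inl k A k[X] a)
  | .t => NCForms.of (kt k A) (tVar k A)
  | .diff a => NCForms.dOf (kt k A) (FreeProd.inl k A k[X] a)

/-- The bigraded piece `Ω_t^{2p,q} A`: the span of the words in the letters `a`, `t`, `da` with
`p` letters `t` and `q` letters of the form `da`; its total degree is `2p + q`. -/
def OmegaT.bideg (p q : ℕ) : Submodule k (OmegaT k A) :=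
  Submodule.span k {ω | ∃ l : List (Letter A), (l.map Letter.tCount).sum = p ∧
    (l.map Letter.dCount).sum = q ∧ ω = (l.map (Letter.val k)).prod}

/-- The bigraded piece `DR_t^{2p,q} A`. -/
def DRt.bideg (p q : ℕ) : Submodule k (DRt k A) :=
  (OmegaT.bideg k A p q).map (NCForms.comm (kt k A)).mkQ

end Extended

/-! ### Algebraic differential forms on an affine scheme -/

section CommForms

variable (k R : Type*) [Field k] [CommRing R] [Algebra k R]

/-- The algebra of Kähler differential forms `Λ_R Ω¹_{R/k}`. -/
abbrev Forms : Type _ := ExteriorAlgebra R (Ω[R⁄k])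

namespace Forms

/-- The one-form attached to a Kähler differential. -/
abbrev one : Ω[R⁄k] →ₗ[R] Forms k R := ExteriorAlgebra.ι R

/-- The sign involution, `(-1)^n` on `n`-forms. -/
abbrev invol : Forms k R →ₐ[R] Forms k R := CliffordAlgebra.involute

theorem one_mul_eq (m : Ω[R⁄k]) (x : Forms k R) : one k R m * x = invol k R x * one k R m := by
  induction x using ExteriorAlgebra.induction with
  | algebraMap r => rw [AlgHom.commutes]; exact (Algebra.commutes r _).symm
  | ι n =>
    have h := ExteriorAlgebra.ι_add_mul_swap (R := R) m n
    have h' : invol k R (ExteriorAlgebra.ι R n) = -ExteriorAlgebra.ι R n :=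
      CliffordAlgebra.involute_ι n
    rw [h', neg_mul]
    exact eq_neg_of_add_eq_zero_left h
  | mul x y hx hy => rw [← mul_assoc, hx, mul_assoc, hy, ← mul_assoc, map_mul]
  | add x y hx hy => rw [mul_add, hx, hy, map_add, add_mul]

/-- The algebra of matrices `(±ω, η; 0, ω)`; algebra maps `ω ↦ (±ω, Dω; 0, ω)` into it encode
graded derivations `D` of odd degree. -/
def triSubring : Subring (Matrix (Fin 2) (Fin 2) (Forms k R)) where
  carrier := {M | M 1 0 = 0 ∧ M 0 0 = invol k R (M 1 1)}
  mul_mem' := by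
    rintro M N ⟨h₁, h₂⟩ ⟨h₃, h₄⟩
    simp [Matrix.mul_apply, Fin.sum_univ_two, h₁, h₂, h₃, h₄]
  one_mem' := by simp
  add_mem' := by
    rintro M N ⟨h₁, h₂⟩ ⟨h₃, h₄⟩
    simp [h₁, h₂, h₃, h₄]
  zero_mem' := by simp
  neg_mem' := by
    rintro M ⟨h₁, h₂⟩
    simp [h₁, h₂]

/-- The ring of matrices `(±ω, η; 0, ω)`. -/
def Tri : Type _ := triSubring k R

instance : Ring (Tri k R) := inferInstanceAs (Ring (triSubring k R))

/-- A matrix `(±ω, η; 0, ω)`. -/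
def Tri.mk (ω η : Forms k R) : Tri k R := ⟨!![invol k R ω, η; 0, ω], by simp [triSubring]⟩

/-- The entry `ω`. -/
def Tri.diag (M : Tri k R) : Forms k R := M.1 1 1

/-- The entry `η`. -/
def Tri.off (M : Tri k R) : Forms k R := M.1 0 1

variable {k R} in
theorem Tri.ext {M N : Tri k R} (h : M.diag = N.diag) (h' : M.off = N.off) : M = N := by
  obtain ⟨M, hM⟩ := M
  obtain ⟨N, hN⟩ := N
  simp only [Tri.diag, Tri.off] at h h'
  refine Subtype.ext ?_
  ext i j
  fin_cases i <;> fin_cases j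
  · simp [hM.2, hN.2, h]
  · exact h'
  · simp [hM.1, hN.1]
  · exact h

variable {k R}

@[simp] theorem Tri.diag_mk (ω η) : (Tri.mk k R ω η).diag = ω := by simp [Tri.diag, Tri.mk]
@[simp] theorem Tri.off_mk (ω η) : (Tri.mk k R ω η).off = η := by simp [Tri.off, Tri.mk]
@[simp] theorem Tri.diag_add (M N : Tri k R) : (M + N).diag = M.diag + N.diag := rfl
@[simp] theorem Tri.off_add (M N : Tri k R) : (M + N).off = M.off + N.off := rfl
@[simp] theorem Tri.diag_zero : (0 : Tri k R).diag = 0 := rfl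
@[simp] theorem Tri.off_zero : (0 : Tri k R).off = 0 := rfl
@[simp] theorem Tri.diag_one : (1 : Tri k R).diag = 1 := rfl
@[simp] theorem Tri.off_one : (1 : Tri k R).off = 0 := rfl
@[simp] theorem Tri.diag_mul (M N : Tri k R) : (M * N).diag = M.diag * N.diag := by
  have h : M.1 1 0 = 0 := M.2.1
  change (M.1 * N.1) 1 1 = M.1 1 1 * N.1 1 1
  simp [Matrix.mul_apply, Fin.sum_univ_two, h]
@[simp] theorem Tri.off_mul (M N : Tri k R) :
    (M * N).off = invol k R M.diag * N.off + M.off * N.diag := by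
  have h : M.1 0 0 = invol k R (M.1 1 1) := M.2.2
  change (M.1 * N.1) 0 1 = invol k R (M.1 1 1) * N.1 0 1 + M.1 0 1 * N.1 1 1
  simp [Matrix.mul_apply, Fin.sum_univ_two, h]

variable (k R)

/-- The structure map `r ↦ (r, dr; 0, r)`. -/
def Tri.ofRing : R →+* Tri k R where
  toFun r := Tri.mk k R (algebraMap R _ r) (one k R (KaehlerDifferential.D k R r))
  map_one' := by apply Tri.ext <;> simp
  map_mul' r s := by
    apply Tri.ext
    · simp
    · rw [Tri.off_mul]
      simp only [Tri.off_mk, Tri.diag_mk, AlgHom.commutes, Derivation.leibniz, map_add, map_smul,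
        Algebra.smul_def]
      rw [← Algebra.commutes s]
  map_zero' := by apply Tri.ext <;> simp
  map_add' r s := by apply Tri.ext <;> simp

/-- The `R`-algebra structure on the triangular matrices given by `r ↦ (r, dr; 0, r)`. -/
instance Tri.algebra : Algebra R (Tri k R) :=
  RingHom.toAlgebra' (Tri.ofRing k R) fun r M => by
    apply Tri.ext
    · simp [Tri.ofRing, Algebra.commutes]
    · simp [Tri.ofRing, Algebra.commutes, one_mul_eq, add_comm]

instance : Module k (Tri k R) := Module.compHom _ (algebraMap k R)

instance : IsScalarTower k R (Tri k R) :=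
  IsScalarTower.of_algebraMap_smul fun _ _ => rfl

variable {k R} in
@[simp] theorem Tri.diag_smul (r : R) (M : Tri k R) : (r • M).diag = r • M.diag := by
  rw [Algebra.smul_def, Algebra.smul_def, Tri.diag_mul]
  congr 1

variable {k R} in
@[simp] theorem Tri.off_smul (r : R) (M : Tri k R) :
    (r • M).off = r • M.off + one k R (KaehlerDifferential.D k R r) * M.diag := by
  rw [Algebra.smul_def, Tri.off_mul]
  change invol k R (Tri.mk k R _ _).diag * _ + (Tri.mk k R _ _).off * _ = _
  rw [Tri.diag_mk, Tri.off_mk, AlgHom.commutes, Algebra.smul_def]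

variable {k R} in
@[simp] theorem Tri.diag_ksmul (c : k) (M : Tri k R) : (c • M).diag = c • M.diag := by
  rw [← algebraMap_smul R c M, Tri.diag_smul, algebraMap_smul]

variable {k R} in
@[simp] theorem Tri.off_ksmul (c : k) (M : Tri k R) : (c • M).off = c • M.off := by
  rw [← algebraMap_smul R c M, Tri.off_smul, algebraMap_smul]
  simp

/-- The derivation `s ↦ (ds, 0)`. -/
def Tri.der : Derivation k R (Tri k R) where
  toFun s := Tri.mk k R (one k R (KaehlerDifferential.D k R s)) 0
  map_add' s t := by apply Tri.ext <;> simp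
  map_smul' c s := by
    have e : one k R (c • KaehlerDifferential.D k R s) = c • one k R (KaehlerDifferential.D k R s) :=
      LinearMap.map_smul_of_tower _ c _
    apply Tri.ext <;> simp [e]
  map_one_eq_zero' := by apply Tri.ext <;> simp
  leibniz' s t := by
    apply Tri.ext
    · simp
    · have h := ExteriorAlgebra.ι_add_mul_swap (R := R) (KaehlerDifferential.D k R s)
        (KaehlerDifferential.D k R t)
      simp

/-- The map `r ds ↦ (r ds, dr ds)` on one-forms. -/
def Tri.ofOne : Ω[R⁄k] →ₗ[R] Tri k R := (Tri.der k R).liftKaehlerDifferential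

theorem Tri.ofOne_D (s : R) : Tri.ofOne k R (KaehlerDifferential.D k R s) =
    Tri.mk k R (one k R (KaehlerDifferential.D k R s)) 0 :=
  Derivation.liftKaehlerDifferential_comp_D _ _

theorem Tri.ofOne_spec (m : Ω[R⁄k]) : (Tri.ofOne k R m).diag = one k R m ∧
    ∀ x, (Tri.ofOne k R m).off * x = x * (Tri.ofOne k R m).off := by
  have hm : m ∈ Submodule.span R (Set.range (KaehlerDifferential.D k R)) := by
    rw [KaehlerDifferential.span_range_derivation]; trivial
  induction hm using Submodule.span_induction with
  | mem m hm =>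
    obtain ⟨s, rfl⟩ := hm
    rw [Tri.ofOne_D]
    simp
  | zero => simp
  | add m n _ _ h₁ h₂ =>
    simp [h₁.1, h₂.1, add_mul, mul_add, h₁.2, h₂.2]
  | smul r m _ h =>
    refine ⟨by simp [h.1], fun x => ?_⟩
    rw [map_smul, Tri.off_smul, h.1, add_mul, mul_add, smul_mul_assoc, h.2, mul_smul_comm,
      mul_assoc, one_mul_eq k R m, ← mul_assoc, one_mul_eq, mul_assoc]
    simp

/-- The algebra map `ω ↦ (±ω, dω; 0, ω)`. -/
def dHom : Forms k R →ₐ[R] Tri k R :=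
  ExteriorAlgebra.lift R ⟨Tri.ofOne k R, fun m => by
    obtain ⟨h, h'⟩ := Tri.ofOne_spec k R m
    apply Tri.ext
    · simp [h]
    · rw [Tri.off_mul, h, h']
      have : invol k R (one k R m) = -one k R m := CliffordAlgebra.involute_ι m
      rw [this]; simp⟩

theorem dHom_one (m : Ω[R⁄k]) : dHom k R (one k R m) = Tri.ofOne k R m :=
  ExteriorAlgebra.lift_ι_apply _ _ _ _

theorem diag_dHom (x : Forms k R) : (dHom k R x).diag = x := by
  induction x using ExteriorAlgebra.induction with
  | algebraMap r => rw [AlgHom.commutes]; exact Tri.diag_mk _ _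
  | ι m => exact (congrArg (Tri.diag k R) (dHom_one k R m)).trans (Tri.ofOne_spec k R m).1
  | mul x y hx hy => rw [map_mul, Tri.diag_mul, hx, hy]
  | add x y hx hy => rw [map_add, Tri.diag_add, hx, hy]

/-- The de Rham differential on algebraic differential forms: the graded derivation of degree `1`
with `r ↦ dr` and `dr ↦ 0` for `r ∈ R` (see `d_algebraMap`, `d_D`, `d_mul`). -/
def d : Forms k R →ₗ[k] Forms k R where
  toFun x := (dHom k R x).off
  map_add' x y := by simp
  map_smul' c x := by
    rw [← algebraMap_smul R c x, map_smul, algebraMap_smul, Tri.off_ksmul, RingHom.id_apply]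

@[simp] theorem d_algebraMap (r : R) :
    d k R (algebraMap R _ r) = one k R (KaehlerDifferential.D k R r) := by
  change (dHom k R (algebraMap R _ r)).off = _
  rw [AlgHom.commutes]; exact Tri.off_mk _ _

@[simp] theorem d_D (r : R) : d k R (one k R (KaehlerDifferential.D k R r)) = 0 := by
  change (dHom k R _).off = _
  rw [dHom_one, Tri.ofOne_D, Tri.off_mk]

theorem d_mul (x y : Forms k R) : d k R (x * y) = d k R x * y + invol k R x * d k R y := by
  change (dHom k R (x * y)).off = _
  rw [map_mul, Tri.off_mul, diag_dHom, diag_dHom, add_comm]; rfl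

variable {k R}

/-- The contraction `i_ξ` of differential forms with a vector field `ξ`: the graded `R`-linear
derivation of degree `-1` with `ds ↦ ξ(s)`. -/
def contr (ξ : Derivation k R R) : Forms k R →ₗ[k] Forms k R :=
  (CliffordAlgebra.contractLeft ξ.liftKaehlerDifferential).restrictScalars k

/-- The Lie derivative `L_ξ = d i_ξ + i_ξ d`. -/
def lie (ξ : Derivation k R R) : Forms k R →ₗ[k] Forms k R :=
  d k R ∘ₗ contr ξ + contr ξ ∘ₗ d k R

variable (k R)

/-- The space of `n`-forms. -/
def deg (n : ℕ) : Submodule k (Forms k R) := (⋀[R]^n (Ω[R⁄k])).restrictScalars k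

end Forms
end CommForms

/-! ### The representation scheme -/

section Rep

variable (k A V : Type*) [Field k] [Ring A] [Algebra k A] [AddCommGroup V] [Module k V]
  [FiniteDimensional k V]

/-- The algebra `End V`. -/
abbrev E : Type _ := Module.End k V

/-- The dimension of `End V`. -/
abbrev dimE : ℕ := Module.finrank k (E k V)

/-- A basis `e_r` of `End V`, used for coordinates. -/
def bas : Module.Basis (Fin (dimE k V)) k (E k V) := Module.finBasis k (E k V)

section Slice
variable {k V} {W W' : Type*} [AddCommGroup W] [Module k W] [AddCommGroup W'] [Module k W']

/-- The map `φ ⊗ id : End V ⊗ W → W`. -/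
def slice (φ : E k V →ₗ[k] k) : E k V ⊗[k] W →ₗ[k] W :=
  (TensorProduct.lid k W).toLinearMap ∘ₗ φ.rTensor W

@[simp] theorem slice_tmul (φ : E k V →ₗ[k] k) (e : E k V) (w : W) :
    slice φ (e ⊗ₜ[k] w) = φ e • w := by simp [slice]

theorem slice_lTensor (φ : E k V →ₗ[k] k) (f : W →ₗ[k] W') (z : E k V ⊗[k] W) :
    slice φ (f.lTensor (E k V) z) = f (slice φ z) := by
  induction z using TensorProduct.induction_on with
  | zero => simp
  | tmul e w => simp
  | add x y hx hy => simp [hx, hy]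

theorem sum_slice (z : E k V ⊗[k] W) :
    ∑ r, bas k V r ⊗ₜ[k] slice ((bas k V).coord r) z = z := by
  induction z using TensorProduct.induction_on with
  | zero => simp
  | tmul e w =>
    simp only [slice_tmul]
    conv_rhs => rw [← (bas k V).sum_repr e, TensorProduct.sum_tmul]
    simp [TensorProduct.smul_tmul]
  | add x y hx hy => simp [TensorProduct.tmul_add, Finset.sum_add_distrib, hx, hy]

theorem ext_slice {z z' : E k V ⊗[k] W}
    (h : ∀ r, slice ((bas k V).coord r) z = slice ((bas k V).coord r) z') : z = z' := by
  rw [← sum_slice z, ← sum_slice z']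
  simp [h]

end Slice

/-- The polynomial ring on the matrix coordinates of symbols `a ∈ A`. -/
abbrev GenPoly : Type _ := MvPolynomial (A × Fin (dimE k V)) k

/-- The generic endomorphism `∑ e_r ⊗ x_{a,r}` attached to the symbol `a`. -/
def genElt (a : A) : E k V ⊗[k] GenPoly k A V := ∑ r, bas k V r ⊗ₜ[k] MvPolynomial.X (a, r)

/-- The ideal expressing that `a ↦ ∑ e_r ⊗ x_{a,r}` is a unital algebra map. -/
def repIdeal : Ideal (GenPoly k A V) :=
  Ideal.span {f | ∃ r : Fin (dimE k V),
    (∃ a b : A, f = slice ((bas k V).coord r) (genElt k A V (a + b))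
      - slice ((bas k V).coord r) (genElt k A V a + genElt k A V b)) ∨
    (∃ (c : k) (a : A), f = slice ((bas k V).coord r) (genElt k A V (c • a))
      - slice ((bas k V).coord r) (c • genElt k A V a)) ∨
    (f = slice ((bas k V).coord r) (genElt k A V 1) - slice ((bas k V).coord r) 1) ∨
    (∃ a b : A, f = slice ((bas k V).coord r) (genElt k A V (a * b))
      - slice ((bas k V).coord r) (genElt k A V a * genElt k A V b))}

/-- The coordinate ring `k[Rep(A,V)]` of the scheme of representations of `A` in `V`; it represents
the functor `W ↦ Hom_{k-alg}(A, End V ⊗ W)` on commutative `k`-algebras (see `RepRing.lift`). -/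
def RepRing : Type _ := GenPoly k A V ⧸ repIdeal k A V

instance : CommRing (RepRing k A V) :=
  inferInstanceAs (CommRing (GenPoly k A V ⧸ repIdeal k A V))

instance : Algebra k (RepRing k A V) :=
  inferInstanceAs (Algebra k (GenPoly k A V ⧸ repIdeal k A V))

/-- The quotient map onto `k[Rep(A,V)]`. -/
def RepRing.mk : GenPoly k A V →ₐ[k] RepRing k A V := Ideal.Quotient.mkₐ k (repIdeal k A V)

variable {k A V} in
theorem slice_coord_genElt (a : A) (r : Fin (dimE k V)) :
    slice ((bas k V).coord r) (genElt k A V a) = MvPolynomial.X (a, r) := by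
  simp [genElt, Finsupp.single_apply, ite_smul]

namespace RepRing

/-- Reduction modulo the ideal of relations, on `End V`-valued functions. -/
def red : E k V ⊗[k] GenPoly k A V →ₐ[k] E k V ⊗[k] RepRing k A V :=
  Algebra.TensorProduct.map (AlgHom.id k _) (mk k A V)

variable {k A V} in
theorem red_eq {z z' : E k V ⊗[k] GenPoly k A V}
    (h : ∀ r, slice ((bas k V).coord r) z - slice ((bas k V).coord r) z' ∈ repIdeal k A V) :
    red k A V z = red k A V z' := by
  refine ext_slice fun r => ?_
  have e : ∀ z, red k A V z =
      (mk k A V).toLinearMap.lTensor (E k V) z := fun _ => rfl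
  rw [e, e, slice_lTensor, slice_lTensor]
  exact Ideal.Quotient.eq.2 (h r)

/-- The evaluation map `ev : A → End V ⊗ k[Rep(A,V)]`, `a ↦ â`. -/
def ev : A →ₐ[k] E k V ⊗[k] RepRing k A V :=
  AlgHom.ofLinearMap
    { toFun := fun a => red k A V (genElt k A V a)
      map_add' := fun a b => by
        rw [← map_add]
        exact red_eq fun r => Ideal.subset_span ⟨r, Or.inl ⟨a, b, rfl⟩⟩
      map_smul' := fun c a => by
        rw [← map_smul]
        exact red_eq fun r => Ideal.subset_span ⟨r, Or.inr (Or.inl ⟨c, a, rfl⟩)⟩ }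
    ((red_eq (z' := 1) fun r => Ideal.subset_span ⟨r, Or.inr (Or.inr (Or.inl rfl))⟩).trans
      (map_one (red k A V)))
    (fun a b => by
      change red k A V _ = red k A V _ * red k A V _
      rw [← map_mul]
      exact red_eq fun r => Ideal.subset_span ⟨r, Or.inr (Or.inr (Or.inr ⟨a, b, rfl⟩))⟩)

variable {k A V}

theorem slice_ev (a : A) (r : Fin (dimE k V)) : slice ((bas k V).coord r) (ev k A V a) =
    mk k A V (MvPolynomial.X (a, r)) := by
  change slice _ ((mk k A V).toLinearMap.lTensor (E k V)
    (genElt k A V a)) = _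
  rw [slice_lTensor, slice_coord_genElt]; rfl

variable {W : Type*} [CommRing W] [Algebra k W]

/-- The point of `Rep(A,V)` over `W` given by an algebra map `A → End V ⊗ W`. -/
def lift (f : A →ₐ[k] E k V ⊗[k] W) : RepRing k A V →ₐ[k] W :=
  Ideal.Quotient.liftₐ (repIdeal k A V)
    (MvPolynomial.aeval fun p => slice ((bas k V).coord p.2) (f p.1)) (by
      set φ : GenPoly k A V →ₐ[k] W :=
        MvPolynomial.aeval fun p => slice ((bas k V).coord p.2) (f p.1) with hφ
      let Φ : E k V ⊗[k] GenPoly k A V →ₐ[k] E k V ⊗[k] W :=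
        Algebra.TensorProduct.map (AlgHom.id k _) φ
      have e : ∀ (ψ : E k V →ₗ[k] k) z, φ (slice ψ z) = slice ψ (Φ z) := fun ψ z =>
        (slice_lTensor ψ φ.toLinearMap z).symm
      have g : ∀ a, Φ (genElt k A V a) = f a := fun a => by
        refine ext_slice fun r => ?_
        rw [← e, slice_coord_genElt, hφ, MvPolynomial.aeval_X]
      have le : repIdeal k A V ≤ RingHom.ker φ := by
        refine Ideal.span_le.2 ?_
        rintro _ ⟨r, ⟨a, b, rfl⟩ | ⟨c, a, rfl⟩ | rfl | ⟨a, b, rfl⟩⟩ <;>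
          simp only [SetLike.mem_coe, RingHom.mem_ker, map_sub] <;>
          rw [sub_eq_zero] <;> simp only [e, g, map_add, map_smul, map_mul, map_one]
      exact fun a ha => le ha)

theorem lift_mk_X (f : A →ₐ[k] E k V ⊗[k] W) (a : A) (r : Fin (dimE k V)) :
    lift f (mk k A V (MvPolynomial.X (a, r))) =
      slice ((bas k V).coord r) (f a) :=
  by
  exact MvPolynomial.aeval_X (R := k) (fun p : A × Fin (dimE k V) => slice ((bas k V).coord p.2) (f p.1)) (a, r)

theorem map_lift_ev (f : A →ₐ[k] E k V ⊗[k] W) (a : A) :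
    Algebra.TensorProduct.map (AlgHom.id k (E k V)) (lift f) (ev k A V a) = f a := by
  refine ext_slice fun r => ?_
  have h := slice_lTensor ((bas k V).coord r) (lift f).toLinearMap (ev k A V a)
  rw [slice_ev] at h
  exact h.trans (lift_mk_X f a r)

theorem hom_ext {f g : RepRing k A V →ₐ[k] W}
    (h : ∀ a, Algebra.TensorProduct.map (AlgHom.id k (E k V)) f (ev k A V a) =
      Algebra.TensorProduct.map (AlgHom.id k (E k V)) g (ev k A V a)) : f = g := by
  refine Ideal.Quotient.algHom_ext k ?_
  refine MvPolynomial.algHom_ext fun p => ?_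
  have hf := slice_lTensor ((bas k V).coord p.2) f.toLinearMap (ev k A V p.1)
  have hg := slice_lTensor ((bas k V).coord p.2) g.toLinearMap (ev k A V p.1)
  rw [slice_ev] at hf hg
  exact hf.symm.trans ((congrArg _ (h p.1)).trans hg)

end RepRing

/-! ### The infinitesimal action of `GL(V)` -/

section Action

variable {k V}

/-- The algebra map `a ↦ u f(a) u⁻¹`. -/
def conjHom {A C : Type*} [Ring A] [Algebra k A] [Ring C] [Algebra k C] (f : A →ₐ[k] C) (u : Cˣ) :
    A →ₐ[k] C where
  toFun a := u * f a * ↑u⁻¹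
  map_one' := by simp
  map_mul' a b := by simp [mul_assoc]
  map_zero' := by simp
  map_add' a b := by simp [mul_add, add_mul]
  commutes' c := by
    rw [AlgHom.commutes, ← Algebra.commutes, mul_assoc, Units.mul_inv, mul_one]

/-- The element `1 + ε x` of `GL(V)(R[ε]) = (End V ⊗ R[ε])ˣ`. -/
def onePlus (R : Type*) [CommRing R] [Algebra k R] (x : E k V) : (E k V ⊗[k] DualNumber R)ˣ where
  val := 1 + x ⊗ₜ[k] DualNumber.eps
  inv := 1 - x ⊗ₜ[k] DualNumber.eps
  val_inv := by
    rw [mul_sub, add_mul, add_mul, Algebra.TensorProduct.tmul_mul_tmul, DualNumber.eps_mul_eps,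
      TensorProduct.tmul_zero]
    simp only [one_mul, mul_one]; abel
  inv_val := by
    rw [mul_add, sub_mul, sub_mul, Algebra.TensorProduct.tmul_mul_tmul, DualNumber.eps_mul_eps,
      TensorProduct.tmul_zero]
    simp only [one_mul, mul_one]; abel

section
variable {R : Type*} [CommRing R] [Algebra k R]

theorem onePlus_val (x : E k V) : (onePlus R x : E k V ⊗[k] DualNumber R) =
    1 + x ⊗ₜ[k] DualNumber.eps := rfl

theorem onePlus_inv (x : E k V) : ((onePlus R x)⁻¹ : (E k V ⊗[k] DualNumber R)ˣ).val =
    1 - x ⊗ₜ[k] DualNumber.eps := rfl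

/-- The inclusion `End V ⊗ R → End V ⊗ R[ε]`. -/
def inclEps : E k V ⊗[k] R →ₐ[k] E k V ⊗[k] DualNumber R :=
  Algebra.TensorProduct.map (AlgHom.id k (E k V)) (TrivSqZeroExt.inlAlgHom k R R)

theorem fst_conj (x : E k V) (z : E k V ⊗[k] R) :
    Algebra.TensorProduct.map (AlgHom.id k (E k V)) (TrivSqZeroExt.fstHom k R R)
      (onePlus R x * inclEps z * ↑(onePlus R x)⁻¹) = z := by
  rw [onePlus_val, onePlus_inv]
  rw [map_mul, map_mul, map_add, map_sub, map_one]
  have h : Algebra.TensorProduct.map (AlgHom.id k (E k V)) (TrivSqZeroExt.fstHom k R R)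
      (x ⊗ₜ[k] DualNumber.eps) = 0 := by simp
  rw [h, add_zero, sub_zero, one_mul, mul_one]
  induction z using TensorProduct.induction_on with
  | zero => simp
  | tmul e r => simp [inclEps]
  | add z w hz hw => rw [map_add, map_add, hz, hw]

theorem snd_conj (x : E k V) (z : E k V ⊗[k] R) :
    (TrivSqZeroExt.sndHom R R |>.restrictScalars k).lTensor (E k V)
      (onePlus R x * inclEps z * ↑(onePlus R x)⁻¹) = x ⊗ₜ[k] 1 * z - z * x ⊗ₜ[k] 1 := by
  rw [onePlus_val, onePlus_inv]
  induction z using TensorProduct.induction_on with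
  | zero => simp
  | tmul e r =>
    simp only [inclEps, Algebra.TensorProduct.map_tmul, AlgHom.coe_id, id_eq, add_mul, mul_sub,
      one_mul, mul_one, Algebra.TensorProduct.tmul_mul_tmul, map_sub, map_add,
      LinearMap.lTensor_tmul]
    simp
  | add z w hz hw =>
    rw [map_add, mul_add, add_mul, map_add, hz, hw, mul_add, add_mul]; abel

end

/-- The algebra map `f ↦ f + ε x⃗(f)`, i.e. the function `f` evaluated at the conjugate
`a ↦ (1 + ε x) ρ(a) (1 + ε x)⁻¹` of the universal representation `ρ`. -/
def flow (x : E k V) : RepRing k A V →ₐ[k] DualNumber (RepRing k A V) :=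
  RepRing.lift (conjHom (inclEps.comp (RepRing.ev k A V)) (onePlus (RepRing k A V) x))

theorem fst_flow (x : E k V) (f : RepRing k A V) : (flow A x f).fst = f := by
  have h : (TrivSqZeroExt.fstHom k (RepRing k A V) (RepRing k A V)).comp (flow A x) =
      AlgHom.id k _ := by
    refine RepRing.hom_ext fun a => ?_
    have e : Algebra.TensorProduct.map (AlgHom.id k (E k V))
        ((TrivSqZeroExt.fstHom k (RepRing k A V) (RepRing k A V)).comp (flow A x)) =
        (Algebra.TensorProduct.map (AlgHom.id k (E k V)) (TrivSqZeroExt.fstHom k _ _)).comp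
          (Algebra.TensorProduct.map (AlgHom.id k (E k V)) (flow A x)) := by
      ext <;> simp
    rw [e, AlgHom.comp_apply, flow, RepRing.map_lift_ev, Algebra.TensorProduct.map_id]
    exact fst_conj x _
  exact DFunLike.congr_fun h f

/-- The vector field `x⃗` on `Rep(A,V)` generating the action `g(ρ) = g ρ g⁻¹` of `GL(V)`: the
derivative of the function `f` along `ε ↦ (1 + ε x)(ρ)`. -/
def act (x : E k V) : Derivation k (RepRing k A V) (RepRing k A V) where
  toFun f := (flow A x f).snd
  map_add' f g := by simp
  map_smul' c f := by simp
  map_one_eq_zero' := by simp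
  leibniz' f g := by simp [fst_flow, mul_comm]

/-- `x⃗` acts on the `End V`-valued function `â` as the commutator `[x, â]`. -/
theorem act_ev (x : E k V) (a : A) :
    (act A x).toLinearMap.lTensor (E k V) (RepRing.ev k A V a) =
      x ⊗ₜ[k] 1 * RepRing.ev k A V a - RepRing.ev k A V a * x ⊗ₜ[k] 1 := by
  rw [← snd_conj]
  have h := RepRing.map_lift_ev
    (conjHom (inclEps.comp (RepRing.ev k A V)) (onePlus (RepRing k A V) x)) a
  change _ = onePlus (RepRing k A V) x * inclEps (RepRing.ev k A V a) *
    ↑(onePlus (RepRing k A V) x)⁻¹ at h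
  rw [← h]
  have e : (act A x).toLinearMap = (TrivSqZeroExt.sndHom (RepRing k A V) (RepRing k A V)
      |>.restrictScalars k) ∘ₗ (flow A x).toLinearMap := rfl
  rw [e, LinearMap.lTensor_comp]
  rfl

end Action
end Rep

/-! ### Equivariant and basic forms on the representation scheme -/

section Equivariant

variable (k A V : Type*) [Field k] [Ring A] [Algebra k A] [AddCommGroup V] [Module k V]
  [FiniteDimensional k V]

/-- Differential forms on `Rep(A,V)`. -/
abbrev RepForms : Type _ := Forms k (RepRing k A V)

/-- The algebra `k[𝔤]` of polynomial functions on `𝔤 = End V`; the variable `y_r` is the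
coordinate `e_r^*`. -/
abbrev PolyG : Type _ := MvPolynomial (Fin (dimE k V)) k

/-- The algebra `Ω(Rep(A,V), 𝔤) = Ω(Rep(A,V)) ⊗ k[𝔤]`. -/
abbrev EqForms : Type _ := RepForms k A V ⊗[k] PolyG k V

variable {k V} in
/-- The infinitesimal adjoint action of `x ∈ 𝔤` on `k[𝔤]`: the derivative of `f` along
`ε ↦ (1 + ε x) y (1 + ε x)⁻¹ = y + ε [x, y]`. -/
def adPoly (x : E k V) : Derivation k (PolyG k V) (PolyG k V) :=
  MvPolynomial.mkDerivation k fun r =>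
    ∑ s, (bas k V).coord r (x * bas k V s - bas k V s * x) • MvPolynomial.X s

variable {k V} in
/-- The diagonal action of `x ∈ 𝔤` on `Ω(Rep(A,V), 𝔤)`. -/
def eqLie (x : E k V) : EqForms k A V →ₗ[k] EqForms k A V :=
  (Forms.lie (act A x)).rTensor _ + (adPoly x).toLinearMap.lTensor _

/-- The invariants `Ω(Rep(A,V), 𝔤)^𝔤`. -/
def eqInvariants : Submodule k (EqForms k A V) := ⨅ x : E k V, LinearMap.ker (eqLie A x)

/-- The differential `d_DR = d ⊗ id`. -/
def dDR : EqForms k A V →ₗ[k] EqForms k A V := (Forms.d k (RepRing k A V)).rTensor _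

/-- The differential `d_𝔤 : ω ⊗ f ↦ ∑ i_{e_r} ω ⊗ e_r^* f`. -/
def dG : EqForms k A V →ₗ[k] EqForms k A V :=
  ∑ r, TensorProduct.map (Forms.contr (act A (bas k V r)))
    (LinearMap.mulLeft k (MvPolynomial.X r))

/-- The bigraded piece of `Ω(Rep(A,V), 𝔤)` spanned by `ω ⊗ f` with `ω` a `q`-form and `f`
homogeneous of polynomial degree `p`; its total degree is `2p + q`. -/
def EqForms.bideg (p q : ℕ) : Submodule k (EqForms k A V) :=
  Submodule.span k {w | ∃ ω ∈ Forms.deg k (RepRing k A V) q,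
    ∃ f ∈ MvPolynomial.homogeneousSubmodule (Fin (dimE k V)) k p, w = ω ⊗ₜ[k] f}

/-- Basic forms on `Rep(A,V)`: those killed by all `L_x` and `i_x`, `x ∈ 𝔤`. -/
def basic : Submodule k (RepForms k A V) :=
  ⨅ x : E k V, LinearMap.ker (Forms.lie (act A x)) ⊓ LinearMap.ker (Forms.contr (act A x))

/-- Basic `n`-forms. -/
def basicDeg (n : ℕ) : Submodule k (RepForms k A V) :=
  basic k A V ⊓ Forms.deg k (RepRing k A V) n

/-! ### The evaluation map on forms -/

/-- The inclusion of functions into `Ω(Rep(A,V))`. -/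
def funForms : RepRing k A V →ₐ[k] RepForms k A V := IsScalarTower.toAlgHom k _ _

/-- The evaluation map `a ↦ â`, with values in `End V ⊗ Ω⁰(Rep(A,V))`. -/
def evForms : A →ₐ[k] E k V ⊗[k] RepForms k A V :=
  (Algebra.TensorProduct.map (AlgHom.id k _) (funForms k A V)).comp (RepRing.ev k A V)

/-- The linear map `a ↦ d â`. -/
def dEvForms : A →ₗ[k] E k V ⊗[k] RepForms k A V :=
  (Forms.d k (RepRing k A V)).lTensor _ ∘ₗ (evForms k A V).toLinearMap

/-- The trace `Tr ⊗ id`. -/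
def tr {k V : Type*} [Field k] [AddCommGroup V] [Module k V] {W : Type*} [AddCommGroup W]
    [Module k W] : E k V ⊗[k] W →ₗ[k] W :=
  slice (LinearMap.trace k V)

/-- The algebra `End V ⊗ Ω(Rep(A,V), 𝔤)`. -/
def EndForms : Type _ := E k V ⊗[k] EqForms k A V

instance : Ring (EndForms k A V) := inferInstanceAs (Ring (E k V ⊗[k] EqForms k A V))
instance : Algebra k (EndForms k A V) := inferInstanceAs (Algebra k (E k V ⊗[k] EqForms k A V))

/-- The pure tensor `e ⊗ w`. -/
def EndForms.tmul (e : E k V) (w : EqForms k A V) : EndForms k A V := e ⊗ₜ[k] w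

/-- The tautological element `t̂ = ∑ e_r ⊗ e_r^*` of `End V ⊗ k[𝔤]`. -/
def tHat : EndForms k A V := ∑ r, EndForms.tmul k A V (bas k V r) (1 ⊗ₜ[k] MvPolynomial.X r)

/-- The inclusion of `End V ⊗ Ω(Rep(A,V))` into `End V ⊗ Ω(Rep(A,V), 𝔤)`. -/
def inclEnd : E k V ⊗[k] RepForms k A V →ₐ[k] EndForms k A V :=
  (Algebra.TensorProduct.map (AlgHom.id k (E k V)) Algebra.TensorProduct.includeLeft :
    E k V ⊗[k] RepForms k A V →ₐ[k] E k V ⊗[k] EqForms k A V)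

/-- The evaluation map on `A_t`, `a ↦ â` and `t ↦ t̂`. -/
def evT : At k A →ₐ[k] EndForms k A V :=
  FreeProd.lift
    ((inclEnd k A V).comp (evForms k A V))
    (Polynomial.aeval (tHat k A V))

/-- The differential `id ⊗ d_DR` on `End V ⊗ Ω(Rep(A,V), 𝔤)`. -/
def dEnd : EndForms k A V →ₗ[k] EndForms k A V :=
  (dDR k A V).lTensor (E k V)

/-- The sign involution on `Ω(Rep(A,V), 𝔤)`. -/
def eqInvol : EqForms k A V →ₐ[k] EqForms k A V :=
  Algebra.TensorProduct.map ((Forms.invol k (RepRing k A V)).restrictScalars k) (AlgHom.id k _)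

/-- The sign involution on `End V ⊗ Ω(Rep(A,V), 𝔤)`. -/
def endInvol : EndForms k A V →ₐ[k] EndForms k A V :=
  (Algebra.TensorProduct.map (AlgHom.id k (E k V)) (eqInvol k A V) :
    E k V ⊗[k] EqForms k A V →ₐ[k] E k V ⊗[k] EqForms k A V)

section Leibniz
variable {k} {C W : Type*} [Ring C] [Algebra k C] [Ring W] [Algebra k W]

theorem rTensor_leibniz (D : W →ₗ[k] W) (σ : W →ₐ[k] W)
    (h : ∀ x y, D (x * y) = D x * y + σ x * D y) (x y : W ⊗[k] C) :
    D.rTensor C (x * y) = D.rTensor C x * y +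
      Algebra.TensorProduct.map σ (AlgHom.id k C) x * D.rTensor C y := by
  induction x using TensorProduct.induction_on with
  | zero => simp
  | add x x' hx hx' => rw [add_mul, map_add, map_add, map_add, hx, hx']; simp only [add_mul]; abel
  | tmul ω f =>
    induction y using TensorProduct.induction_on with
    | zero => simp
    | add y y' hy hy' => rw [mul_add, map_add, map_add, hy, hy']; simp only [mul_add]; abel
    | tmul η g => simp [h, TensorProduct.add_tmul]

theorem lTensor_leibniz (D : W →ₗ[k] W) (σ : W →ₐ[k] W)
    (h : ∀ x y, D (x * y) = D x * y + σ x * D y) (x y : C ⊗[k] W) :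
    D.lTensor C (x * y) = D.lTensor C x * y +
      Algebra.TensorProduct.map (AlgHom.id k C) σ x * D.lTensor C y := by
  induction x using TensorProduct.induction_on with
  | zero => simp
  | add x x' hx hx' => rw [add_mul, map_add, map_add, map_add, hx, hx']; simp only [add_mul]; abel
  | tmul ω f =>
    induction y using TensorProduct.induction_on with
    | zero => simp
    | add y y' hy hy' => rw [mul_add, map_add, map_add, hy, hy']; simp only [mul_add]; abel
    | tmul η g => simp [h, TensorProduct.tmul_add]

theorem leibniz_one (D : W →ₗ[k] W) (σ : W →ₐ[k] W)
    (h : ∀ x y, D (x * y) = D x * y + σ x * D y) : D 1 = 0 := by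
  have h := h 1 1
  simpa using h

theorem leibniz_pow (D : W →ₗ[k] W) (σ : W →ₐ[k] W)
    (h : ∀ x y, D (x * y) = D x * y + σ x * D y) (x : W) (hx : D x = 0) (n : ℕ) :
    D (x ^ n) = 0 := by
  induction n with
  | zero => rw [pow_zero]; exact leibniz_one D σ h
  | succ n ih => rw [pow_succ, h, ih, hx]; simp

theorem leibniz_aeval (D : W →ₗ[k] W) (σ : W →ₐ[k] W)
    (h : ∀ x y, D (x * y) = D x * y + σ x * D y) (x : W) (hx : D x = 0) (p : Polynomial k) :
    D (Polynomial.aeval x p) = 0 := by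
  induction p using Polynomial.induction_on' with
  | add p q hp hq => rw [map_add, map_add, hp, hq, add_zero]
  | monomial n c =>
    rw [Polynomial.aeval_monomial, ← Algebra.smul_def, map_smul, leibniz_pow D σ h x hx, smul_zero]

end Leibniz

theorem dDR_mul (x y : EqForms k A V) :
    dDR k A V (x * y) = dDR k A V x * y + eqInvol k A V x * dDR k A V y :=
  rTensor_leibniz (Forms.d k (RepRing k A V))
    ((Forms.invol k (RepRing k A V)).restrictScalars k) (Forms.d_mul k _) x y

theorem dEnd_mul (x y : EndForms k A V) :
    dEnd k A V (x * y) = dEnd k A V x * y + endInvol k A V x * dEnd k A V y :=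
  lTensor_leibniz (dDR k A V) (eqInvol k A V) (dDR_mul k A V) x y

theorem dDR_tmul (ω : RepForms k A V) (f : PolyG k V) :
    dDR k A V (ω ⊗ₜ[k] f) = Forms.d k (RepRing k A V) ω ⊗ₜ[k] f := rfl

theorem endInvol_tmul (e : E k V) (ω : RepForms k A V) (f : PolyG k V) :
    endInvol k A V (e ⊗ₜ[k] (ω ⊗ₜ[k] f) : E k V ⊗[k] EqForms k A V) =
      (e ⊗ₜ[k] (Forms.invol k (RepRing k A V) ω ⊗ₜ[k] f) : E k V ⊗[k] EqForms k A V) := rfl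

theorem endInvol_tHat : endInvol k A V (tHat k A V) = tHat k A V := by
  rw [tHat, map_sum]
  refine Finset.sum_congr rfl fun r _ => ?_
  exact (endInvol_tmul k A V _ _ _).trans (by rw [map_one]; rfl)

theorem dEnd_tHat : dEnd k A V (tHat k A V) = 0 := by
  rw [tHat, map_sum]
  refine Finset.sum_eq_zero fun r _ => ?_
  have h : Forms.d k (RepRing k A V) 1 = 0 := by
    rw [← map_one (algebraMap (RepRing k A V) (RepForms k A V)), Forms.d_algebraMap]; simp
  change (bas k V r ⊗ₜ[k] (Forms.d k (RepRing k A V) 1 ⊗ₜ[k] MvPolynomial.X r) :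
    E k V ⊗[k] EqForms k A V) = 0
  rw [h, TensorProduct.zero_tmul, TensorProduct.tmul_zero]

theorem evT_inl (a : A) : evT k A V (FreeProd.inl k A _ a) = inclEnd k A V (evForms k A V a) :=
  FreeProd.lift_inl _ _ a

theorem evT_inr (p : Polynomial k) :
    evT k A V (FreeProd.inr k A _ p) = Polynomial.aeval (tHat k A V) p :=
  FreeProd.lift_inr _ _ p

theorem endInvol_evT (b : At k A) : endInvol k A V (evT k A V b) = evT k A V b := by
  have h : (endInvol k A V).comp (evT k A V) = evT k A V := by
    refine FreeProd.hom_ext (fun a => ?_) (fun p => ?_)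
    · rw [AlgHom.comp_apply, evT_inl, evForms, AlgHom.comp_apply]
      induction RepRing.ev k A V a using TensorProduct.induction_on with
      | zero => simp only [map_zero]
      | add x y hx hy => simp only [map_add, hx, hy]
      | tmul e r =>
        change (e ⊗ₜ[k] (Forms.invol k (RepRing k A V) (algebraMap _ _ r) ⊗ₜ[k] 1) :
            E k V ⊗[k] EqForms k A V) =
          e ⊗ₜ[k] (algebraMap (RepRing k A V) (RepForms k A V) r ⊗ₜ[k] 1)
        rw [AlgHom.commutes]
    · rw [AlgHom.comp_apply, evT_inr, ← Polynomial.aeval_algHom_apply, endInvol_tHat]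
  exact DFunLike.congr_fun h b

theorem dEnd_evT_mem (s : At k A) (hs : s ∈ kt k A) : dEnd k A V (evT k A V s) = 0 := by
  obtain ⟨p, rfl⟩ := hs
  change dEnd k A V (evT k A V (FreeProd.inr k A _ p)) = 0
  rw [evT_inr]
  exact leibniz_aeval (dEnd k A V) (endInvol k A V) (dEnd_mul k A V) _ (dEnd_tHat k A V) p

/-- The evaluation map on forms, `ev_Ω : Ω_t A → End V ⊗ Ω(Rep(A,V), 𝔤)`,
`b₀ db₁ … dbₙ ↦ b̂₀ d_DR b̂₁ … d_DR b̂ₙ`. -/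
def evOmega : OmegaT k A →ₐ[k] EndForms k A V :=
  NCForms.lift (evT k A V) (dEnd k A V ∘ₗ (evT k A V).toLinearMap)
    (fun b b' => by
      change dEnd k A V (evT k A V (b * b')) = dEnd k A V (evT k A V b) * evT k A V b' +
        evT k A V b * dEnd k A V (evT k A V b')
      rw [map_mul, dEnd_mul, endInvol_evT])
    (dEnd_evT_mem k A V)

/-- The trace of the evaluation map, `b₀ db₁ … dbₙ ↦ Tr(b̂₀ d_DR b̂₁ … d_DR b̂ₙ)`. -/
def trEvOmega : OmegaT k A →ₗ[k] EqForms k A V where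
  toFun ω := tr (evOmega k A V ω : E k V ⊗[k] EqForms k A V)
  map_add' x y := by rw [map_add]; exact map_add tr _ _
  map_smul' c x := by rw [map_smul]; exact map_smul tr _ _

end Equivariant

/-! ### Hochschild homology and Connes' differential -/

section Hochschild

variable (k A : Type*) [Field k] [Ring A] [Algebra k A]

/-- Hochschild `n`-chains of `A` with coefficients in `A`: the space `A^{⊗ (n+1)}`. -/
abbrev HChain (n : ℕ) : Type _ := ⨂[k] _ : Fin (n + 1), A

variable {A} in
/-- A map of tuples such that changing one entry of the argument changes only one entry of the
value, and this in a linear way; it then induces a linear map of tensor powers. -/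
def SlotLinear {m n : ℕ} (φ : (Fin m → A) → (Fin n → A)) : Prop :=
  ∀ (a : Fin m → A) (i : Fin m), ∃ (s : Fin n) (L : A →ₗ[k] A),
    ∀ x, φ (Function.update a i x) = Function.update (φ a) s (L x)

variable {k A} in
/-- The linear map `a₁ ⊗ … ⊗ a_m ↦ ⨂ φ(a₁,…,a_m)`. -/
def SlotLinear.map {m n : ℕ} {φ : (Fin m → A) → (Fin n → A)} (h : SlotLinear k φ) :
    (⨂[k] _ : Fin m, A) →ₗ[k] ⨂[k] _ : Fin n, A :=
  PiTensorProduct.lift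
    { toFun := fun a => PiTensorProduct.tprod k (φ a)
      map_update_add' := fun {dec} a i x y => by
        obtain rfl : dec = instDecidableEqFin m := Subsingleton.elim _ _
        obtain ⟨s, L, hL⟩ := h a i
        rw [hL, hL, hL, map_add, MultilinearMap.map_update_add]
      map_update_smul' := fun {dec} a i c x => by
        obtain rfl : dec = instDecidableEqFin m := Subsingleton.elim _ _
        obtain ⟨s, L, hL⟩ := h a i
        rw [hL, hL, map_smul, MultilinearMap.map_update_smul] }

theorem slotLinear_contract {n : ℕ} (j : Fin (n + 1)) :
    SlotLinear k (fun a : Fin (n + 2) → A => Fin.contractNth j.castSucc (· * ·) a) := by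
  intro a i
  rcases lt_trichotomy (i : ℕ) j with h | h | h
  · refine ⟨⟨i, by omega⟩, LinearMap.id, fun x => ?_⟩
    ext l
    simp only [Fin.contractNth, Function.update_apply, Fin.ext_iff, Fin.val_castSucc,
      Fin.val_succ, LinearMap.id_apply, LinearMap.mulRight_apply, LinearMap.mulLeft_apply]
    grind
  · refine ⟨j, LinearMap.mulRight k (a j.succ), fun x => ?_⟩
    ext l
    simp only [Fin.contractNth, Function.update_apply, Fin.ext_iff, Fin.val_castSucc,
      Fin.val_succ, LinearMap.id_apply, LinearMap.mulRight_apply, LinearMap.mulLeft_apply]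
    grind
  · by_cases h' : (i : ℕ) = j + 1
    · refine ⟨j, LinearMap.mulLeft k (a j.castSucc), fun x => ?_⟩
      ext l
      simp only [Fin.contractNth, Function.update_apply, Fin.ext_iff, Fin.val_castSucc,
      Fin.val_succ, LinearMap.id_apply, LinearMap.mulRight_apply, LinearMap.mulLeft_apply]
      grind
    · refine ⟨⟨i - 1, by omega⟩, LinearMap.id, fun x => ?_⟩
      ext l
      simp only [Fin.contractNth, Function.update_apply, Fin.ext_iff, Fin.val_castSucc,
      Fin.val_succ, LinearMap.id_apply, LinearMap.mulRight_apply, LinearMap.mulLeft_apply]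
      grind

theorem slotLinear_rotate (n : ℕ) :
    SlotLinear k (fun (a : Fin (n + 1) → A) j => a (j - 1)) := fun a i =>
  ⟨i + 1, LinearMap.id, fun x => by
    ext l
    simp only [Function.update_apply, LinearMap.id_apply, sub_eq_iff_eq_add]⟩

theorem slotLinear_cons (n : ℕ) :
    SlotLinear k (fun a : Fin n → A => (Fin.cons 1 a : Fin (n + 1) → A)) := fun a i =>
  ⟨i.succ, LinearMap.id, fun x => by simp⟩

namespace HChain

/-- The face `a₀ ⊗ … ⊗ a_{n+1} ↦ a₀ ⊗ … ⊗ a_j a_{j+1} ⊗ … ⊗ a_{n+1}`, `0 ≤ j ≤ n`. -/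
def face {n : ℕ} (j : Fin (n + 1)) : HChain k A (n + 1) →ₗ[k] HChain k A n :=
  (slotLinear_contract k A j).map

/-- The rotation `a₀ ⊗ … ⊗ a_n ↦ a_n ⊗ a₀ ⊗ … ⊗ a_{n-1}`. -/
def rotate (n : ℕ) : HChain k A n →ₗ[k] HChain k A n := (slotLinear_rotate k A n).map

/-- The map `a₀ ⊗ … ⊗ a_n ↦ 1 ⊗ a₀ ⊗ … ⊗ a_n`. -/
def extra (n : ℕ) : HChain k A n →ₗ[k] HChain k A (n + 1) := (slotLinear_cons k A (n + 1)).map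

/-- The Hochschild differential `b` on `(n+1)`-chains,
`∑_{j ≤ n} (-1)^j (a₀,…,a_j a_{j+1},…,a_{n+1}) + (-1)^{n+1} (a_{n+1} a₀, a₁,…,a_n)`. -/
def b (n : ℕ) : HChain k A (n + 1) →ₗ[k] HChain k A n :=
  ∑ j : Fin (n + 1), (-1 : k) ^ (j : ℕ) • face k A j +
    (-1 : k) ^ (n + 1) • (face k A 0 ∘ₗ rotate k A (n + 1))

/-- The signed cyclic operator `t_n = (-1)^n · rotation`. -/
def cyc (n : ℕ) : HChain k A n →ₗ[k] HChain k A n := (-1 : k) ^ n • rotate k A n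

/-- Connes' operator `B = (1 - t) s N`, where `N = ∑_{i ≤ n} t^i`. -/
def connesB (n : ℕ) : HChain k A n →ₗ[k] HChain k A (n + 1) :=
  (LinearMap.id - cyc k A (n + 1)) ∘ₗ extra k A n ∘ₗ ∑ i ∈ Finset.range (n + 1), cyc k A n ^ i

/-- Hochschild cycles. -/
def cycles : (n : ℕ) → Submodule k (HChain k A n)
  | 0 => ⊤
  | n + 1 => LinearMap.ker (b k A n)

/-- Hochschild boundaries. -/
def boundaries (n : ℕ) : Submodule k (HChain k A n) := LinearMap.range (b k A n)

end HChain

/-- The Hochschild homology `H_n(A, A)`. -/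
abbrev HH (n : ℕ) : Type _ :=
  HChain.cycles k A n ⧸ (HChain.boundaries k A n).comap (HChain.cycles k A n).subtype

variable (V : Type*) [AddCommGroup V] [Module k V] [FiniteDimensional k V]

/-- The map `a₀ ⊗ … ⊗ a_n ↦ Tr(â₀ dâ₁ … dâ_n)` on Hochschild chains. -/
def HChain.trEv (n : ℕ) : HChain k A n →ₗ[k] RepForms k A V :=
  tr ∘ₗ PiTensorProduct.lift ((MultilinearMap.mkPiAlgebraFin k (n + 1) _).compLinearMap
    fun i => if i = 0 then (evForms k A V).toLinearMap else dEvForms k A V)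

end Hochschild

end NCRep

end

/-! Almost every identity below is an equality of two maps that obey the same Leibniz rule, ordinary
or twisted by the sign `(-1)^n`, so it is enough to check it on generators; the rest is cyclicity of
the trace. Both halves rest on one computation: since `x⃗(â) = [x, â]`, contraction gives `i_x dâ =
[x, â]` (`contr_dEvForms`; in the equivariant setting `gEnd_dEnd_evT`, where summing over `e_r` with
weight `e_r^*` gives `[t̂, â]`).

Hochschild side. By the Leibniz rule the alternating sum of the contractions of a word `dâ₁ ⋯ dâ_n`
telescopes, and its two ends cancel under the trace against the outer faces, so `Tr(â₀ dâ₁ ⋯ dâ_n)`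
vanishes on boundaries (`trEv_b`). If the constant matrix `x` is inserted in all positions of the
word, telescoping fails exactly by the alternating sum of words in which one `dâ_i` becomes `[x,
â_i]`, and this sum is `i_x` of the word. Hence `i_x ∘ ev` factors through `b` (`contr_trEv`) and
kills cycles. Already on chains `ev(B c) = (n+1) d ev(c)` (`trEv_connesB`): in `B = (1 - t) s N` the
map `s` puts `1` in front and `a₀` under `d`; the summand with `t s` puts `1` under `d` and dies;
the `n + 1` summands of `N` agree by graded cyclicity. As `b B = -B b`, `B c` is a cycle when `c`
is, so `(n+1) i_x d ev(c) = 0`. Dividing by `n + 1`, Cartan's formula yields `L_x ev(c) = 0`: Lie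
invariance is a consequence of Connes' operator and needs no separate calculation. The relations `b
B = -B b` and `B² = 0` follow from `b (1 - t) = (1 - t) b'`, `b' N = N b`, `b' s + s b' = 1` and `N
(1 - t) = (1 - t) N = 0`, where `b'` omits the wrap-around face.

Equivariant side. The evaluation `Ω_t A → End V ⊗ Ω ⊗ k[𝔤]` is an algebra map that carries `d` to
`d_DR` and `i_Δ` to `d_𝔤`, and on its image the diagonal action of `x` is `[x, ·]` (`evOmega_d`,
`evOmega_contr`, `lieEnd_evOmega`). The trace therefore takes invariant values, and it kills
super-commutators because forms are graded commutative. The square of `d + i_Δ` is `[t, ·]`, which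
dies in `DR_t A`. The square of `d_DR + d_𝔤` is `∑ e_r^* L_{e_r}`; on invariants it equals `-∑ e_r^*
ad(e_r)`, which is zero by antisymmetry of the bracket. -/

noncomputable section

namespace NCRep

/-! ### Twisted derivations -/

section TwistedDer

variable {k W : Type*} [Field k] [Ring W] [Algebra k W]

/-- A linear map satisfying the Leibniz rule twisted by the algebra map `σ`. -/
def IsTwistedDer (σ : W →ₐ[k] W) (D : W →ₗ[k] W) : Prop :=
  ∀ x y, D (x * y) = D x * y + σ x * D y

namespace IsTwistedDer

variable {σ : W →ₐ[k] W} {D D' : W →ₗ[k] W}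

theorem map_one (h : IsTwistedDer σ D) : D 1 = 0 := leibniz_one D σ h

theorem zero (σ : W →ₐ[k] W) : IsTwistedDer σ 0 := by
  intro x y; simp

theorem add (h : IsTwistedDer σ D) (h' : IsTwistedDer σ D') : IsTwistedDer σ (D + D') := by
  intro x y
  simp only [LinearMap.add_apply, h x y, h' x y, add_mul, mul_add]
  abel

theorem sum {ι : Type*} {s : Finset ι} {D : ι → W →ₗ[k] W} (h : ∀ i, IsTwistedDer σ (D i)) :
    IsTwistedDer σ (∑ i ∈ s, D i) := by
  intro x y
  simp only [LinearMap.sum_apply, h _ x y, Finset.sum_add_distrib, Finset.sum_mul, Finset.mul_sum]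

/-- The anticommutator of two odd derivations is a derivation. -/
theorem anticomm (h : IsTwistedDer σ D) (h' : IsTwistedDer σ D') (hσ : ∀ x, σ (σ x) = x)
    (hD : ∀ x, σ (D x) = -D (σ x)) (hD' : ∀ x, σ (D' x) = -D' (σ x)) :
    IsTwistedDer (AlgHom.id k W) (D ∘ₗ D' + D' ∘ₗ D) := by
  intro x y
  simp only [LinearMap.add_apply, LinearMap.comp_apply, h x y, h' x y, map_add, h _ _, h' _ _, hσ,
    hD, hD', AlgHom.id_apply, add_mul, mul_add, neg_mul]
  abel

/-- The square of an odd derivation is a derivation. -/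
theorem square (h : IsTwistedDer σ D) (hσ : ∀ x, σ (σ x) = x)
    (hD : ∀ x, σ (D x) = -D (σ x)) :
    IsTwistedDer (AlgHom.id k W) (D ∘ₗ D) := by
  intro x y
  simp only [LinearMap.comp_apply, h x y, map_add, h _ _, hσ,
    hD, AlgHom.id_apply, neg_mul]
  abel

/-- The commutator of an even and an odd derivation is an odd derivation. -/
theorem comm {L : W →ₗ[k] W} (hL : IsTwistedDer (AlgHom.id k W) L) (h : IsTwistedDer σ D)
    (hLσ : ∀ x, L (σ x) = σ (L x)) : IsTwistedDer σ (L ∘ₗ D - D ∘ₗ L) := by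
  intro x y
  simp only [LinearMap.sub_apply, LinearMap.comp_apply, h x y, hL x y, map_add, h _ _, hL _ _, hLσ,
    AlgHom.id_apply, sub_mul, mul_sub]
  abel

/-- The multiplicative step of every comparison on generators: the elements where two derivations
with the same twist agree are closed under products. -/
theorem eq_mul (h : IsTwistedDer σ D) (h' : IsTwistedDer σ D') {x y : W} (hx : D x = D' x)
    (hy : D y = D' y) : D (x * y) = D' (x * y) := by
  rw [h, h', hx, hy]

/-- The even derivation `[u, ·]`. It is what a Lie derivative becomes after evaluation, with `u` the
constant matrix `x`, and what `d i_Δ + i_Δ d` equals, with `u = t`. -/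
theorem inner (u : W) : IsTwistedDer (AlgHom.id k W)
    (LinearMap.mulLeft k u - LinearMap.mulRight k u) := by
  intro x y
  simp [sub_mul, mul_sub, mul_assoc]

end IsTwistedDer

end TwistedDer

/-! ### Operators on the factors of a tensor product -/

section TensorOperators

variable {k W P : Type*} [Field k] [AddCommGroup W] [Module k W] [AddCommGroup P] [Module k P]

theorem rTensor_anticomm {f g : W →ₗ[k] W} (h : ∀ ω, f (g ω) = -g (f ω)) (w : W ⊗[k] P) :
    f.rTensor P (g.rTensor P w) = -g.rTensor P (f.rTensor P w) := by
  induction w using TensorProduct.induction_on with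
  | zero => simp
  | tmul ω p => simp only [LinearMap.rTensor_tmul, h, TensorProduct.neg_tmul]
  | add z z' h h' => rw [map_add, map_add, map_add, map_add, h, h', neg_add]

theorem rTensor_comp_add_comp (f g : W →ₗ[k] W) (w : W ⊗[k] P) :
    f.rTensor P (g.rTensor P w) + g.rTensor P (f.rTensor P w) =
      (f ∘ₗ g + g ∘ₗ f).rTensor P w := by
  rw [LinearMap.rTensor_add, LinearMap.rTensor_comp, LinearMap.rTensor_comp]
  rfl

/-- The commutator of a diagonal operator with an operator on the first factor. -/
theorem diagonal_rTensor {L c c' : W →ₗ[k] W} (q : P →ₗ[k] P)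
    (h : ∀ ω, L (c ω) = c (L ω) + c' ω) (w : W ⊗[k] P) :
    (L.rTensor P + q.lTensor W) (c.rTensor P w) =
      c.rTensor P ((L.rTensor P + q.lTensor W) w) + c'.rTensor P w := by
  induction w using TensorProduct.induction_on with
  | zero => simp
  | tmul ω p =>
    simp only [LinearMap.add_apply, LinearMap.rTensor_tmul, LinearMap.lTensor_tmul, map_add, h,
      TensorProduct.add_tmul]
    abel
  | add z z' h h' => simp only [map_add, h, h']; abel

/-- A diagonal operator commutes with an operator on the first factor if the factors do. -/
theorem diagonal_rTensor_comm {L c : W →ₗ[k] W} (q : P →ₗ[k] P)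
    (h : ∀ ω, L (c ω) = c (L ω)) (w : W ⊗[k] P) :
    (L.rTensor P + q.lTensor W) (c.rTensor P w) =
      c.rTensor P ((L.rTensor P + q.lTensor W) w) := by
  have h := diagonal_rTensor (c' := 0) q (fun ω => (h ω).trans (add_zero _).symm) w
  rwa [LinearMap.rTensor_zero, LinearMap.zero_apply, add_zero] at h

end TensorOperators

/-! ### Operators on algebraic differential forms -/

namespace Forms

variable {k R : Type*} [Field k] [CommRing R] [Algebra k R]

/-- One-forms are spanned over `R` by exact differentials, so functions and the `dr` generate all
forms as a ring. -/
theorem induction {P : Forms k R → Prop} (halg : ∀ r, P (algebraMap R _ r))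
    (hD : ∀ r, P (one k R (KaehlerDifferential.D k R r)))
    (hmul : ∀ x y, P x → P y → P (x * y)) (hadd : ∀ x y, P x → P y → P (x + y)) (x : Forms k R) :
    P x := by
  induction x using ExteriorAlgebra.induction with
  | algebraMap r => exact halg r
  | ι m =>
    have hm : m ∈ Submodule.span R (Set.range (KaehlerDifferential.D k R)) := by
      rw [KaehlerDifferential.span_range_derivation]; trivial
    induction hm using Submodule.span_induction with
    | mem m hm => obtain ⟨s, rfl⟩ := hm; exact hD s
    | zero => rw [map_zero, ← map_zero (algebraMap R (Forms k R))]; exact halg 0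
    | add m n _ _ h₁ h₂ => rw [map_add]; exact hadd _ _ h₁ h₂
    | smul r m _ h => rw [map_smul, Algebra.smul_def]; exact hmul _ _ (halg r) h
  | mul x y hx hy => exact hmul x y hx hy
  | add x y hx hy => exact hadd x y hx hy

/-- The sign involution, as a `k`-algebra map. -/
abbrev kinvol (k R : Type*) [Field k] [CommRing R] [Algebra k R] : Forms k R →ₐ[k] Forms k R :=
  (invol k R).restrictScalars k

theorem kinvol_kinvol (x : Forms k R) : kinvol k R (kinvol k R x) = x :=
  CliffordAlgebra.involute_involute x

theorem kinvol_algebraMap (r : R) : kinvol k R (algebraMap R _ r) = algebraMap R _ r :=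
  AlgHom.commutes (invol k R) r

theorem kinvol_one (m : Ω[R⁄k]) : kinvol k R (one k R m) = -one k R m :=
  CliffordAlgebra.involute_ι m

/-- Turns each identity of the Cartan calculus into a check on `r` and on `dr`. -/
theorem ext_der {σ : Forms k R →ₐ[k] Forms k R} {D D' : Forms k R →ₗ[k] Forms k R}
    (h : IsTwistedDer σ D) (h' : IsTwistedDer σ D')
    (halg : ∀ r, D (algebraMap R _ r) = D' (algebraMap R _ r))
    (hD : ∀ r, D (one k R (KaehlerDifferential.D k R r)) =
      D' (one k R (KaehlerDifferential.D k R r))) : D = D' := by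
  refine LinearMap.ext fun x => ?_
  induction x using induction with
  | halg r => exact halg r
  | hD r => exact hD r
  | hmul x y hx hy => exact h.eq_mul h' hx hy
  | hadd x y hx hy => rw [map_add, map_add, hx, hy]

theorem d_isTwistedDer : IsTwistedDer (kinvol k R) (d k R) := d_mul k R

theorem kinvol_d (x : Forms k R) : kinvol k R (d k R x) = -d k R (kinvol k R x) := by
  induction x using induction with
  | halg r => rw [d_algebraMap, kinvol_one, kinvol_algebraMap, d_algebraMap]
  | hD r => rw [d_D, kinvol_one, map_neg, d_D]; simp
  | hmul x y hx hy =>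
    rw [d_isTwistedDer x y, map_mul, d_isTwistedDer, map_add, map_mul, map_mul, hx, hy]
    simp only [kinvol_kinvol]; noncomm_ring
  | hadd x y hx hy => simp only [map_add, hx, hy, neg_add]

/-- The square of an odd derivation is an even derivation, and this one vanishes on `r` and on `dr`.
-/
theorem d_d (x : Forms k R) : d k R (d k R x) = 0 := by
  have h := ext_der ((d_isTwistedDer (k := k) (R := R)).square kinvol_kinvol kinvol_d)
    (IsTwistedDer.zero _) (fun r => by simp) (fun r => by simp)
  exact LinearMap.congr_fun h x

/-! ### Contractions, Lie derivatives and Cartan's identities. -/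

section Contr

variable (ξ η : Derivation k R R)

theorem contr_algebraMap (r : R) : contr ξ (algebraMap R (Forms k R) r) = 0 :=
  CliffordAlgebra.contractLeft_algebraMap (Q := (0 : QuadraticForm R (Ω[R⁄k])))
    ξ.liftKaehlerDifferential r

theorem contr_D (r : R) :
    contr ξ (one k R (KaehlerDifferential.D k R r)) = algebraMap R _ (ξ r) := by
  refine (CliffordAlgebra.contractLeft_ι (Q := (0 : QuadraticForm R (Ω[R⁄k])))
    (d := ξ.liftKaehlerDifferential) _).trans ?_
  rw [Derivation.liftKaehlerDifferential_comp_D]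

theorem contr_isTwistedDer : IsTwistedDer (kinvol k R) (contr ξ) := by
  intro x y
  -- The product case applies the hypothesis on `x` to `x' * y`, so `y` has to vary.
  induction x using ExteriorAlgebra.induction generalizing y with
  | algebraMap r =>
    have h := CliffordAlgebra.contractLeft_algebraMap_mul (Q := (0 : QuadraticForm R (Ω[R⁄k])))
      ξ.liftKaehlerDifferential r y
    rw [contr_algebraMap, zero_mul, zero_add, kinvol_algebraMap]
    exact h
  | ι m =>
    have h := CliffordAlgebra.contractLeft_ι_mul (Q := (0 : QuadraticForm R (Ω[R⁄k])))
      (d := ξ.liftKaehlerDifferential) m y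
    have h' := CliffordAlgebra.contractLeft_ι (Q := (0 : QuadraticForm R (Ω[R⁄k])))
      (d := ξ.liftKaehlerDifferential) m
    have e : contr ξ (one k R m) = algebraMap R _ (ξ.liftKaehlerDifferential m) := h'
    rw [e, kinvol_one, neg_mul, ← sub_eq_add_neg, ← Algebra.smul_def]
    exact h
  | mul x x' hx hx' =>
    rw [mul_assoc, hx, hx', hx x', map_mul]
    noncomm_ring
  | add x x' hx hx' => rw [add_mul, map_add, hx, hx', map_add, map_add]; noncomm_ring

theorem kinvol_contr (x : Forms k R) :
    kinvol k R (contr ξ x) = -contr ξ (kinvol k R x) := by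
  induction x using induction with
  | halg r => rw [contr_algebraMap, kinvol_algebraMap, contr_algebraMap]; simp
  | hD r => rw [contr_D, kinvol_one, map_neg, contr_D, kinvol_algebraMap, neg_neg]
  | hmul x y hx hy =>
    rw [contr_isTwistedDer ξ x y, map_mul, contr_isTwistedDer, map_add, map_mul, map_mul, hx, hy]
    simp only [kinvol_kinvol]; noncomm_ring
  | hadd x y hx hy => simp only [map_add, hx, hy, neg_add]

theorem contr_comm (x : Forms k R) : contr ξ (contr η x) = -contr η (contr ξ x) :=
  CliffordAlgebra.contractLeft_comm (Q := (0 : QuadraticForm R (Ω[R⁄k])))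
    (d := ξ.liftKaehlerDifferential) (d' := η.liftKaehlerDifferential) x

theorem lie_apply (x : Forms k R) : lie ξ x = d k R (contr ξ x) + contr ξ (d k R x) := rfl

/-- Cartan's formula. The scalar is there because the Hochschild argument controls only `(n+1) d ω`;
it is applied with `c = n + 1`. -/
theorem lie_eq_zero {x : Forms k R} {c : k} (hc : c ≠ 0) (h : contr ξ x = 0)
    (hd : contr ξ (c • d k R x) = 0) : lie ξ x = 0 := by
  rw [map_smul] at hd
  rw [lie_apply, h, (smul_eq_zero.1 hd).resolve_left hc, map_zero, add_zero]

theorem contr_d_eq_zero {x : Forms k R} (h : contr ξ x = 0) (hl : lie ξ x = 0) :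
    contr ξ (d k R x) = 0 := by
  rwa [lie_apply, h, map_zero, zero_add] at hl

theorem lie_isTwistedDer : IsTwistedDer (AlgHom.id k _) (lie (k := k) ξ) :=
  d_isTwistedDer.anticomm (contr_isTwistedDer ξ) kinvol_kinvol kinvol_d (kinvol_contr ξ)

theorem lie_algebraMap (r : R) :
    lie ξ (algebraMap R (Forms k R) r) = algebraMap R _ (ξ r) := by
  rw [lie_apply, contr_algebraMap, d_algebraMap, contr_D, map_zero, zero_add]

/-- By Cartan's formula and `d² = 0` both sides equal `d i_ξ d x`. -/
theorem lie_d (x : Forms k R) : lie ξ (d k R x) = d k R (lie ξ x) := by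
  rw [lie_apply, lie_apply, map_add, d_d, d_d, map_zero, add_zero, zero_add]

theorem lie_kinvol (x : Forms k R) : lie ξ (kinvol k R x) = kinvol k R (lie ξ x) := by
  rw [lie_apply, lie_apply, map_add, kinvol_d, kinvol_contr, kinvol_contr, kinvol_d]
  simp

/-- Both sides are odd derivations that vanish on functions. On `dr` the Lie derivative passes
through `d`, which leaves `ξ(η r) - η(ξ r)`. -/
theorem lie_contr (x : Forms k R) :
    lie ξ (contr η x) - contr η (lie ξ x) = contr ⁅ξ, η⁆ x := by
  have h := ext_der ((lie_isTwistedDer ξ).comm (contr_isTwistedDer η) (lie_kinvol ξ))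
    (contr_isTwistedDer ⁅ξ, η⁆) (fun r => by
      simp [lie_algebraMap, contr_algebraMap]) (fun r => by
      simp only [LinearMap.sub_apply, LinearMap.comp_apply, contr_D, lie_algebraMap]
      rw [← d_algebraMap, lie_d, lie_algebraMap, d_algebraMap, contr_D, ← map_sub]
      rfl)
  exact LinearMap.congr_fun h x

theorem lie_contr_of_eq {ζ : Derivation k R R} (h : ⁅ξ, η⁆ = ζ) (x : Forms k R) :
    lie ξ (contr η x) = contr η (lie ξ x) + contr ζ x := by
  rw [← h, ← lie_contr, add_sub_cancel]

theorem lie_d_eq_zero {x : Forms k R} (h : lie ξ x = 0) : lie ξ (d k R x) = 0 := by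
  rw [lie_d, h, map_zero]

theorem contr_add (x : Forms k R) : contr (ξ + η) x = contr ξ x + contr η x := by
  have h := ext_der (contr_isTwistedDer (ξ + η))
    ((contr_isTwistedDer ξ).add (contr_isTwistedDer η))
    (fun r => by simp [contr_algebraMap]) (fun r => by simp [contr_D])
  exact LinearMap.congr_fun h x

theorem contr_smul (c : k) (x : Forms k R) : contr (c • ξ) x = c • contr ξ x := by
  have e : IsTwistedDer (kinvol k R) (c • contr (k := k) ξ) := by
    intro x y
    simp [contr_isTwistedDer ξ x y]
  have h := ext_der (contr_isTwistedDer (c • ξ)) e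
    (fun r => by simp [contr_algebraMap])
    (fun r => by
      rw [contr_D, LinearMap.smul_apply, contr_D, Derivation.smul_apply, ← algebraMap_smul R c,
        ← algebraMap_smul R c, Algebra.smul_def, Algebra.smul_def, map_mul]
      rfl)
  exact LinearMap.congr_fun h x

variable (k R) in
/-- The contraction, as a linear function of the vector field. -/
def contrₗ : Derivation k R R →ₗ[k] Forms k R →ₗ[k] Forms k R where
  toFun ξ := contr ξ
  map_add' ξ η := LinearMap.ext fun x => contr_add ξ η x
  map_smul' c ξ := LinearMap.ext fun x => contr_smul ξ c x

end Contr

/-! ### The grading by form degree and graded commutativity. -/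

section Degree

theorem algebraMap_mem_deg (r : R) : algebraMap R (Forms k R) r ∈ deg k R 0 := by
  change algebraMap R _ r ∈ ⋀[R]^0 (Ω[R⁄k])
  rw [ExteriorAlgebra.exteriorPower, pow_zero]
  exact Submodule.mem_one.2 ⟨r, rfl⟩

theorem one_mem_deg (m : Ω[R⁄k]) : one k R m ∈ deg k R 1 := by
  change one k R m ∈ ⋀[R]^1 (Ω[R⁄k])
  rw [ExteriorAlgebra.exteriorPower, pow_one]
  exact LinearMap.mem_range_self _ m

theorem mul_mem_deg {p q : ℕ} {x y : Forms k R} (hx : x ∈ deg k R p) (hy : y ∈ deg k R q) :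
    x * y ∈ deg k R (p + q) := by
  change x * y ∈ ⋀[R]^(p + q) (Ω[R⁄k])
  rw [ExteriorAlgebra.exteriorPower, pow_add]
  exact Submodule.mul_mem_mul hx hy

/-- `P` is only assumed additive, not stable under multiplication by functions, so the coefficient
`r` is carried along in the spanning elements `r · ds · x`. -/
theorem deg_succ_induction {n : ℕ} {P : Forms k R → Prop}
    (hadd : ∀ x y, P x → P y → P (x + y))
    (hmul : ∀ r s x, x ∈ deg k R n →
      P (algebraMap R _ r * (one k R (KaehlerDifferential.D k R s) * x)))
    {x : Forms k R} (hx : x ∈ deg k R (n + 1)) : P x := by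
  have h0 : P 0 := by simpa using hmul 0 0 0 (zero_mem _)
  change x ∈ ⋀[R]^(n + 1) (Ω[R⁄k]) at hx
  rw [ExteriorAlgebra.exteriorPower, pow_succ'] at hx
  induction hx using Submodule.mul_induction_on' with
  | mem_mul_mem m hm y hy =>
    obtain ⟨m, rfl⟩ := hm
    have hm : m ∈ Submodule.span R (Set.range (KaehlerDifferential.D k R)) := by
      rw [KaehlerDifferential.span_range_derivation]; trivial
    induction hm using Submodule.span_induction with
    | mem m hm => obtain ⟨s, rfl⟩ := hm; simpa using hmul 1 s y hy
    | zero => simpa using h0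
    | add m n _ _ h₁ h₂ => rw [map_add, add_mul]; exact hadd _ _ h₁ h₂
    | smul r m _ h =>
      -- Knowing `P` for `m` says nothing about `r • m`, so the span induction on `m` is run again
      -- with `r` arbitrary.
      clear h
      have hm' : m ∈ Submodule.span R (Set.range (KaehlerDifferential.D k R)) := by
        rw [KaehlerDifferential.span_range_derivation]; trivial
      induction hm' using Submodule.span_induction generalizing r with
      | mem m hm =>
        obtain ⟨s, rfl⟩ := hm
        rw [map_smul, Algebra.smul_def, mul_assoc]; exact hmul r s y hy
      | zero => simpa using h0
      | add m n hm hn h₁ h₂ =>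
        rw [smul_add, map_add, add_mul]; exact hadd _ _ (h₁ r hm) (h₂ r hn)
      | smul r' m hm h => rw [smul_smul]; exact h _ hm
  | add x _ y _ hx hy => exact hadd x y hx hy

theorem deg_induction {P : ℕ → Forms k R → Prop}
    (hadd : ∀ n x y, P n x → P n y → P n (x + y))
    (halg : ∀ r, P 0 (algebraMap R _ r))
    (hmul : ∀ n r s x, x ∈ deg k R n → P n x →
      P (n + 1) (algebraMap R _ r * (one k R (KaehlerDifferential.D k R s) * x)))
    {n : ℕ} {x : Forms k R} (hx : x ∈ deg k R n) : P n x := by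
  induction n generalizing x with
  | zero =>
    change x ∈ ⋀[R]^0 (Ω[R⁄k]) at hx
    rw [ExteriorAlgebra.exteriorPower, pow_zero] at hx
    obtain ⟨r, rfl⟩ := Submodule.mem_one.1 hx
    exact halg r
  | succ n ih =>
    exact deg_succ_induction (hadd (n + 1)) (fun r s x hx => hmul n r s x hx (ih hx)) hx

theorem d_mem_deg {n : ℕ} {x : Forms k R} (hx : x ∈ deg k R n) : d k R x ∈ deg k R (n + 1) := by
  refine deg_induction (P := fun n x => d k R x ∈ deg k R (n + 1))
    ?_ ?_ ?_ hx
  · intro n x y hx hy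
    rw [map_add]; exact add_mem hx hy
  · intro r
    rw [d_algebraMap]; exact one_mem_deg _
  · intro n r s x hx h
    -- The computation is `d(r ds x) = dr ds x - r ds dx`; both terms have degree `n + 2`.
    rw [d_isTwistedDer, d_isTwistedDer, d_algebraMap, d_D, zero_mul, zero_add, kinvol_algebraMap,
      kinvol_one, neg_mul, mul_neg, ← sub_eq_add_neg]
    have h₁ := mul_mem_deg (one_mem_deg (KaehlerDifferential.D k R r))
      (mul_mem_deg (one_mem_deg (KaehlerDifferential.D k R s)) hx)
    have h₂ := mul_mem_deg (algebraMap_mem_deg r)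
      (mul_mem_deg (one_mem_deg (KaehlerDifferential.D k R s)) h)
    rw [show 1 + (1 + n) = n + 1 + 1 by ring] at h₁
    rw [show 0 + (1 + (n + 1)) = n + 1 + 1 by ring] at h₂
    exact sub_mem h₁ h₂

theorem kinvol_of_mem {n : ℕ} {x : Forms k R} (hx : x ∈ deg k R n) :
    kinvol k R x = (-1 : k) ^ n • x := by
  refine deg_induction (P := fun n x => kinvol k R x = (-1 : k) ^ n • x)
    ?_ ?_ ?_ hx
  · intro n x y hx hy
    rw [map_add, hx, hy, smul_add]
  · intro r
    rw [kinvol_algebraMap, pow_zero, one_smul]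
  · intro n r s x hx h
    rw [map_mul, map_mul, kinvol_algebraMap, kinvol_one, h, pow_succ]
    simp

theorem one_mul_of_mem (m : Ω[R⁄k]) {q : ℕ} {y : Forms k R} (hy : y ∈ deg k R q) :
    one k R m * y = (-1 : k) ^ q • (y * one k R m) := by
  have h : one k R m * y = kinvol k R y * one k R m := one_mul_eq k R m y
  rw [h, kinvol_of_mem hy, smul_mul_assoc]

/-- Forms are graded commutative. -/
theorem mul_comm_of_mem {p q : ℕ} {x y : Forms k R} (hx : x ∈ deg k R p) (hy : y ∈ deg k R q) :
    x * y = (-1 : k) ^ (p * q) • (y * x) := by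
  refine deg_induction (P := fun n x => x * y = (-1 : k) ^ (n * q) • (y * x)) ?_ ?_ ?_ hx
  · intro n x y hx hy
    rw [add_mul, mul_add, hx, hy, smul_add]
  · intro r
    rw [Nat.zero_mul, pow_zero, one_smul]
    exact Algebra.commutes r y
  · intro n r s x _ h
    have hs := one_mul_of_mem (KaehlerDifferential.D k R s) hy
    have hr := Algebra.commutes r y
    generalize one k R (KaehlerDifferential.D k R s) = D at *
    generalize algebraMap R (Forms k R) r = a at *
    calc a * (D * x) * y = a * (D * (x * y)) := by rw [mul_assoc, mul_assoc]
      _ = (-1 : k) ^ (n * q) • (a * ((D * y) * x)) := by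
        rw [h, mul_smul_comm, mul_smul_comm, mul_assoc D]
      _ = (-1 : k) ^ (n * q + q) • ((a * y) * (D * x)) := by
        rw [hs, smul_mul_assoc, mul_smul_comm, smul_smul, pow_add, mul_assoc y, mul_assoc a]
      _ = (-1 : k) ^ ((n + 1) * q) • (y * (a * (D * x))) := by
        rw [hr, mul_assoc y, Nat.succ_mul]

end Degree

end Forms

/-! ### The Lie algebra of vector fields generating the action -/

section Action

variable {k V : Type*} [Field k] [AddCommGroup V] [Module k V]

section
variable {W W' : Type*} [Ring W] [Algebra k W] [Ring W'] [Algebra k W']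

theorem lTensor_const_mul (f : W →ₗ[k] W) (x : E k V) (z : E k V ⊗[k] W) :
    f.lTensor (E k V) (x ⊗ₜ[k] 1 * z) = x ⊗ₜ[k] 1 * f.lTensor (E k V) z := by
  induction z using TensorProduct.induction_on with
  | zero => simp
  | tmul e w => simp
  | add z z' h h' => simp only [mul_add, map_add, h, h']

theorem lTensor_mul_const (f : W →ₗ[k] W) (x : E k V) (z : E k V ⊗[k] W) :
    f.lTensor (E k V) (z * x ⊗ₜ[k] 1) = f.lTensor (E k V) z * x ⊗ₜ[k] 1 := by
  induction z using TensorProduct.induction_on with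
  | zero => simp
  | tmul e w => simp
  | add z z' h h' => simp only [add_mul, map_add, h, h']

end

variable [FiniteDimensional k V] (A : Type*) [Ring A] [Algebra k A]

variable {A} in
-- The coordinate ring is generated by the matrix entries of the `â`, so a derivation is determined
-- by its effect on them.
theorem RepRing.derivation_ext {D D' : Derivation k (RepRing k A V) (RepRing k A V)}
    (h : ∀ a, D.toLinearMap.lTensor (E k V) (RepRing.ev k A V a) =
      D'.toLinearMap.lTensor (E k V) (RepRing.ev k A V a)) : D = D' := by
  refine Derivation.ext fun f => ?_
  obtain ⟨p, rfl⟩ := Ideal.Quotient.mk_surjective (I := repIdeal k A V) f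
  change D (RepRing.mk k A V p) = D' (RepRing.mk k A V p)
  induction p using MvPolynomial.induction_on with
  | C c =>
    have e : RepRing.mk k A V (MvPolynomial.C c) = algebraMap k _ c :=
      (RepRing.mk k A V).commutes c
    rw [e, Derivation.map_algebraMap, Derivation.map_algebraMap]
  | add p q hp hq => rw [map_add, map_add, map_add, hp, hq]
  | mul_X p i hp =>
    have hX : D (RepRing.mk k A V (MvPolynomial.X i)) =
        D' (RepRing.mk k A V (MvPolynomial.X i)) := by
      have e := congrArg (slice ((bas k V).coord i.2)) (h i.1)
      rw [slice_lTensor, slice_lTensor, RepRing.slice_ev] at e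
      exact e
    rw [map_mul, Derivation.leibniz, Derivation.leibniz, hp, hX]

theorem act_add (x y : E k V) : act A (x + y) = act A x + act A y := by
  refine RepRing.derivation_ext fun a => ?_
  have e : (act A x + act A y).toLinearMap =
    (act A x).toLinearMap + (act A y).toLinearMap := rfl
  rw [e, LinearMap.lTensor_add, LinearMap.add_apply, act_ev, act_ev, act_ev,
    TensorProduct.add_tmul]
  noncomm_ring

theorem act_smul (c : k) (x : E k V) : act A (c • x) = c • act A x := by
  refine RepRing.derivation_ext fun a => ?_
  have e : (c • act A x).toLinearMap = c • (act A x).toLinearMap := rfl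
  rw [e, LinearMap.lTensor_smul, LinearMap.smul_apply, act_ev, act_ev,
    ← TensorProduct.smul_tmul', smul_mul_assoc, mul_smul_comm, smul_sub]

/-- The Jacobi identity `[x, [y, z]] - [y, [x, z]] = [[x, y], z]`, in the shape in which it arises
from composing two vector fields. -/
theorem comm_comm_sub {C : Type*} [Ring C] (x y z : C) :
    x * (y * z - z * y) - (y * z - z * y) * x - (y * (x * z - z * x) - (x * z - z * x) * y) =
      (x * y - y * x) * z - z * (x * y - y * x) := by
  noncomm_ring

/-- The matrix `x` is constant on the scheme, so applying `y⃗` to `[x, â]` gives `[x, [y, â]]`: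
composition reverses the order of the matrices. Hence `x ↦ x⃗` reverses brackets. -/
theorem act_lie (x y : E k V) : ⁅act A y, act A x⁆ = act A (x * y - y * x) := by
  refine RepRing.derivation_ext fun a => ?_
  have e : (⁅act A y, act A x⁆).toLinearMap =
    (act A y).toLinearMap ∘ₗ (act A x).toLinearMap -
      (act A x).toLinearMap ∘ₗ (act A y).toLinearMap := rfl
  have h : ∀ x y : E k V, (x * y) ⊗ₜ[k] (1 : RepRing k A V) = x ⊗ₜ[k] 1 * y ⊗ₜ[k] 1 := by
    intro x y; simp
  rw [e, LinearMap.lTensor_sub, LinearMap.lTensor_comp, LinearMap.lTensor_comp,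
    LinearMap.sub_apply, LinearMap.comp_apply, LinearMap.comp_apply, act_ev, act_ev, act_ev,
    map_sub, map_sub, lTensor_const_mul, lTensor_mul_const, lTensor_const_mul, lTensor_mul_const,
    act_ev, act_ev, TensorProduct.sub_tmul, h, h]
  exact comm_comm_sub _ _ _

/-- The vector fields generating the action, as a linear function of the element of `End V`. -/
def actₗ : E k V →ₗ[k] Derivation k (RepRing k A V) (RepRing k A V) where
  toFun x := act A x
  map_add' := act_add A
  map_smul' := act_smul A

end Action

/-! ### Operators on equivariant forms -/

section Equivariant

/-- Exchanging the two indices shows that the sum equals its own negative, and `2` is invertible. On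
the equivariant side the characteristic enters only through this lemma. -/
theorem sum_sum_eq_zero_of_antisymm {k M ι : Type*} [Field k] [CharZero k] [AddCommGroup M]
    [Module k M] [Fintype ι] (f : ι → ι → M) (h : ∀ i j, f i j = -f j i) :
    ∑ i, ∑ j, f i j = 0 := by
  have e : ∑ i, ∑ j, f i j = -∑ i, ∑ j, f i j := by
    conv_lhs => rw [Finset.sum_comm]
    simp only [← Finset.sum_neg_distrib]
    exact Finset.sum_congr rfl fun i _ => Finset.sum_congr rfl fun j _ => h j i
  have e₂ : (2 : k) • ∑ i, ∑ j, f i j = 0 := by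
    rw [two_smul]; nth_rw 1 [e]; exact neg_add_cancel _
  exact (smul_eq_zero.1 e₂).resolve_left two_ne_zero

variable {k V : Type*} [Field k] [AddCommGroup V] [Module k V] [FiniteDimensional k V]
  (A : Type*) [Ring A] [Algebra k A]

/-- The coordinate function `e_r^*` as an element of `Ω(Rep(A,V), 𝔤)`. -/
def coordForm (k A V : Type*) [Field k] [Ring A] [Algebra k A] [AddCommGroup V] [Module k V]
    [FiniteDimensional k V] (r : Fin (dimE k V)) : EqForms k A V :=
  (1 : RepForms k A V) ⊗ₜ[k] (MvPolynomial.X r : PolyG k V)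

theorem EqForms.mul_neg (w z : EqForms k A V) : w * -z = -(w * z) := _root_.mul_neg w z

theorem EqForms.mul_smul (c : k) (w z : EqForms k A V) : w * c • z = c • (w * z) :=
  mul_smul_comm c w z

theorem const_mul_comm (f : PolyG k V) (w : EqForms k A V) :
    ((1 : RepForms k A V) ⊗ₜ[k] f) * w = w * ((1 : RepForms k A V) ⊗ₜ[k] f) := by
  induction w using TensorProduct.induction_on with
  | zero => simp
  | tmul ω g => simp [mul_comm]
  | add z z' h h' => rw [mul_add, add_mul, h, h']

theorem coordForm_mul_comm (r : Fin (dimE k V)) (w : EqForms k A V) :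
    coordForm k A V r * w = w * coordForm k A V r := const_mul_comm A _ w

theorem rTensor_const_mul (f : RepForms k A V →ₗ[k] RepForms k A V) (p : PolyG k V)
    (w : EqForms k A V) :
    f.rTensor (PolyG k V) (((1 : RepForms k A V) ⊗ₜ[k] p) * w) =
      ((1 : RepForms k A V) ⊗ₜ[k] p) * f.rTensor (PolyG k V) w := by
  induction w using TensorProduct.induction_on with
  | zero => simp
  | tmul ω g => simp
  | add z z' h h' => rw [mul_add, map_add, map_add, mul_add, h, h']

theorem rTensor_isTwistedDer {D : RepForms k A V →ₗ[k] RepForms k A V}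
    (h : IsTwistedDer (Forms.kinvol k (RepRing k A V)) D) :
    IsTwistedDer (eqInvol k A V) (D.rTensor (PolyG k V)) :=
  rTensor_leibniz D (Forms.kinvol k (RepRing k A V)) h

theorem eqInvol_rTensor {D : RepForms k A V →ₗ[k] RepForms k A V}
    (h : ∀ ω, Forms.kinvol k (RepRing k A V) (D ω) = -D (Forms.kinvol k (RepRing k A V) ω))
    (w : EqForms k A V) :
    eqInvol k A V (D.rTensor (PolyG k V) w) = -D.rTensor (PolyG k V) (eqInvol k A V w) := by
  induction w using TensorProduct.induction_on with
  | zero => simp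
  | tmul ω g =>
    rw [LinearMap.rTensor_tmul, eqInvol, Algebra.TensorProduct.map_tmul,
      Algebra.TensorProduct.map_tmul, LinearMap.rTensor_tmul, h, TensorProduct.neg_tmul]
  | add z z' h h' => rw [map_add, map_add, map_add, map_add, h, h', neg_add]

variable (k V) in
theorem dDR_dDR (w : EqForms k A V) : dDR k A V (dDR k A V w) = 0 := by
  induction w using TensorProduct.induction_on with
  | zero => simp
  | tmul ω g => rw [dDR_tmul, dDR_tmul, Forms.d_d, TensorProduct.zero_tmul]
  | add z z' h h' => rw [map_add, map_add, h, h', add_zero]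

/-- The contraction of equivariant forms with the vector field generated by `x`. -/
def eqContr : E k V →ₗ[k] EqForms k A V →ₗ[k] EqForms k A V :=
  LinearMap.rTensorHom (PolyG k V) ∘ₗ Forms.contrₗ k (RepRing k A V) ∘ₗ actₗ A

theorem eqContr_apply (x : E k V) :
    eqContr A x = (Forms.contr (act A x)).rTensor (PolyG k V) := rfl

theorem eqContr_isTwistedDer (x : E k V) : IsTwistedDer (eqInvol k A V) (eqContr A x) :=
  rTensor_isTwistedDer A (Forms.contr_isTwistedDer (act A x))

theorem eqContr_comm (x y : E k V) (w : EqForms k A V) :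
    eqContr A x (eqContr A y w) = -eqContr A y (eqContr A x w) :=
  rTensor_anticomm (Forms.contr_comm (act A x) (act A y)) w

theorem eqContr_coordForm_mul (x : E k V) (r : Fin (dimE k V)) (w : EqForms k A V) :
    eqContr A x (coordForm k A V r * w) = coordForm k A V r * eqContr A x w :=
  rTensor_const_mul A _ _ w

variable (k V) in
-- A central even coefficient times an odd derivation, summed over `r`: in this form the Leibniz
-- rule and the commutation relations of `d_𝔤` can be read off term by term.
theorem dG_apply (w : EqForms k A V) :
    dG k A V w = ∑ r, coordForm k A V r * eqContr A (bas k V r) w := by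
  rw [dG, LinearMap.sum_apply]
  refine Finset.sum_congr rfl fun r _ => ?_
  rw [eqContr_apply, coordForm]
  induction w using TensorProduct.induction_on with
  | zero => simp
  | tmul ω g => simp
  | add z z' h h' => rw [map_add, map_add, mul_add, h, h']

variable (k V) in
theorem dG_isTwistedDer : IsTwistedDer (eqInvol k A V) (dG k A V) := by
  intro x y
  simp only [dG_apply, Finset.sum_mul, Finset.mul_sum, ← Finset.sum_add_distrib]
  refine Finset.sum_congr rfl fun r _ => ?_
  rw [eqContr_isTwistedDer, mul_add, mul_assoc, ← mul_assoc _ (eqInvol k A V x),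
    coordForm_mul_comm A r (eqInvol k A V x), mul_assoc]

variable (k V) in
-- The coefficients `e_r^* e_s^*` are symmetric in `r, s` while the contractions anticommute.
theorem dG_dG [CharZero k] (w : EqForms k A V) : dG k A V (dG k A V w) = 0 := by
  simp only [dG_apply, map_sum, eqContr_coordForm_mul]
  refine sum_sum_eq_zero_of_antisymm (k := k) _ fun r s => ?_
  rw [eqContr_comm, EqForms.mul_neg, EqForms.mul_neg, ← mul_assoc, ← mul_assoc,
    coordForm_mul_comm A r (coordForm k A V s)]

variable (k V) in
theorem eqInvol_dDR (w : EqForms k A V) :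
    eqInvol k A V (dDR k A V w) = -dDR k A V (eqInvol k A V w) :=
  eqInvol_rTensor A Forms.kinvol_d w

variable (k V) in
-- Since `d_DR` does not see the coordinates `e_r^*`, this is Cartan's formula for each `e_r`.
theorem dDR_dG_add_dG_dDR (w : EqForms k A V) :
    dDR k A V (dG k A V w) + dG k A V (dDR k A V w) =
      ∑ r, coordForm k A V r *
        (Forms.lie (act A (bas k V r))).rTensor (PolyG k V) w := by
  rw [dG_apply, dG_apply, map_sum, ← Finset.sum_add_distrib]
  refine Finset.sum_congr rfl fun r _ => ?_
  have h : dDR k A V (coordForm k A V r * eqContr A (bas k V r) w) =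
    coordForm k A V r * dDR k A V (eqContr A (bas k V r) w) := rTensor_const_mul A _ _ _
  rw [h, ← mul_add]
  exact congrArg _ (rTensor_comp_add_comp _ _ w)

theorem eqLie_isTwistedDer (x : E k V) : IsTwistedDer (AlgHom.id k _) (eqLie A x) := by
  refine IsTwistedDer.add (fun y z => ?_) (fun y z => ?_)
  · refine (rTensor_leibniz (Forms.lie (act A x)) (AlgHom.id k _)
      (Forms.lie_isTwistedDer (act A x)) y z).trans ?_
    rw [Algebra.TensorProduct.map_id]
  · refine (lTensor_leibniz (C := RepForms k A V) (adPoly x).toLinearMap (AlgHom.id k _)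
      (fun y z => ?_) y z).trans ?_
    · simp [Derivation.leibniz, mul_comm, add_comm]
    · rw [Algebra.TensorProduct.map_id]

theorem eqLie_apply (x : E k V) (w : EqForms k A V) :
    eqLie A x w = (Forms.lie (act A x)).rTensor _ w + (adPoly x).toLinearMap.lTensor _ w := rfl

theorem eqLie_coordForm (x : E k V) (r : Fin (dimE k V)) :
    eqLie A x (coordForm k A V r) =
      ∑ s, (bas k V).coord r (x * bas k V s - bas k V s * x) • coordForm k A V s := by
  have h : Forms.lie (act A x) (1 : RepForms k A V) = 0 :=
    (Forms.lie_isTwistedDer (act A x)).map_one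
  have h' : adPoly x (MvPolynomial.X r) = ∑ s, (bas k V).coord r (x * bas k V s - bas k V s * x) •
    (MvPolynomial.X s : PolyG k V) := MvPolynomial.mkDerivation_X _ _ _
  rw [eqLie_apply, coordForm, LinearMap.rTensor_tmul, h, TensorProduct.zero_tmul, zero_add,
    LinearMap.lTensor_tmul]
  change (1 : RepForms k A V) ⊗ₜ[k] adPoly x (MvPolynomial.X r) = _
  rw [h', TensorProduct.tmul_sum]
  simp only [TensorProduct.tmul_smul]
  rfl

/-! ### Invariance of the differentials and the square of the equivariant differential. -/

theorem eqLie_dDR (x : E k V) (w : EqForms k A V) :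
    eqLie A x (dDR k A V w) = dDR k A V (eqLie A x w) :=
  diagonal_rTensor_comm _ (Forms.lie_d (act A x)) w

/-- The commutator on the right is `[y, x]` and not `[x, y]`, because the action by vector fields
reverses brackets (`act_lie`). -/
theorem lie_contr_act (x y : E k V) (ω : RepForms k A V) :
    Forms.lie (act A x) (Forms.contr (act A y) ω) =
      Forms.contr (act A y) (Forms.lie (act A x) ω) + Forms.contr (act A (y * x - x * y)) ω :=
  Forms.lie_contr_of_eq _ _ (act_lie A y x) ω

theorem eqLie_eqContr (x y : E k V) (w : EqForms k A V) :
    eqLie A x (eqContr A y w) = eqContr A y (eqLie A x w) + eqContr A (y * x - x * y) w :=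
  diagonal_rTensor _ (lie_contr_act A x y) w

/-- The tensor `∑ e_r^* ⊗ e_r` is invariant: the variation of the coordinates `e_r^*` cancels the
variation of the contractions with `e_r`. -/
theorem eqLie_dG (x : E k V) (w : EqForms k A V) :
    eqLie A x (dG k A V w) = dG k A V (eqLie A x w) := by
  simp only [dG_apply, map_sum]
  have h : ∀ r, eqLie A x (coordForm k A V r * eqContr A (bas k V r) w) =
      (∑ s, (bas k V).coord r (x * bas k V s - bas k V s * x) •
        (coordForm k A V s * eqContr A (bas k V r) w)) +
      coordForm k A V r * eqContr A (bas k V r) (eqLie A x w) -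
      coordForm k A V r * eqContr A (x * bas k V r - bas k V r * x) w := by
    intro r
    rw [eqLie_isTwistedDer A x, eqLie_coordForm, eqLie_eqContr, Finset.sum_mul, AlgHom.id_apply,
      ← neg_sub (x * bas k V r), map_neg, LinearMap.neg_apply, mul_add, EqForms.mul_neg]
    simp only [smul_mul_assoc]
    abel
  simp only [h, Finset.sum_sub_distrib, Finset.sum_add_distrib]
  -- Expanding `[x, e_s]` in the basis turns the variation of the coordinates into contractions with
  -- `[x, e_s]`, the terms that occur with a minus sign in `h`.
  have h' : ∑ r, ∑ s, (bas k V).coord r (x * bas k V s - bas k V s * x) •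
        (coordForm k A V s * eqContr A (bas k V r) w) =
      ∑ s, coordForm k A V s * eqContr A (x * bas k V s - bas k V s * x) w := by
    rw [Finset.sum_comm]
    refine Finset.sum_congr rfl fun s _ => ?_
    conv_rhs => rw [← (bas k V).sum_repr (x * bas k V s - bas k V s * x), map_sum,
      LinearMap.sum_apply, Finset.mul_sum]
    refine Finset.sum_congr rfl fun r _ => ?_
    rw [map_smul, LinearMap.smul_apply, EqForms.mul_smul]
    rfl
  rw [h']
  abel

/-- At a point `y` of `𝔤` this vector field has the value `[y, y] = 0`. In coordinates, structure
constants antisymmetric in `r, s` meet the symmetric monomials `X_r X_s`. -/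
theorem sum_X_smul_adPoly [CharZero k] :
    ∑ r, (MvPolynomial.X r : PolyG k V) • adPoly (bas k V r) = 0 := by
  refine MvPolynomial.derivation_ext fun q => ?_
  have e : ∀ r, adPoly (bas k V r) (MvPolynomial.X q) =
      ∑ s, (bas k V).coord q (bas k V r * bas k V s - bas k V s * bas k V r) •
        (MvPolynomial.X s : PolyG k V) := fun r => MvPolynomial.mkDerivation_X _ _ _
  have e' : (∑ r, (MvPolynomial.X r : PolyG k V) • adPoly (bas k V r)) (MvPolynomial.X q) =
      ∑ r, ∑ s, (bas k V).coord q (bas k V r * bas k V s - bas k V s * bas k V r) •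
        ((MvPolynomial.X r : PolyG k V) * MvPolynomial.X s) := by
    rw [← Derivation.coeFnAddMonoidHom_apply, map_sum, Finset.sum_apply]
    refine Finset.sum_congr rfl fun r _ => ?_
    rw [Derivation.coeFnAddMonoidHom_apply, Derivation.smul_apply, e, smul_eq_mul, Finset.mul_sum]
    simp only [mul_smul_comm]
  rw [e', Derivation.zero_apply]
  refine sum_sum_eq_zero_of_antisymm (k := k) _ fun r s => ?_
  rw [← neg_sub (bas k V s * bas k V r), map_neg, neg_smul, mul_comm]

theorem sum_coordForm_mul_adPoly [CharZero k] (w : EqForms k A V) :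
    ∑ r, coordForm k A V r * (adPoly (bas k V r)).toLinearMap.lTensor (RepForms k A V) w = 0 := by
  induction w using TensorProduct.induction_on with
  | zero => simp
  | tmul ω g =>
    have h : ∑ r, (MvPolynomial.X r : PolyG k V) * adPoly (bas k V r) g = 0 := by
      have h := DFunLike.congr_fun (sum_X_smul_adPoly (k := k) (V := V)) g
      rw [← Derivation.coeFnAddMonoidHom_apply, map_sum, Finset.sum_apply] at h
      exact h
    have e : ∀ r, coordForm k A V r *
        (adPoly (bas k V r)).toLinearMap.lTensor (RepForms k A V) (ω ⊗ₜ[k] g) =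
        ω ⊗ₜ[k] (MvPolynomial.X r * adPoly (bas k V r) g) := by
      intro r
      rw [LinearMap.lTensor_tmul, coordForm, Algebra.TensorProduct.tmul_mul_tmul, one_mul]
      rfl
    simp only [e]
    rw [← TensorProduct.tmul_sum, h, TensorProduct.tmul_zero]
  | add z z' h h' => simp only [map_add, mul_add, Finset.sum_add_distrib, h, h', add_zero]

variable {A} in
theorem mem_eqInvariants {w : EqForms k A V} :
    w ∈ eqInvariants k A V ↔ ∀ x : E k V, eqLie A x w = 0 := by
  simp [eqInvariants]

variable {A} in
theorem dDR_add_dG_mem {w : EqForms k A V} (hw : w ∈ eqInvariants k A V) :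
    (dDR k A V + dG k A V) w ∈ eqInvariants k A V := by
  rw [mem_eqInvariants] at *
  intro x
  rw [LinearMap.add_apply, map_add, eqLie_dDR, eqLie_dG, hw, map_zero, map_zero, add_zero]

variable {A} in
-- The square is `∑ e_r^* L_{e_r}`. On an invariant element `L_{e_r}` acts as minus the adjoint
-- action on polynomials, so `sum_coordForm_mul_adPoly` applies. Off the invariants the square need
-- not vanish.
theorem dDR_add_dG_square [CharZero k] {w : EqForms k A V} (hw : w ∈ eqInvariants k A V) :
    (dDR k A V + dG k A V) ((dDR k A V + dG k A V) w) = 0 := by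
  rw [mem_eqInvariants] at hw
  have e : (dDR k A V + dG k A V) ((dDR k A V + dG k A V) w) =
      dDR k A V (dG k A V w) + dG k A V (dDR k A V w) := by
    simp only [LinearMap.add_apply, map_add, dDR_dDR, dG_dG]; abel
  rw [e, dDR_dG_add_dG_dDR]
  have e' : ∀ r, (Forms.lie (act A (bas k V r))).rTensor (PolyG k V) w =
      -(adPoly (bas k V r)).toLinearMap.lTensor (RepForms k A V) w := fun r =>
    eq_neg_of_add_eq_zero_left (hw (bas k V r))
  simp only [e', EqForms.mul_neg]
  rw [Finset.sum_neg_distrib, sum_coordForm_mul_adPoly, neg_zero]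

end Equivariant

/-! ### Operators on noncommutative forms -/

namespace NCForms

variable {k B : Type*} [Field k] [Ring B] [Algebra k B] {S : Subalgebra k B}

theorem d_isTwistedDer : IsTwistedDer (invol S) (d S) := d_mul S

theorem contr_isTwistedDer (θ : RelDer S) : IsTwistedDer (invol S) (contr S θ) := contr_mul S θ

theorem ext_der {σ : NCForms S →ₐ[k] NCForms S} {D D' : NCForms S →ₗ[k] NCForms S}
    (h : IsTwistedDer σ D) (h' : IsTwistedDer σ D') (hof : ∀ b, D (of S b) = D' (of S b))
    (hd : ∀ b, D (dOf S b) = D' (dOf S b)) : D = D' := by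
  refine LinearMap.ext fun x => ?_
  induction x using induction with
  | hof b => exact hof b
  | hd b => exact hd b
  | hmul x y hx hy => exact h.eq_mul h' hx hy
  | hadd x y hx hy => rw [map_add, map_add, hx, hy]

theorem invol_invol (x : NCForms S) : invol S (invol S x) = x := by
  induction x using induction with
  | hof b => simp
  | hd b => simp
  | hmul x y hx hy => rw [map_mul, map_mul, hx, hy]
  | hadd x y hx hy => rw [map_add, map_add, hx, hy]

theorem invol_d (x : NCForms S) : invol S (d S x) = -d S (invol S x) := by
  induction x using induction with
  | hof b => simp
  | hd b => simp
  | hmul x y hx hy =>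
    rw [d_mul, map_mul, d_mul, map_add, map_mul, map_mul, hx, hy]
    simp only [invol_invol]; noncomm_ring
  | hadd x y hx hy => simp only [map_add, hx, hy, neg_add]

theorem invol_contr (θ : RelDer S) (x : NCForms S) :
    invol S (contr S θ x) = -contr S θ (invol S x) := by
  induction x using induction with
  | hof b => simp
  | hd b => simp
  | hmul x y hx hy =>
    rw [contr_mul, map_mul, contr_mul, map_add, map_mul, map_mul, hx, hy]
    simp only [invol_invol]; noncomm_ring
  | hadd x y hx hy => simp only [map_add, hx, hy, neg_add]

theorem d_d (x : NCForms S) : d S (d S x) = 0 := by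
  have h := ext_der ((d_isTwistedDer (S := S)).square invol_invol invol_d)
    (IsTwistedDer.zero _) (fun r => by simp) (fun r => by simp)
  exact LinearMap.congr_fun h x

theorem contr_contr (θ : RelDer S) (x : NCForms S) : contr S θ (contr S θ x) = 0 := by
  have h := ext_der ((contr_isTwistedDer θ).square invol_invol (invol_contr θ))
    (IsTwistedDer.zero _) (fun r => by simp) (fun r => by simp)
  exact LinearMap.congr_fun h x

theorem mem_span_word (x : NCForms S) : x ∈ Submodule.span k (Set.range (word S)) := by
  induction x using induction with
  | hof b => exact Submodule.subset_span ⟨[.inl b], by simp [word]⟩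
  | hd b => exact Submodule.subset_span ⟨[.inr b], by simp [word]⟩
  | hadd x y hx hy => exact add_mem hx hy
  | hmul x y hx hy =>
    induction hx, hy using Submodule.span_induction₂ with
    | mem_mem x y hx hy =>
      obtain ⟨l, rfl⟩ := hx
      obtain ⟨m, rfl⟩ := hy
      exact Submodule.subset_span ⟨l ++ m, by simp [word]⟩
    | zero_left => simp
    | zero_right => simp
    | add_left x y z _ _ _ h₁ h₂ => rw [add_mul]; exact add_mem h₁ h₂
    | add_right x y z _ _ _ h₁ h₂ => rw [mul_add]; exact add_mem h₁ h₂
    | smul_left r x y _ _ h => rw [smul_mul_assoc]; exact Submodule.smul_mem _ _ h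
    | smul_right r x y _ _ h => rw [mul_smul_comm]; exact Submodule.smul_mem _ _ h

/-- Super-commutators are given on homogeneous pairs, so `x` is expanded into words; `b` has degree
`0`, hence no sign appears. -/
theorem of_mul_sub_mul_of_mem_comm (b : B) (x : NCForms S) :
    of S b * x - x * of S b ∈ comm S := by
  induction mem_span_word x using Submodule.span_induction with
  | mem x hx =>
    obtain ⟨l, rfl⟩ := hx
    exact Submodule.subset_span ⟨0, _, _, _, of_mem_deg S b, word_mem_deg S l, by simp⟩
  | zero => simp
  | add x y _ _ hx hy =>
    have e : of S b * (x + y) - (x + y) * of S b =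
      (of S b * x - x * of S b) + (of S b * y - y * of S b) := by noncomm_ring
    rw [e]; exact add_mem hx hy
  | smul c x _ hx =>
    rw [mul_smul_comm, smul_mul_assoc, ← smul_sub]; exact Submodule.smul_mem _ _ hx

end NCForms

section Extended

variable (k A : Type*) [Field k] [Ring A] [Algebra k A]

theorem dOf_tVar : NCForms.dOf (kt k A) (tVar k A) = 0 :=
  NCForms.dOf_mem _ ⟨Polynomial.X, rfl⟩

theorem adT_apply (b : At k A) : (adT k A).toFun b = tVar k A * b - b * tVar k A := rfl

/-- Cartan's formula for `Δ`: both sides are even derivations, equal to `[t, b]` on `b`. On `db` the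
left side is `d[t, b] = [t, db]`, because `t` lies in the base `k[t]` and so `dt = 0`. -/
theorem d_contr_add_contr_d (x : OmegaT k A) :
    NCForms.d (kt k A) (NCForms.contr (kt k A) (adT k A) x) +
      NCForms.contr (kt k A) (adT k A) (NCForms.d (kt k A) x) =
    NCForms.of (kt k A) (tVar k A) * x - x * NCForms.of (kt k A) (tVar k A) := by
  have h := NCForms.ext_der (NCForms.d_isTwistedDer.anticomm
    (NCForms.contr_isTwistedDer (adT k A)) NCForms.invol_invol NCForms.invol_d
    (NCForms.invol_contr (adT k A))) (IsTwistedDer.inner (NCForms.of (kt k A) (tVar k A)))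
    (fun b => by simp [adT_apply]) (fun b => by
      simp [adT_apply, NCForms.d_mul, dOf_tVar])
  exact LinearMap.congr_fun h x

theorem DRt.diff_mk (x : OmegaT k A) :
    DRt.diff k A (Submodule.Quotient.mk x) = Submodule.Quotient.mk
      (NCForms.d (kt k A) x + NCForms.contr (kt k A) (adT k A) x) := rfl

/-- As `d` and `i_Δ` each square to zero, only their anticommutator remains; it is a commutator with
the zero-form `t` and vanishes in the quotient. -/
theorem DRt.diff_diff : DRt.diff k A ∘ₗ DRt.diff k A = 0 := by
  refine LinearMap.ext fun x => ?_
  obtain ⟨x, rfl⟩ := Submodule.Quotient.mk_surjective _ x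
  rw [LinearMap.comp_apply, DRt.diff_mk, DRt.diff_mk, LinearMap.zero_apply,
    Submodule.Quotient.mk_eq_zero]
  have h := NCForms.of_mul_sub_mul_of_mem_comm (S := kt k A) (tVar k A) x
  rw [← d_contr_add_contr_d] at h
  simpa only [map_add, NCForms.d_d, NCForms.contr_contr, zero_add, add_zero, add_comm] using h

variable {k A} in
-- The algebra `A_t` is generated by `A` and the single letter `t`; the scalars already come from
-- `A`.
theorem At.induction {P : At k A → Prop} (hinl : ∀ a, P (FreeProd.inl k A _ a))
    (ht : P (tVar k A)) (hadd : ∀ x y, P x → P y → P (x + y))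
    (hmul : ∀ x y, P x → P y → P (x * y)) (b : At k A) : P b := by
  have hC : ∀ c : k, P (algebraMap k _ c) := fun c => by
    rw [← (FreeProd.inl k A (Polynomial k)).commutes]; exact hinl _
  have hinr : ∀ p : Polynomial k, P (FreeProd.inr k A _ p) := by
    intro p
    induction p using Polynomial.induction_on with
    | C c =>
      rw [← Polynomial.algebraMap_eq, AlgHom.commutes]; exact hC c
    | add p q hp hq =>
      rw [map_add]
      exact hadd _ _ hp hq
    | monomial n c h =>
      rw [pow_succ, ← mul_assoc, map_mul]
      exact hmul _ _ h ht
  obtain ⟨x, rfl⟩ := RingQuot.mkAlgHom_surjective k (FreeProd.Rel k A (Polynomial k)) b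
  change P (FreeProd.mk k A _ x)
  induction x using FreeAlgebra.induction with
  | grade0 c => rw [AlgHom.commutes]; exact hC c
  | grade1 x =>
    cases x with
    | inl a => exact hinl a
    | inr p => exact hinr p
  | mul x y hx hy => rw [map_mul]; exact hmul _ _ hx hy
  | add x y hx hy => rw [map_add]; exact hadd _ _ hx hy

end Extended

/-! ### Traces of endomorphism-valued elements -/

section Trace

variable {k V : Type*} [Field k] [AddCommGroup V] [Module k V]
variable {W : Type*} [Ring W] [Algebra k W]

/-- Moves a scalar form `y` into the entry of a constant matrix. With `e = e_s` and `y = e_s^*` this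
is how the summands of `t̂` arise from those of `d_𝔤`. -/
theorem lTensor_mulLeft_const_mul (y : W) (e : E k V) (z : E k V ⊗[k] W) :
    (LinearMap.mulLeft k y).lTensor (E k V) (e ⊗ₜ[k] 1 * z) = e ⊗ₜ[k] y * z := by
  induction z using TensorProduct.induction_on with
  | zero => simp
  | tmul e' w => simp
  | add z z' h h' => rw [mul_add, mul_add, map_add, h, h']

theorem lTensor_mulLeft_mul_const {y : W} (hy : ∀ w, y * w = w * y) (e : E k V)
    (z : E k V ⊗[k] W) :
    (LinearMap.mulLeft k y).lTensor (E k V) (z * e ⊗ₜ[k] 1) = z * e ⊗ₜ[k] y := by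
  induction z using TensorProduct.induction_on with
  | zero => simp
  | tmul e' w => simp [hy]
  | add z z' h h' => rw [add_mul, add_mul, map_add, h, h']

theorem lTensor_neg_apply (f : W →ₗ[k] W) (z : E k V ⊗[k] W) :
    (-f).lTensor (E k V) z = -f.lTensor (E k V) z := by
  rw [LinearMap.lTensor_neg, LinearMap.neg_apply]

/-- The elements of `End V ⊗ W` with entries in a subspace `P` of `W`. -/
def endValued (V : Type*) [AddCommGroup V] [Module k V] (P : Submodule k W) :
    Submodule k (E k V ⊗[k] W) :=
  Submodule.span k {z | ∃ (e : E k V), ∃ w ∈ P, z = e ⊗ₜ[k] w}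

variable {P Q R : Submodule k W}

theorem tmul_mem_endValued (e : E k V) {w : W} (hw : w ∈ P) : e ⊗ₜ[k] w ∈ endValued V P :=
  Submodule.subset_span ⟨e, w, hw, rfl⟩

theorem mul_mem_endValued (h : ∀ x ∈ P, ∀ y ∈ Q, x * y ∈ R) {u v : E k V ⊗[k] W}
    (hu : u ∈ endValued V P) (hv : v ∈ endValued V Q) : u * v ∈ endValued V R := by
  induction hu, hv using Submodule.span_induction₂ with
  | mem_mem x y hx hy =>
    obtain ⟨e, w, hw, rfl⟩ := hx
    obtain ⟨e', w', hw', rfl⟩ := hy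
    rw [Algebra.TensorProduct.tmul_mul_tmul]
    exact tmul_mem_endValued _ (h _ hw _ hw')
  | zero_left => rw [zero_mul]; exact zero_mem _
  | zero_right => rw [mul_zero]; exact zero_mem _
  | add_left x y z _ _ _ h₁ h₂ => rw [add_mul]; exact add_mem h₁ h₂
  | add_right x y z _ _ _ h₁ h₂ => rw [mul_add]; exact add_mem h₁ h₂
  | smul_left r x y _ _ h => rw [smul_mul_assoc]; exact Submodule.smul_mem _ _ h
  | smul_right r x y _ _ h => rw [mul_smul_comm]; exact Submodule.smul_mem _ _ h

theorem lTensor_mem_endValued {W' : Type*} [AddCommGroup W'] [Module k W'] {f : W' →ₗ[k] W}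
    (h : ∀ w, f w ∈ P) (z : E k V ⊗[k] W') : f.lTensor (E k V) z ∈ endValued V P := by
  induction z using TensorProduct.induction_on with
  | zero => rw [map_zero]; exact zero_mem _
  | tmul e w => exact tmul_mem_endValued e (h w)
  | add z z' h h' => rw [map_add]; exact add_mem h h'

theorem lTensor_mem_endValued_of_mem {f : W →ₗ[k] W} (h : ∀ w ∈ Q, f w ∈ P) {z : E k V ⊗[k] W}
    (hz : z ∈ endValued V Q) : f.lTensor (E k V) z ∈ endValued V P := by
  induction hz using Submodule.span_induction with
  | mem z hz => obtain ⟨e, w, hw, rfl⟩ := hz; exact tmul_mem_endValued e (h w hw)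
  | zero => rw [map_zero]; exact zero_mem _
  | add z z' _ _ h h' => rw [map_add]; exact add_mem h h'
  | smul c z _ h => rw [map_smul]; exact Submodule.smul_mem _ _ h

variable [FiniteDimensional k V]

theorem tr_mem {z : E k V ⊗[k] W} (hz : z ∈ endValued V P) : tr z ∈ P := by
  induction hz using Submodule.span_induction with
  | mem z hz =>
    obtain ⟨e, w, hw, rfl⟩ := hz
    rw [tr, slice_tmul]; exact Submodule.smul_mem _ _ hw
  | zero => rw [map_zero]; exact zero_mem _
  | add z z' _ _ h h' => rw [map_add]; exact add_mem h h'
  | smul c z _ h => rw [map_smul]; exact Submodule.smul_mem _ _ h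

theorem tr_lTensor (f : W →ₗ[k] W) (z : E k V ⊗[k] W) : tr (f.lTensor (E k V) z) = f (tr z) :=
  slice_lTensor _ f z

/-- The trace is cyclic up to the sign coming from exchanging the entries. -/
theorem tr_mul_comm {s : k} (h : ∀ x ∈ P, ∀ y ∈ Q, x * y = s • (y * x)) {u v : E k V ⊗[k] W}
    (hu : u ∈ endValued V P) (hv : v ∈ endValued V Q) : tr (u * v) = s • tr (v * u) := by
  induction hu, hv using Submodule.span_induction₂ with
  | mem_mem x y hx hy =>
    obtain ⟨e, w, hw, rfl⟩ := hx
    obtain ⟨e', w', hw', rfl⟩ := hy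
    rw [Algebra.TensorProduct.tmul_mul_tmul, Algebra.TensorProduct.tmul_mul_tmul, tr, slice_tmul,
      slice_tmul, h _ hw _ hw', LinearMap.trace_mul_comm, smul_comm]
  | zero_left => simp
  | zero_right => simp
  | add_left x y z _ _ _ h₁ h₂ => rw [add_mul, mul_add, map_add, map_add, h₁, h₂, smul_add]
  | add_right x y z _ _ _ h₁ h₂ => rw [add_mul, mul_add, map_add, map_add, h₁, h₂, smul_add]
  | smul_left r x y _ _ h =>
    rw [smul_mul_assoc, mul_smul_comm, map_smul, map_smul, h, smul_comm]
  | smul_right r x y _ _ h =>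
    rw [smul_mul_assoc, mul_smul_comm, map_smul, map_smul, h, smul_comm]

/-- A constant matrix has the central entry `1`, so only the ordinary trace identity is involved and
no degree or sign enters. -/
theorem tr_const_mul_comm (x : E k V) (z : E k V ⊗[k] W) :
    tr (x ⊗ₜ[k] 1 * z) = tr (z * x ⊗ₜ[k] 1) := by
  induction z using TensorProduct.induction_on with
  | zero => simp
  | tmul e w =>
    rw [Algebra.TensorProduct.tmul_mul_tmul, Algebra.TensorProduct.tmul_mul_tmul, tr, slice_tmul,
      slice_tmul, LinearMap.trace_mul_comm, one_mul, mul_one]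
  | add z z' h h' => rw [mul_add, add_mul, map_add, map_add, h, h']

end Trace

/-! ### The evaluation map on noncommutative forms -/

section Evaluation

variable {k : Type*} (A : Type*) {V : Type*} [Field k] [Ring A] [Algebra k A] [AddCommGroup V]
  [Module k V] [FiniteDimensional k V]

variable (k V) in
/-- The inclusion of functions into `Ω(Rep(A,V), 𝔤)`. -/
def funEq : RepRing k A V →ₐ[k] EqForms k A V :=
  Algebra.TensorProduct.includeLeft.comp (funForms k A V)

theorem funEq_apply (r : RepRing k A V) :
    funEq k A V r = (algebraMap (RepRing k A V) (RepForms k A V) r) ⊗ₜ[k] (1 : PolyG k V) := rfl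

variable (k V) in
/-- The inclusion of `End V`-valued functions into `End V ⊗ Ω(Rep(A,V), 𝔤)`. -/
def funEnd : E k V ⊗[k] RepRing k A V →ₐ[k] EndForms k A V :=
  (Algebra.TensorProduct.map (AlgHom.id k (E k V)) (funEq k A V) :
    E k V ⊗[k] RepRing k A V →ₐ[k] E k V ⊗[k] EqForms k A V)

theorem evT_inl_eq (a : A) :
    evT k A V (FreeProd.inl k A _ a) = funEnd k A V (RepRing.ev k A V a) := by
  rw [evT_inl, evForms, AlgHom.comp_apply]
  induction RepRing.ev k A V a using TensorProduct.induction_on with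
  | zero => simp only [map_zero]
  | tmul e r => rfl
  | add z z' h h' => simp only [map_add, h, h']

theorem evT_tVar : evT k A V (tVar k A) = tHat k A V := by
  rw [tVar, evT_inr, Polynomial.aeval_X]

/-- An operator on equivariant forms, extended to `End V`-valued ones. -/
def endOp (D : EqForms k A V →ₗ[k] EqForms k A V) : EndForms k A V →ₗ[k] EndForms k A V :=
  D.lTensor (E k V)

theorem endOp_dDR : endOp A (dDR k A V) = dEnd k A V := rfl

variable {A}

theorem endOp_isTwistedDer {D : EqForms k A V →ₗ[k] EqForms k A V}
    (h : IsTwistedDer (eqInvol k A V) D) : IsTwistedDer (endInvol k A V) (endOp A D) :=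
  lTensor_leibniz D (eqInvol k A V) h

theorem endOp_isTwistedDer_id {D : EqForms k A V →ₗ[k] EqForms k A V}
    (h : IsTwistedDer (AlgHom.id k _) D) : IsTwistedDer (AlgHom.id k _) (endOp A D) := by
  intro x y
  refine (lTensor_leibniz D (AlgHom.id k _) h x y).trans ?_
  rw [Algebra.TensorProduct.map_id]
  rfl

theorem endOp_comp (D D' : EqForms k A V →ₗ[k] EqForms k A V) (z : EndForms k A V) :
    endOp A D (endOp A D' z) = endOp A (D ∘ₗ D') z :=
  (LinearMap.lTensor_comp_apply (E k V) D D' z).symm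

theorem endOp_funEnd (D : EqForms k A V →ₗ[k] EqForms k A V) (z : E k V ⊗[k] RepRing k A V) :
    (endOp A D (funEnd k A V z) : E k V ⊗[k] EqForms k A V) =
      (D ∘ₗ (funEq k A V).toLinearMap).lTensor (E k V) z :=
  (LinearMap.lTensor_comp_apply (E k V) D _ z).symm

theorem funEnd_const (x : E k V) : funEnd k A V (x ⊗ₜ[k] 1) = EndForms.tmul k A V x 1 := by
  change x ⊗ₜ[k] funEq k A V 1 = x ⊗ₜ[k] 1
  rw [map_one]

theorem endInvol_endOp {D : EqForms k A V →ₗ[k] EqForms k A V}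
    (h : ∀ w, eqInvol k A V (D w) = -D (eqInvol k A V w)) (z : EndForms k A V) :
    endInvol k A V (endOp A D z) = -endOp A D (endInvol k A V z) := by
  have e : (eqInvol k A V).toLinearMap ∘ₗ D = -(D ∘ₗ (eqInvol k A V).toLinearMap) :=
    LinearMap.ext h
  have h₁ : endInvol k A V (endOp A D z) =
    endOp A ((eqInvol k A V).toLinearMap ∘ₗ D) z := endOp_comp _ _ z
  have h₂ : endOp A D (endInvol k A V z) =
    endOp A (D ∘ₗ (eqInvol k A V).toLinearMap) z := endOp_comp _ _ z
  rw [h₁, h₂, e]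
  exact lTensor_neg_apply _ z

theorem endOp_const_mul (D : EqForms k A V →ₗ[k] EqForms k A V) (x : E k V)
    (z : EndForms k A V) :
    endOp A D (EndForms.tmul k A V x 1 * z) = EndForms.tmul k A V x 1 * endOp A D z :=
  lTensor_const_mul D x z

theorem endOp_mul_const (D : EqForms k A V →ₗ[k] EqForms k A V) (x : E k V)
    (z : EndForms k A V) :
    endOp A D (z * EndForms.tmul k A V x 1) = endOp A D z * EndForms.tmul k A V x 1 :=
  lTensor_mul_const D x z

theorem mulLeft_const_mul (y : EqForms k A V) (e : E k V) (z : EndForms k A V) :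
    endOp A (LinearMap.mulLeft k y) (EndForms.tmul k A V e 1 * z) =
      EndForms.tmul k A V e y * z :=
  lTensor_mulLeft_const_mul y e z

theorem mulLeft_mul_const {y : EqForms k A V} (hy : ∀ w, y * w = w * y) (e : E k V)
    (z : EndForms k A V) :
    endOp A (LinearMap.mulLeft k y) (z * EndForms.tmul k A V e 1) =
      z * EndForms.tmul k A V e y :=
  lTensor_mulLeft_mul_const hy e z

/-! #### The operator `d_𝔤` -/

variable (k A V) in
/-- The differential `id ⊗ d_𝔤`. -/
abbrev gEnd : EndForms k A V →ₗ[k] EndForms k A V := endOp A (dG k A V)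

variable (k A V) in
theorem gEnd_isTwistedDer : IsTwistedDer (endInvol k A V) (gEnd k A V) :=
  endOp_isTwistedDer (dG_isTwistedDer k V A)

theorem dG_funEq (r : RepRing k A V) : dG k A V (funEq k A V r) = 0 := by
  rw [dG_apply]
  refine Finset.sum_eq_zero fun s _ => ?_
  rw [eqContr_apply, funEq_apply, LinearMap.rTensor_tmul, Forms.contr_algebraMap,
    TensorProduct.zero_tmul, mul_zero]

theorem dG_dDR_funEq (r : RepRing k A V) : dG k A V (dDR k A V (funEq k A V r)) =
    ∑ s, coordForm k A V s * funEq k A V (act A (bas k V s) r) := by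
  rw [dG_apply]
  refine Finset.sum_congr rfl fun s _ => ?_
  rw [eqContr_apply, funEq_apply, dDR_tmul, Forms.d_algebraMap, LinearMap.rTensor_tmul,
    Forms.contr_D, funEq_apply]

theorem gEnd_tHat : gEnd k A V (tHat k A V) = 0 := by
  rw [tHat, map_sum]
  refine Finset.sum_eq_zero fun r _ => ?_
  have h : dG k A V (coordForm k A V r) = 0 := by
    rw [dG_apply]
    refine Finset.sum_eq_zero fun s _ => ?_
    have h : Forms.contr (act A (bas k V s)) (1 : RepForms k A V) = 0 :=
      (Forms.contr_isTwistedDer _).map_one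
    have h' : eqContr A (bas k V s) (coordForm k A V r) = 0 := by
      rw [eqContr_apply, coordForm, LinearMap.rTensor_tmul, h, TensorProduct.zero_tmul]
    rw [h', mul_zero]
  change bas k V r ⊗ₜ[k] dG k A V (coordForm k A V r) = 0
  rw [h, TensorProduct.tmul_zero]

/-- Evaluations of elements of `A_t` have form degree `0`, and contractions kill functions. -/
theorem gEnd_evT (b : At k A) : gEnd k A V (evT k A V b) = 0 := by
  induction b using At.induction with
  | hinl a =>
    rw [evT_inl_eq]
    refine (endOp_funEnd _ _).trans ?_
    have e : dG k A V ∘ₗ (funEq k A V).toLinearMap = 0 := LinearMap.ext dG_funEq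
    rw [e, LinearMap.lTensor_zero, LinearMap.zero_apply]
    rfl
  | ht => rw [evT_tVar, gEnd_tHat]
  | hadd x y hx hy => rw [map_add, map_add, hx, hy, add_zero]
  | hmul x y hx hy => rw [map_mul, gEnd_isTwistedDer, hx, hy, zero_mul, mul_zero, add_zero]

theorem gEnd_dEnd_funEnd (z : E k V ⊗[k] RepRing k A V) :
    gEnd k A V (dEnd k A V (funEnd k A V z)) =
      ∑ s, endOp A (LinearMap.mulLeft k (coordForm k A V s))
        (funEnd k A V ((act A (bas k V s)).toLinearMap.lTensor (E k V) z)) := by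
  induction z using TensorProduct.induction_on with
  | zero => simp only [map_zero, Finset.sum_const_zero]
  | tmul e r =>
    change e ⊗ₜ[k] dG k A V (dDR k A V (funEq k A V r)) = _
    rw [dG_dDR_funEq, TensorProduct.tmul_sum]
    rfl
  | add z z' h h' => simp only [map_add, h, h', Finset.sum_add_distrib]

/-- For `a ∈ A`, contraction with `e_s` sends `dâ` to `[e_s, â]`, and the weights `e_s^*` assemble
the `e_s` into `t̂`. For `t` both sides vanish, and both sides obey the Leibniz rule in `b`. -/
theorem gEnd_dEnd_evT (b : At k A) : gEnd k A V (dEnd k A V (evT k A V b)) =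
    tHat k A V * evT k A V b - evT k A V b * tHat k A V := by
  induction b using At.induction with
  | hinl a =>
    rw [evT_inl_eq, gEnd_dEnd_funEnd, tHat, Finset.sum_mul, Finset.mul_sum,
      ← Finset.sum_sub_distrib]
    refine Finset.sum_congr rfl fun s _ => ?_
    rw [act_ev, map_sub, map_mul, map_mul, map_sub, funEnd_const, mulLeft_const_mul,
      mulLeft_mul_const (coordForm_mul_comm A s)]
    rfl
  | ht => rw [evT_tVar, dEnd_tHat, map_zero, sub_self]
  | hadd x y hx hy => simp only [map_add, hx, hy]; noncomm_ring
  | hmul x y hx hy =>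
    rw [map_mul, dEnd_mul, map_add, gEnd_isTwistedDer, gEnd_isTwistedDer, endInvol_evT, gEnd_evT,
      gEnd_evT, hx, hy, endInvol_evT]
    noncomm_ring

/-! #### The Lie derivatives -/

variable (A) in
/-- The Lie derivative on `End V`-valued equivariant forms. -/
abbrev lieEnd (x : E k V) : EndForms k A V →ₗ[k] EndForms k A V := endOp A (eqLie A x)

variable (A) in
theorem lieEnd_isTwistedDer (x : E k V) : IsTwistedDer (AlgHom.id k _) (lieEnd A x) :=
  endOp_isTwistedDer_id (eqLie_isTwistedDer A x)

theorem eqLie_funEq (x : E k V) (r : RepRing k A V) :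
    eqLie A x (funEq k A V r) = funEq k A V (act A x r) := by
  have h : adPoly x (1 : PolyG k V) = 0 := (adPoly x).map_one_eq_zero
  rw [eqLie_apply, funEq_apply, LinearMap.rTensor_tmul, LinearMap.lTensor_tmul,
    Forms.lie_algebraMap]
  change _ + _ ⊗ₜ[k] adPoly x 1 = _
  rw [h, TensorProduct.tmul_zero, add_zero, funEq_apply]

variable (A) in
-- The same double sum of `coord_r [x, e_s] · e_r ⊗ e_s^*` computes both sides: collected in `s` it
-- is the variation of a coordinate, collected in `r` it is the matrix `[x, e_s]`.
theorem lieEnd_tHat (x : E k V) : lieEnd A x (tHat k A V) =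
    EndForms.tmul k A V x 1 * tHat k A V - tHat k A V * EndForms.tmul k A V x 1 := by
  have h : ∀ r, lieEnd A x (EndForms.tmul k A V (bas k V r) (coordForm k A V r)) =
      ∑ s, EndForms.tmul k A V ((bas k V).coord r (x * bas k V s - bas k V s * x) • bas k V r)
        (coordForm k A V s) := by
    intro r
    change bas k V r ⊗ₜ[k] eqLie A x (coordForm k A V r) = _
    rw [eqLie_coordForm, TensorProduct.tmul_sum]
    refine Finset.sum_congr rfl fun s _ => ?_
    exact (TensorProduct.smul_tmul _ _ _).symm
  have h' : ∀ s, EndForms.tmul k A V x 1 * EndForms.tmul k A V (bas k V s) (coordForm k A V s) -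
      EndForms.tmul k A V (bas k V s) (coordForm k A V s) * EndForms.tmul k A V x 1 =
      ∑ r, EndForms.tmul k A V ((bas k V).coord r (x * bas k V s - bas k V s * x) • bas k V r)
        (coordForm k A V s) := by
    intro s
    have e₁ : EndForms.tmul k A V x 1 * EndForms.tmul k A V (bas k V s) (coordForm k A V s) =
        EndForms.tmul k A V (x * bas k V s) (coordForm k A V s) :=
      (Algebra.TensorProduct.tmul_mul_tmul _ _ _ _).trans (by rw [one_mul]; rfl)
    have e₂ : EndForms.tmul k A V (bas k V s) (coordForm k A V s) * EndForms.tmul k A V x 1 =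
        EndForms.tmul k A V (bas k V s * x) (coordForm k A V s) :=
      (Algebra.TensorProduct.tmul_mul_tmul _ _ _ _).trans (by rw [mul_one]; rfl)
    rw [e₁, e₂]
    refine (TensorProduct.sub_tmul _ _ _).symm.trans ?_
    refine Eq.trans ?_ (TensorProduct.sum_tmul _ _ _)
    congr 1
    exact ((bas k V).sum_repr (x * bas k V s - bas k V s * x)).symm
  have e : tHat k A V = ∑ r, EndForms.tmul k A V (bas k V r) (coordForm k A V r) := rfl
  rw [e, map_sum, Finset.mul_sum, Finset.sum_mul, ← Finset.sum_sub_distrib]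
  simp only [h, h']
  exact Finset.sum_comm

variable (A) in
/-- The inner derivation `[x, ·]` of `End V ⊗ Ω(Rep(A,V), 𝔤)`. -/
abbrev adEnd (x : E k V) : EndForms k A V →ₗ[k] EndForms k A V :=
  LinearMap.mulLeft k (EndForms.tmul k A V x 1) - LinearMap.mulRight k (EndForms.tmul k A V x 1)

/-- Infinitesimal equivariance of the evaluation: moving the point of the scheme and of `𝔤`
conjugates the resulting matrix. -/
theorem lieEnd_evT (x : E k V) (b : At k A) :
    lieEnd A x (evT k A V b) = adEnd A x (evT k A V b) := by
  induction b using At.induction with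
  | hinl a =>
    have h : lieEnd A x (funEnd k A V (RepRing.ev k A V a)) =
        funEnd k A V ((act A x).toLinearMap.lTensor (E k V) (RepRing.ev k A V a)) := by
      refine (endOp_funEnd _ _).trans ?_
      have e : eqLie A x ∘ₗ (funEq k A V).toLinearMap =
        (funEq k A V).toLinearMap ∘ₗ (act A x).toLinearMap := LinearMap.ext (eqLie_funEq x)
      rw [e]
      exact LinearMap.lTensor_comp_apply (E k V) _ _ _
    rw [evT_inl_eq, h, act_ev, map_sub, map_mul, map_mul, funEnd_const]
    rfl
  | ht => rw [evT_tVar, lieEnd_tHat]; rfl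
  | hadd y z hy hz => simp only [map_add, hy, hz]
  | hmul y z hy hz =>
    rw [map_mul]
    exact (lieEnd_isTwistedDer A x).eq_mul (IsTwistedDer.inner _) hy hz

/-- The Lie derivative commutes with `d_DR`, and `d_DR` passes through the constant matrix `x`. -/
theorem lieEnd_dEnd_evT (x : E k V) (b : At k A) :
    lieEnd A x (dEnd k A V (evT k A V b)) = adEnd A x (dEnd k A V (evT k A V b)) := by
  have e : eqLie A x ∘ₗ dDR k A V = dDR k A V ∘ₗ eqLie A x := LinearMap.ext (eqLie_dDR A x)
  have h : lieEnd A x (dEnd k A V (evT k A V b)) = dEnd k A V (lieEnd A x (evT k A V b)) := by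
    rw [← endOp_dDR, endOp_comp, e, endOp_comp]
  rw [h, lieEnd_evT, LinearMap.sub_apply, map_sub, LinearMap.mulLeft_apply,
    LinearMap.mulRight_apply, ← endOp_dDR, endOp_const_mul, endOp_mul_const]
  rfl

/-! #### Compatibility of the evaluation map with the operators -/

theorem evOmega_of (b : At k A) : evOmega k A V (NCForms.of _ b) = evT k A V b :=
  NCForms.lift_of _ _ _ _ b

theorem evOmega_dOf (b : At k A) : evOmega k A V (NCForms.dOf _ b) = dEnd k A V (evT k A V b) :=
  NCForms.lift_dOf _ _ _ _ b

/-- Evaluation preserves parity, which is what lets the twisted Leibniz rules on its two sides be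
compared. -/
theorem endInvol_evOmega (ω : OmegaT k A) :
    endInvol k A V (evOmega k A V ω) = evOmega k A V (NCForms.invol _ ω) := by
  induction ω using NCForms.induction with
  | hof b => rw [NCForms.invol_of, evOmega_of, endInvol_evT]
  | hd b =>
    rw [NCForms.invol_dOf, map_neg, evOmega_dOf, ← endOp_dDR,
      endInvol_endOp (eqInvol_dDR k V A), endInvol_evT]
  | hadd x y hx hy => simp only [map_add, hx, hy]
  | hmul x y hx hy => simp only [map_mul, hx, hy]

theorem evOmega_d (ω : OmegaT k A) :
    evOmega k A V (NCForms.d _ ω) = dEnd k A V (evOmega k A V ω) := by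
  induction ω using NCForms.induction with
  | hof b => rw [NCForms.d_of, evOmega_of, evOmega_dOf]
  | hd b =>
    have e : dDR k A V ∘ₗ dDR k A V = 0 := LinearMap.ext (dDR_dDR k V A)
    rw [NCForms.d_dOf, evOmega_dOf, map_zero, ← endOp_dDR, endOp_comp, e]
    exact (LinearMap.congr_fun (LinearMap.lTensor_zero (E k V)) _).symm
  | hadd x y hx hy => simp only [map_add, hx, hy]
  | hmul x y hx hy =>
    rw [NCForms.d_mul, map_mul, map_add, map_mul, map_mul, dEnd_mul, hx, hy, endInvol_evOmega]

/-- On `b` both sides are zero, and on `db` both are the evaluation of `[t, b]`, by `gEnd_dEnd_evT`.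
-/
theorem evOmega_contr (ω : OmegaT k A) :
    evOmega k A V (NCForms.contr _ (adT k A) ω) = gEnd k A V (evOmega k A V ω) := by
  induction ω using NCForms.induction with
  | hof b => rw [NCForms.contr_of, evOmega_of, gEnd_evT, map_zero]
  | hd b =>
    rw [NCForms.contr_dOf, evOmega_dOf, evOmega_of, gEnd_dEnd_evT, adT_apply, map_sub, map_mul,
      map_mul, evT_tVar]
  | hadd x y hx hy => simp only [map_add, hx, hy]
  | hmul x y hx hy =>
    rw [NCForms.contr_mul, map_mul, map_add, map_mul, map_mul, gEnd_isTwistedDer, hx, hy,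
      endInvol_evOmega]

theorem lieEnd_evOmega (x : E k V) (ω : OmegaT k A) :
    lieEnd A x (evOmega k A V ω) = adEnd A x (evOmega k A V ω) := by
  induction ω using NCForms.induction with
  | hof b => rw [evOmega_of, lieEnd_evT]
  | hd b => rw [evOmega_dOf, lieEnd_dEnd_evT]
  | hadd y z hy hz => simp only [map_add, hy, hz]
  | hmul y z hy hz =>
    rw [map_mul]
    exact (lieEnd_isTwistedDer A x).eq_mul (IsTwistedDer.inner _) hy hz

variable (A V) in
/-- The trace on `End V ⊗ Ω(Rep(A,V), 𝔤)`. -/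
def trEnd : EndForms k A V →ₗ[k] EqForms k A V := (tr : E k V ⊗[k] EqForms k A V →ₗ[k] _)

theorem trEnd_endOp (D : EqForms k A V →ₗ[k] EqForms k A V) (z : EndForms k A V) :
    trEnd A V (endOp A D z) = D (trEnd A V z) := tr_lTensor D z

theorem trEvOmega_apply (ω : OmegaT k A) :
    trEvOmega k A V ω = trEnd A V (evOmega k A V ω) := rfl

theorem trEvOmega_diff (ω : OmegaT k A) :
    trEvOmega k A V (NCForms.d _ ω + NCForms.contr _ (adT k A) ω) =
      (dDR k A V + dG k A V) (trEvOmega k A V ω) := by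
  rw [map_add, trEvOmega_apply, trEvOmega_apply, trEvOmega_apply, evOmega_d, evOmega_contr,
    ← endOp_dDR, trEnd_endOp, trEnd_endOp, LinearMap.add_apply]

/-- The diagonal action turns the evaluation into its commutator with a constant matrix, whose trace
is zero. -/
theorem trEvOmega_mem (ω : OmegaT k A) : trEvOmega k A V ω ∈ eqInvariants k A V := by
  rw [mem_eqInvariants]
  intro x
  have h : trEnd A V (EndForms.tmul k A V x 1 * evOmega k A V ω) =
    trEnd A V (evOmega k A V ω * EndForms.tmul k A V x 1) := tr_const_mul_comm x _
  rw [trEvOmega_apply, ← trEnd_endOp, lieEnd_evOmega, LinearMap.sub_apply, map_sub,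
    LinearMap.mulLeft_apply, LinearMap.mulRight_apply, h, sub_self]

/-! #### Gradings -/

theorem EqForms.bideg_mul {p q p' q' : ℕ} :
    ∀ x ∈ EqForms.bideg k A V p q, ∀ y ∈ EqForms.bideg k A V p' q',
      x * y ∈ EqForms.bideg k A V (p + p') (q + q') := by
  intro x hx y hy
  induction hx, hy using Submodule.span_induction₂ with
  | mem_mem x y hx hy =>
    obtain ⟨ω, hω, f, hf, rfl⟩ := hx
    obtain ⟨η, hη, g, hg, rfl⟩ := hy
    exact Submodule.subset_span ⟨ω * η, Forms.mul_mem_deg hω hη, f * g,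
      MvPolynomial.IsHomogeneous.mul hf hg, Algebra.TensorProduct.tmul_mul_tmul _ _ _ _⟩
  | zero_left => rw [zero_mul]; exact zero_mem _
  | zero_right => rw [mul_zero]; exact zero_mem _
  | add_left x y z _ _ _ h₁ h₂ => rw [add_mul]; exact add_mem h₁ h₂
  | add_right x y z _ _ _ h₁ h₂ => rw [mul_add]; exact add_mem h₁ h₂
  | smul_left r x y _ _ h => rw [smul_mul_assoc]; exact Submodule.smul_mem _ _ h
  | smul_right r x y _ _ h => rw [mul_smul_comm]; exact Submodule.smul_mem _ _ h

variable (k A V) in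
/-- Equivariant forms of form degree `q`, of arbitrary polynomial degree. -/
def EqForms.formDeg (q : ℕ) : Submodule k (EqForms k A V) :=
  Submodule.span k {w | ∃ ω ∈ Forms.deg k (RepRing k A V) q, ∃ f : PolyG k V, w = ω ⊗ₜ[k] f}

/-- Super-commutators refer to form degree alone, and a general element of `A_t` has no definite
degree in `t`. The coarser grading serves the sign rule and the bigrading serves the compatibility
of degrees; this inclusion links them. -/
theorem EqForms.bideg_le_formDeg (p q : ℕ) :
    EqForms.bideg k A V p q ≤ EqForms.formDeg k A V q := by
  refine Submodule.span_mono ?_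
  rintro _ ⟨ω, hω, f, _, rfl⟩
  exact ⟨ω, hω, f, rfl⟩

theorem EqForms.formDeg_mul {q q' : ℕ} :
    ∀ x ∈ EqForms.formDeg k A V q, ∀ y ∈ EqForms.formDeg k A V q',
      x * y ∈ EqForms.formDeg k A V (q + q') := by
  intro x hx y hy
  induction hx, hy using Submodule.span_induction₂ with
  | mem_mem x y hx hy =>
    obtain ⟨ω, hω, f, rfl⟩ := hx
    obtain ⟨η, hη, g, rfl⟩ := hy
    exact Submodule.subset_span ⟨ω * η, Forms.mul_mem_deg hω hη, f * g,
      Algebra.TensorProduct.tmul_mul_tmul _ _ _ _⟩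
  | zero_left => rw [zero_mul]; exact zero_mem _
  | zero_right => rw [mul_zero]; exact zero_mem _
  | add_left x y z _ _ _ h₁ h₂ => rw [add_mul]; exact add_mem h₁ h₂
  | add_right x y z _ _ _ h₁ h₂ => rw [mul_add]; exact add_mem h₁ h₂
  | smul_left r x y _ _ h => rw [smul_mul_assoc]; exact Submodule.smul_mem _ _ h
  | smul_right r x y _ _ h => rw [mul_smul_comm]; exact Submodule.smul_mem _ _ h

theorem EqForms.formDeg_mul_comm {q q' : ℕ} :
    ∀ x ∈ EqForms.formDeg k A V q, ∀ y ∈ EqForms.formDeg k A V q',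
      x * y = (-1 : k) ^ (q * q') • (y * x) := by
  intro x hx y hy
  induction hx, hy using Submodule.span_induction₂ with
  | mem_mem x y hx hy =>
    obtain ⟨ω, hω, f, rfl⟩ := hx
    obtain ⟨η, hη, g, rfl⟩ := hy
    rw [Algebra.TensorProduct.tmul_mul_tmul, Algebra.TensorProduct.tmul_mul_tmul,
      Forms.mul_comm_of_mem hω hη, mul_comm f g, TensorProduct.smul_tmul']
  | zero_left => rw [zero_mul, mul_zero, smul_zero]
  | zero_right => rw [zero_mul, mul_zero, smul_zero]
  | add_left x y z _ _ _ h₁ h₂ => rw [add_mul, mul_add, h₁, h₂, smul_add]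
  | add_right x y z _ _ _ h₁ h₂ => rw [add_mul, mul_add, h₁, h₂, smul_add]
  | smul_left r x y _ _ h => rw [smul_mul_assoc, mul_smul_comm, h, smul_comm]
  | smul_right r x y _ _ h => rw [smul_mul_assoc, mul_smul_comm, h, smul_comm]

theorem dDR_mem_formDeg {q : ℕ} :
    ∀ w ∈ EqForms.formDeg k A V q, dDR k A V w ∈ EqForms.formDeg k A V (q + 1) := by
  intro w hw
  induction hw using Submodule.span_induction with
  | mem w hw =>
    obtain ⟨ω, hω, f, rfl⟩ := hw
    rw [dDR_tmul]
    exact Submodule.subset_span ⟨_, Forms.d_mem_deg hω, f, rfl⟩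
  | zero => rw [map_zero]; exact zero_mem _
  | add x y _ _ hx hy => rw [map_add]; exact add_mem hx hy
  | smul c x _ hx => rw [map_smul]; exact Submodule.smul_mem _ _ hx

theorem dDR_mem_bideg {p q : ℕ} :
    ∀ w ∈ EqForms.bideg k A V p q, dDR k A V w ∈ EqForms.bideg k A V p (q + 1) := by
  intro w hw
  induction hw using Submodule.span_induction with
  | mem w hw =>
    obtain ⟨ω, hω, f, hf, rfl⟩ := hw
    rw [dDR_tmul]
    exact Submodule.subset_span ⟨_, Forms.d_mem_deg hω, f, hf, rfl⟩
  | zero => rw [map_zero]; exact zero_mem _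
  | add x y _ _ hx hy => rw [map_add]; exact add_mem hx hy
  | smul c x _ hx => rw [map_smul]; exact Submodule.smul_mem _ _ hx

variable (k A V) in
/-- The `End V`-valued equivariant forms with entries in a subspace. -/
def endSub (P : Submodule k (EqForms k A V)) : Submodule k (EndForms k A V) :=
  (endValued V P : Submodule k (E k V ⊗[k] EqForms k A V))

theorem mul_mem_endSub {P Q R : Submodule k (EqForms k A V)}
    (h : ∀ x ∈ P, ∀ y ∈ Q, x * y ∈ R) {u v : EndForms k A V}
    (hu : u ∈ endSub k A V P) (hv : v ∈ endSub k A V Q) : u * v ∈ endSub k A V R :=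
  mul_mem_endValued h hu hv

theorem evT_inl_mem (a : A) :
    evT k A V (FreeProd.inl k A _ a) ∈ endSub k A V (EqForms.bideg k A V 0 0) := by
  rw [evT_inl_eq]
  refine lTensor_mem_endValued (f := (funEq k A V).toLinearMap) (fun r => ?_) _
  exact Submodule.subset_span ⟨_, Forms.algebraMap_mem_deg r, 1,
    MvPolynomial.isHomogeneous_one _ _, rfl⟩

variable (k A V) in
theorem tHat_mem : tHat k A V ∈ endSub k A V (EqForms.bideg k A V 1 0) := by
  refine Submodule.sum_mem _ fun r _ => tmul_mem_endValued _ (Submodule.subset_span ⟨1, ?_, _,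
    MvPolynomial.isHomogeneous_X _ r, rfl⟩)
  rw [← map_one (algebraMap (RepRing k A V) _)]
  exact Forms.algebraMap_mem_deg 1

theorem endSub_mono {P Q : Submodule k (EqForms k A V)} (h : P ≤ Q) :
    endSub k A V P ≤ endSub k A V Q := by
  refine Submodule.span_mono ?_
  rintro _ ⟨e, w, hw, rfl⟩
  exact ⟨e, w, h hw, rfl⟩

theorem evT_mem (b : At k A) : evT k A V b ∈ endSub k A V (EqForms.formDeg k A V 0) := by
  induction b using At.induction with
  | hinl a => exact endSub_mono (EqForms.bideg_le_formDeg 0 0) (evT_inl_mem a)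
  | ht => rw [evT_tVar]; exact endSub_mono (EqForms.bideg_le_formDeg 1 0) (tHat_mem k A V)
  | hadd x y hx hy => rw [map_add]; exact add_mem hx hy
  | hmul x y hx hy =>
    rw [map_mul]; exact mul_mem_endSub (EqForms.formDeg_mul (q := 0) (q' := 0)) hx hy

theorem one_mem_endSub :
    (1 : EndForms k A V) ∈ endSub k A V (EqForms.bideg k A V 0 0) := by
  rw [← map_one (evT k A V), ← map_one (FreeProd.inl k A (Polynomial k))]
  exact evT_inl_mem 1

theorem evOmega_mem {n : ℕ} {ω : OmegaT k A} (hω : ω ∈ NCForms.deg (kt k A) n) :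
    evOmega k A V ω ∈ endSub k A V (EqForms.formDeg k A V n) := by
  induction hω using Submodule.span_induction with
  | mem ω hω =>
    obtain ⟨l, rfl, rfl⟩ := hω
    induction l with
    | nil =>
      have e : NCForms.word (kt k A) [] = 1 := rfl
      rw [e, map_one]
      exact endSub_mono (EqForms.bideg_le_formDeg 0 0) one_mem_endSub
    | cons a l ih =>
      have e : NCForms.word (kt k A) (a :: l) =
        Sum.elim (NCForms.of (kt k A)) (NCForms.dOf (kt k A)) a * NCForms.word (kt k A) l := by
        simp [NCForms.word]
      rw [e, map_mul]
      cases a with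
      | inl b =>
        have h := mul_mem_endSub EqForms.formDeg_mul (evT_mem b) ih
        rw [zero_add] at h
        rw [Sum.elim_inl, evOmega_of]
        simpa [List.countP_cons] using h
      | inr b =>
        have hd : dEnd k A V (evT k A V b) ∈ endSub k A V (EqForms.formDeg k A V 1) :=
          lTensor_mem_endValued_of_mem dDR_mem_formDeg (evT_mem b)
        have h := mul_mem_endSub EqForms.formDeg_mul hd ih
        rw [add_comm] at h
        rw [Sum.elim_inr, evOmega_dOf]
        simpa [List.countP_cons] using h
  | zero => rw [map_zero]; exact zero_mem _
  | add x y _ _ hx hy => rw [map_add]; exact add_mem hx hy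
  | smul c x _ hx => rw [map_smul]; exact Submodule.smul_mem _ _ hx

theorem evOmega_mem_bideg {p q : ℕ} {ω : OmegaT k A} (hω : ω ∈ OmegaT.bideg k A p q) :
    evOmega k A V ω ∈ endSub k A V (EqForms.bideg k A V p q) := by
  induction hω using Submodule.span_induction with
  | mem ω hω =>
    obtain ⟨l, rfl, rfl, rfl⟩ := hω
    induction l with
    | nil =>
      have e : (List.map (Letter.val k) ([] : List (Letter A))).prod = 1 := rfl
      rw [e, map_one]
      exact one_mem_endSub
    | cons a l ih =>
      have e : (List.map (Letter.val k) (a :: l)).prod =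
        Letter.val k a * (List.map (Letter.val k) l).prod := List.prod_cons
      rw [e, map_mul, List.map_cons, List.sum_cons, List.map_cons, List.sum_cons]
      refine mul_mem_endSub EqForms.bideg_mul ?_ ih
      cases a with
      | const a => rw [Letter.val, evOmega_of]; exact evT_inl_mem a
      | t => rw [Letter.val, evOmega_of, evT_tVar]; exact tHat_mem k A V
      | diff a =>
        rw [Letter.val, evOmega_dOf]
        exact lTensor_mem_endValued_of_mem dDR_mem_bideg (evT_inl_mem a)
  | zero => rw [map_zero]; exact zero_mem _
  | add x y _ _ hx hy => rw [map_add]; exact add_mem hx hy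
  | smul c x _ hx => rw [map_smul]; exact Submodule.smul_mem _ _ hx

theorem trEvOmega_mem_bideg {p q : ℕ} {ω : OmegaT k A} (hω : ω ∈ OmegaT.bideg k A p q) :
    trEvOmega k A V ω ∈ EqForms.bideg k A V p q :=
  tr_mem (evOmega_mem_bideg hω)

variable (k A V) in
theorem comm_le_ker_trEvOmega :
    -- The evaluation of a `p`-form has entries of form degree `p`, so exchanging two factors under
    -- the trace costs exactly `(-1)^(p q)`.
    NCForms.comm (kt k A) ≤ LinearMap.ker (trEvOmega k A V) := by
  refine Submodule.span_le.2 ?_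
  rintro _ ⟨p, q, u, v, hu, hv, rfl⟩
  have h : trEnd A V (evOmega k A V u * evOmega k A V v) =
      (-1 : k) ^ (p * q) • trEnd A V (evOmega k A V v * evOmega k A V u) :=
    tr_mul_comm EqForms.formDeg_mul_comm (evOmega_mem hu) (evOmega_mem hv)
  rw [SetLike.mem_coe, LinearMap.mem_ker, map_sub, map_smul, trEvOmega_apply, trEvOmega_apply,
    map_mul (evOmega k A V), map_mul (evOmega k A V), h, sub_self]

variable (k A V) in
/-- The trace of the evaluation map, on the extended de Rham space. -/
def evDRt : DRt k A →ₗ[k] eqInvariants k A V :=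
  LinearMap.codRestrict (eqInvariants k A V)
    (Submodule.liftQ (NCForms.comm (kt k A)) (trEvOmega k A V) (comm_le_ker_trEvOmega k A V))
    fun x => by
      obtain ⟨ω, rfl⟩ := Submodule.Quotient.mk_surjective _ x
      exact trEvOmega_mem ω

theorem evDRt_mk (ω : OmegaT k A) :
    (evDRt k A V (Submodule.Quotient.mk ω) : EqForms k A V) = trEvOmega k A V ω := rfl

end Evaluation

/-! ### The cyclic structure of Hochschild chains -/

section ContractNth

variable {α : Type*} (op : α → α → α)

theorem contractNth_zero_eq {n : ℕ} (a : Fin (n + 2) → α) :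
    Fin.contractNth 0 op a = (Fin.cons (op (a 0) (a 1)) (Fin.tail (Fin.tail a)) :
      Fin (n + 1) → α) := by
  funext l
  refine Fin.cases ?_ (fun m => ?_) l
  · simp [Fin.contractNth]
  · simp [Fin.contractNth, Fin.tail]

theorem contractNth_succ_eq {n : ℕ} (i : Fin (n + 1)) (a : Fin (n + 2) → α) :
    Fin.contractNth i.succ op a = (Fin.cons (a 0) (Fin.contractNth i op (Fin.tail a)) :
      Fin (n + 1) → α) := by
  funext l
  refine Fin.cases ?_ (fun m => ?_) l
  · simp [Fin.contractNth]
  · simp [Fin.contractNth, Fin.tail]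

/-- The rotation of a tuple. -/
def rotateTuple {n : ℕ} (a : Fin (n + 1) → α) : Fin (n + 1) → α := fun j => a (j - 1)

theorem rotateTuple_eq {n : ℕ} (a : Fin (n + 1) → α) :
    rotateTuple a = (Fin.cons (a (Fin.last n)) (Fin.init a) : Fin (n + 1) → α) := by
  funext l
  refine Fin.cases ?_ (fun m => ?_) l
  · rw [Fin.cons_zero, rotateTuple]
    congr 1
    rw [sub_eq_iff_eq_add]
    exact (Fin.last_add_one n).symm
  · rw [Fin.cons_succ, rotateTuple, Fin.init]
    congr 1
    rw [sub_eq_iff_eq_add, Fin.coeSucc_eq_succ]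

/-- Rotation moves every entry one place to the right, so multiplying at place `i + 1` afterwards is
multiplying at place `i` beforehand. -/
theorem contractNth_rotateTuple {n : ℕ} (i : Fin n) (a : Fin (n + 2) → α) :
    Fin.contractNth i.succ.castSucc op (rotateTuple a) =
      rotateTuple (Fin.contractNth i.castSucc.castSucc op a) := by
  rw [rotateTuple_eq, rotateTuple_eq, ← Fin.succ_castSucc, contractNth_succ_eq]
  congr 1
  -- As `i < n`, the contraction leaves the last entry of `a` alone, and this is the entry that
  -- rotation brings to the front.
  have h₁ : ¬ n < (i : ℕ) := by omega
  have h₂ : n ≠ (i : ℕ) := by omega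
  simp [Fin.contractNth, h₁, h₂]

end ContractNth

section Chains

variable (k A : Type*) [Field k] [Ring A] [Algebra k A]

variable {k A} in
theorem SlotLinear.map_tprod {m n : ℕ} {φ : (Fin m → A) → (Fin n → A)} (h : SlotLinear k φ)
    (a : Fin m → A) : h.map (PiTensorProduct.tprod k a) = PiTensorProduct.tprod k (φ a) :=
  PiTensorProduct.lift.tprod _

namespace HChain

theorem face_tprod {n : ℕ} (j : Fin (n + 1)) (a : Fin (n + 2) → A) :
    face k A j (PiTensorProduct.tprod k a) =
      PiTensorProduct.tprod k (Fin.contractNth j.castSucc (· * ·) a) :=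
  SlotLinear.map_tprod _ _

theorem rotate_tprod {n : ℕ} (a : Fin (n + 1) → A) :
    rotate k A n (PiTensorProduct.tprod k a) = PiTensorProduct.tprod k (rotateTuple a) :=
  SlotLinear.map_tprod _ _

theorem extra_tprod {n : ℕ} (a : Fin (n + 1) → A) :
    extra k A n (PiTensorProduct.tprod k a) =
      PiTensorProduct.tprod k (Fin.cons 1 a : Fin (n + 2) → A) :=
  SlotLinear.map_tprod _ _

theorem face_rotate {n : ℕ} (i : Fin n) :
    face k A i.succ ∘ₗ rotate k A (n + 1) = rotate k A n ∘ₗ face k A i.castSucc := by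
  refine PiTensorProduct.ext (MultilinearMap.ext fun a => ?_)
  simp only [LinearMap.compMultilinearMap_apply, LinearMap.comp_apply, face_tprod, rotate_tprod,
    contractNth_rotateTuple]

theorem rotate_pow_tprod {n : ℕ} (i : ℕ) (a : Fin (n + 1) → A) :
    (rotate k A n ^ i) (PiTensorProduct.tprod k a) =
      PiTensorProduct.tprod k (fun j => a (j - i • 1)) := by
  induction i with
  | zero => simp
  | succ i ih =>
    rw [pow_succ', Module.End.mul_apply, ih, rotate_tprod]
    congr 1
    funext j
    rw [rotateTuple, succ_nsmul', sub_sub]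

theorem rotate_pow_card (n : ℕ) : rotate k A n ^ (n + 1) = 1 := by
  refine PiTensorProduct.ext (MultilinearMap.ext fun a => ?_)
  simp only [LinearMap.compMultilinearMap_apply, rotate_pow_tprod]
  have h : (n + 1) • (1 : Fin (n + 1)) = 0 := by
    have h := card_nsmul_eq_zero (x := (1 : Fin (n + 1)))
    rwa [Fintype.card_fin] at h
  simp [h]

/-- The accumulated sign is `(-1)^(n (n + 1))`, and `n (n + 1)` is even. -/
theorem cyc_pow_card (n : ℕ) : cyc k A n ^ (n + 1) = 1 := by
  rw [cyc, smul_pow, rotate_pow_card, ← pow_mul, Even.neg_one_pow (Nat.even_mul_succ_self n),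
    one_smul]

theorem face_zero_extra (n : ℕ) (x : HChain k A n) :
    face k A 0 (extra k A n x) = x := by
  have h : face k A 0 ∘ₗ extra k A n = LinearMap.id := by
    refine PiTensorProduct.ext (MultilinearMap.ext fun a => ?_)
    simp only [LinearMap.compMultilinearMap_apply, LinearMap.comp_apply, face_tprod, extra_tprod,
      LinearMap.id_apply, Fin.castSucc_zero, contractNth_zero_eq]
    congr 1
    rw [Fin.tail_cons, Fin.cons_zero, one_mul]
    exact Fin.cons_self_tail a
  exact LinearMap.congr_fun h x

theorem face_succ_extra {n : ℕ} (i : Fin (n + 1)) (x : HChain k A (n + 1)) :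
    face k A i.succ (extra k A (n + 1) x) = extra k A n (face k A i x) := by
  have h : face k A i.succ ∘ₗ extra k A (n + 1) = extra k A n ∘ₗ face k A i := by
    refine PiTensorProduct.ext (MultilinearMap.ext fun a => ?_)
    simp only [LinearMap.compMultilinearMap_apply, LinearMap.comp_apply, face_tprod, extra_tprod,
      ← Fin.succ_castSucc, contractNth_succ_eq]
    congr 1
  exact LinearMap.congr_fun h x

/-- The signed faces. -/
def sface {n : ℕ} (j : Fin (n + 1)) : HChain k A (n + 1) →ₗ[k] HChain k A n :=
  (-1 : k) ^ (j : ℕ) • face k A j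

/-- The bar differential `b'`. -/
def bar (n : ℕ) : HChain k A (n + 1) →ₗ[k] HChain k A n := ∑ j, sface k A j

/-- The norm operator `N`. -/
def norm (n : ℕ) : HChain k A n →ₗ[k] HChain k A n :=
  ∑ i ∈ Finset.range (n + 1), cyc k A n ^ i

/-! ### The cyclic relations between `b`, `b'`, `t`, `s` and `N`. -/

variable {k A}

theorem bar_apply {n : ℕ} (x : HChain k A (n + 1)) : bar k A n x = ∑ j, sface k A j x := by
  rw [bar, LinearMap.sum_apply]

theorem norm_apply {n : ℕ} (x : HChain k A n) :
    norm k A n x = ∑ i ∈ Finset.range (n + 1), (cyc k A n ^ i) x := by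
  rw [norm, LinearMap.sum_apply]

theorem connesB_apply {n : ℕ} (x : HChain k A n) :
    connesB k A n x = extra k A n (norm k A n x) - cyc k A (n + 1) (extra k A n (norm k A n x)) :=
  rfl

/-- The wrap-around face with its sign `(-1)^(n+1)` is the zeroth face after the signed rotation,
whose own sign in this degree is `(-1)^(n+1)`. -/
theorem b_apply {n : ℕ} (x : HChain k A (n + 1)) :
    b k A n x = bar k A n x + sface k A 0 (cyc k A (n + 1) x) := by
  rw [b, LinearMap.add_apply, cyc, sface]
  simp [bar, sface]

/-- With the signs absorbed into both operators the relation `d_{i+1} t = t d_i` carries none: the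
exponents `(i + 1) + (n + 1)` and `n + i` have the same parity. -/
theorem sface_succ_cyc {n : ℕ} (i : Fin n) (x : HChain k A (n + 1)) :
    sface k A i.succ (cyc k A (n + 1) x) = cyc k A n (sface k A i.castSucc x) := by
  have h := LinearMap.congr_fun (face_rotate k A i) x
  simp only [LinearMap.comp_apply] at h
  simp only [sface, cyc, LinearMap.smul_apply, map_smul, h, smul_smul, Fin.val_succ,
    Fin.val_castSucc]
  congr 1
  ring

theorem sface_cyc_pow {n : ℕ} (i : Fin (n + 1)) (x : HChain k A (n + 1)) :
    sface k A i ((cyc k A (n + 1) ^ (i : ℕ)) x) = (cyc k A n ^ (i : ℕ)) (sface k A 0 x) := by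
  induction i using Fin.induction with
  | zero => simp
  | succ i ih =>
    rw [Fin.val_succ, pow_succ', pow_succ', Module.End.mul_apply, Module.End.mul_apply,
      sface_succ_cyc]
    rw [Fin.val_castSucc] at ih
    rw [ih]

/-- Multiplication by `t` shifts the powers in `N` by one, and the top power wraps around because
`t^(n+1) = 1`. -/
theorem cyc_norm {n : ℕ} (x : HChain k A n) : cyc k A n (norm k A n x) = norm k A n x := by
  rw [norm_apply, map_sum, Finset.sum_range_succ, Finset.sum_range_succ', pow_zero,
    ← Module.End.mul_apply, ← pow_succ', cyc_pow_card]
  simp only [pow_succ', Module.End.mul_apply]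

theorem norm_cyc {n : ℕ} (x : HChain k A n) : norm k A n (cyc k A n x) = norm k A n x := by
  have h : norm k A n * cyc k A n = cyc k A n * norm k A n := by
    rw [norm, Finset.sum_mul, Finset.mul_sum]
    simp only [← pow_succ, ← pow_succ']
  exact (LinearMap.congr_fun h x).trans (cyc_norm x)

theorem norm_cyc_pow {n : ℕ} (i : ℕ) (x : HChain k A n) :
    norm k A n ((cyc k A n ^ i) x) = norm k A n x := by
  induction i with
  | zero => simp
  | succ i ih => rw [pow_succ', Module.End.mul_apply, norm_cyc, ih]

theorem cyc_pow_norm {n : ℕ} (i : ℕ) (x : HChain k A n) :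
    (cyc k A n ^ i) (norm k A n x) = norm k A n x := by
  induction i with
  | zero => simp
  | succ i ih => rw [pow_succ, Module.End.mul_apply, cyc_norm, ih]

theorem cyc_pow_cyc_pow_sub {n i : ℕ} (hi : i ≤ n + 1) (x : HChain k A n) :
    (cyc k A n ^ i) ((cyc k A n ^ (n + 1 - i)) x) = x := by
  rw [← Module.End.mul_apply, ← pow_add, Nat.add_sub_cancel' hi, cyc_pow_card,
    Module.End.one_apply]

/-- Every signed face is the zeroth one conjugated by rotations. The exponent `n + 2 - i` stands for
`-i`, since `t^(n+2) = 1` on `(n+1)`-chains. -/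
theorem sface_eq {n : ℕ} (i : Fin (n + 1)) (x : HChain k A (n + 1)) :
    sface k A i x =
      (cyc k A n ^ (i : ℕ)) (sface k A 0 ((cyc k A (n + 1) ^ (n + 2 - (i : ℕ))) x)) := by
  rw [← sface_cyc_pow, cyc_pow_cyc_pow_sub (by omega)]

/-- `N` absorbs the powers of `t` on the left of `d_0`. On its right the exponents `n + 2 - i` from
`b'` are `2, …, n + 2`, and the wrap-around face supplies the missing exponent `1`. -/
theorem norm_b {n : ℕ} (x : HChain k A (n + 1)) :
    norm k A n (b k A n x) = norm k A n (sface k A 0 (norm k A (n + 1) x)) := by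
  have h : ∀ i : Fin (n + 1), norm k A n (sface k A i x) =
      norm k A n (sface k A 0 ((cyc k A (n + 1) ^ (n + 2 - (i : ℕ))) x)) := fun i => by
    rw [sface_eq, norm_cyc_pow]
  rw [b_apply, map_add, bar_apply, map_sum]
  simp only [h]
  -- Writing `N` as `t N` makes its exponents run over `1, …, n + 2` and not `0, …, n + 1`, to match
  -- the left side.
  rw [← cyc_norm (n := n + 1), norm_apply (n := n + 1), map_sum, map_sum, map_sum,
    Finset.sum_range_succ', pow_zero, Module.End.one_apply]
  congr 1
  rw [Fin.sum_univ_eq_sum_range (fun i => norm k A n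
    (sface k A 0 ((cyc k A (n + 1) ^ (n + 2 - i)) x))) (n + 1), ← Finset.sum_range_reflect]
  refine Finset.sum_congr rfl fun i hi => ?_
  rw [← Module.End.mul_apply (cyc k A (n + 1)), ← pow_succ']
  have : n + 2 - (n + 1 - 1 - i) = i + 1 + 1 := by
    have := Finset.mem_range.1 hi
    omega
  rw [this]

/-- From `d_i t^i = t^i d_0` and `t^i N = N`, the left side is `∑ t^i d_0 N = N d_0 N`, which is `N
b` by `norm_b`. -/
theorem bar_norm {n : ℕ} (x : HChain k A (n + 1)) :
    bar k A n (norm k A (n + 1) x) = norm k A n (b k A n x) := by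
  rw [norm_b, bar_apply, norm_apply (n := n),
    ← Fin.sum_univ_eq_sum_range (fun i => (cyc k A n ^ i) (sface k A 0 (norm k A (n + 1) x)))]
  refine Finset.sum_congr rfl fun i _ => ?_
  rw [← sface_cyc_pow, cyc_pow_norm]

theorem b_sub_cyc {n : ℕ} (x : HChain k A (n + 1)) :
    b k A n (x - cyc k A (n + 1) x) = bar k A n x - cyc k A n (bar k A n x) := by
  -- The two outer terms meet here: `d_n = t^n d_0 t²`, and one more `t` on the left makes `t^(n+1)
  -- = 1`.
  have hlast : sface k A 0 (cyc k A (n + 1) (cyc k A (n + 1) x)) =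
      cyc k A n (sface k A (Fin.last n) x) := by
    rw [sface_eq (Fin.last n), Fin.val_last, ← Module.End.mul_apply (cyc k A n), ← pow_succ',
      cyc_pow_card, show n + 2 - n = 2 by omega, pow_two]
    rfl
  rw [map_sub, b_apply, b_apply, hlast]
  have h₁ : bar k A n (cyc k A (n + 1) x) = sface k A 0 (cyc k A (n + 1) x) +
      ∑ i : Fin n, cyc k A n (sface k A i.castSucc x) := by
    rw [bar_apply, Fin.sum_univ_succ]
    simp only [sface_succ_cyc]
  have h₂ : cyc k A n (bar k A n x) = ∑ i : Fin n, cyc k A n (sface k A i.castSucc x) +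
      cyc k A n (sface k A (Fin.last n) x) := by
    rw [bar_apply, Fin.sum_univ_castSucc, map_add, map_sum]
  rw [h₁, h₂]
  abel

theorem bar_extra_zero (x : HChain k A 0) : bar k A 0 (extra k A 0 x) = x := by
  rw [bar_apply, Fin.sum_univ_one, sface]
  simp [face_zero_extra]

/-- The map `s` is a contracting homotopy of the `b'`-complex: the zeroth face removes the added
`1`, and the other faces of `s x` are those of `x` with the sign reversed. -/
theorem bar_extra_succ {n : ℕ} (x : HChain k A (n + 1)) :
    bar k A (n + 1) (extra k A (n + 1) x) = x - extra k A n (bar k A n x) := by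
  rw [bar_apply, Fin.sum_univ_succ, bar_apply, map_sum, sub_eq_add_neg, ← Finset.sum_neg_distrib]
  congr 1
  · simp [sface, face_zero_extra]
  · refine Finset.sum_congr rfl fun i _ => ?_
    simp only [sface, LinearMap.smul_apply, face_succ_extra, map_smul, Fin.val_succ, pow_succ,
      mul_neg, mul_one, neg_smul]

theorem b_connesB_zero (x : HChain k A 0) : b k A 0 (connesB k A 0 x) = 0 := by
  rw [connesB_apply, b_sub_cyc, bar_extra_zero, cyc_norm, sub_self]

/-- `b (1 - t) s N = (1 - t) b' s N = (1 - t) (1 - s b') N`. Here `(1 - t) N = 0`, and `b' N = N b`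
turns the rest into `-B b`. -/
theorem b_connesB_succ {n : ℕ} (x : HChain k A (n + 1)) :
    b k A (n + 1) (connesB k A (n + 1) x) = -connesB k A n (b k A n x) := by
  rw [connesB_apply, b_sub_cyc, bar_extra_succ, map_sub, cyc_norm, bar_norm, connesB_apply]
  abel

theorem connesB_connesB {n : ℕ} (x : HChain k A n) :
    connesB k A (n + 1) (connesB k A n x) = 0 := by
  have h : norm k A (n + 1) (connesB k A n x) = 0 := by
    rw [connesB_apply, map_sub, norm_cyc, sub_self]
  rw [connesB_apply, h, map_zero, map_zero, sub_zero]

theorem connesB_mem_cycles {n : ℕ} {c : HChain k A n} (hc : c ∈ cycles k A n) :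
    connesB k A n c ∈ cycles k A (n + 1) := by
  change b k A n (connesB k A n c) = 0
  cases n with
  | zero => exact b_connesB_zero c
  | succ n =>
    have h : b k A n c = 0 := hc
    rw [b_connesB_succ, h, map_zero, neg_zero]

theorem connesB_mem_boundaries {n : ℕ} {c : HChain k A n} (hc : c ∈ boundaries k A n) :
    connesB k A n c ∈ boundaries k A (n + 1) := by
  obtain ⟨x, rfl⟩ := hc
  -- The sign compensates `b B = -B b`.
  exact ⟨-connesB k A (n + 1) x, by rw [map_neg, b_connesB_succ, neg_neg]⟩

end HChain

/-- Connes' operator on Hochschild homology. -/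
def HH.connesB (n : ℕ) : HH k A n →ₗ[k] HH k A (n + 1) :=
  Submodule.mapQ _ _
    ((HChain.connesB k A n).restrict (p := HChain.cycles k A n) (q := HChain.cycles k A (n + 1))
      fun _ hc => HChain.connesB_mem_cycles hc)
    fun _ hc => HChain.connesB_mem_boundaries hc

theorem HH.connesB_mk {n : ℕ} (c : HChain.cycles k A n) :
    HH.connesB k A n (Submodule.Quotient.mk c) =
      Submodule.Quotient.mk ⟨HChain.connesB k A n c, HChain.connesB_mem_cycles c.2⟩ := rfl

theorem HH.connesB_connesB {n : ℕ} (x : HH k A n) :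
    HH.connesB k A (n + 1) (HH.connesB k A n x) = 0 := by
  obtain ⟨c, rfl⟩ := Submodule.Quotient.mk_surjective _ x
  rw [HH.connesB_mk, HH.connesB_mk]
  simp only [HChain.connesB_connesB]
  rfl

end Chains

/-! ### Words in an algebra with a derivation -/

section Words

variable {k A C : Type*} [Field k] [Ring A] [Algebra k A] [Ring C] [Algebra k C]

/-- The multilinear map `(a₀, …, a_n) ↦ L(a₀) g(a₁, …, a_n)`. -/
def consMul {n : ℕ} (L : A →ₗ[k] C) (g : MultilinearMap k (fun _ : Fin n => A) C) :
    MultilinearMap k (fun _ : Fin (n + 1) => A) C where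
  toFun a := L (a 0) * g (Fin.tail a)
  map_update_add' := fun {dec} a i x y => by
    obtain rfl : dec = instDecidableEqFin _ := Subsingleton.elim _ _
    refine Fin.cases ?_ (fun j => ?_) i
    · simp [Fin.tail_update_zero, add_mul]
    · simp [Fin.tail_update_succ, mul_add, Function.update_of_ne (Fin.succ_ne_zero j).symm]
  map_update_smul' := fun {dec} a i c x => by
    obtain rfl : dec = instDecidableEqFin _ := Subsingleton.elim _ _
    refine Fin.cases ?_ (fun j => ?_) i
    · simp [Fin.tail_update_zero]
    · simp [Fin.tail_update_succ, Function.update_of_ne (Fin.succ_ne_zero j).symm]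

@[simp] theorem consMul_apply {n : ℕ} (L : A →ₗ[k] C)
    (g : MultilinearMap k (fun _ : Fin n => A) C) (a : Fin (n + 1) → A) :
    consMul L g a = L (a 0) * g (Fin.tail a) := rfl

/-- The word `(a₁, …, a_n) ↦ δa₁ ⋯ δa_n`. -/
def diffWord (δ : A →ₗ[k] C) : (n : ℕ) → MultilinearMap k (fun _ : Fin n => A) C
  | 0 => MultilinearMap.constOfIsEmpty k _ 1
  | n + 1 => consMul δ (diffWord δ n)

/-- The sum of all words obtained from `δa₁ ⋯ δa_n` by inserting the letter `x`. -/
def insertWord (δ : A →ₗ[k] C) (x : C) : (n : ℕ) → MultilinearMap k (fun _ : Fin n => A) C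
  | 0 => MultilinearMap.constOfIsEmpty k _ x
  | n + 1 => consMul (LinearMap.mulLeft k x ∘ₗ δ) (diffWord δ n) + consMul δ (insertWord δ x n)

/-- The alternating sum of the words obtained from `δa₁ ⋯ δa_n` by replacing a letter `δa_i`
by the commutator of `x` and `f(a_i)`. -/
def commWord (f : A →ₐ[k] C) (δ : A →ₗ[k] C) (x : C) : (n : ℕ) → (Fin n → A) → C
  | 0, _ => 0
  | n + 1, a => (x * f (a 0) - f (a 0) * x) * diffWord δ n (Fin.tail a) -
      δ (a 0) * commWord f δ x n (Fin.tail a)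

variable (f : A →ₐ[k] C) (δ : A →ₗ[k] C) (x : C)

@[simp] theorem diffWord_zero (a : Fin 0 → A) : diffWord δ 0 a = 1 := rfl

@[simp] theorem diffWord_succ {n : ℕ} (a : Fin (n + 1) → A) :
    diffWord δ (n + 1) a = δ (a 0) * diffWord δ n (Fin.tail a) := rfl

theorem diffWord_snoc {n : ℕ} (a : Fin (n + 1) → A) :
    diffWord δ (n + 1) a = diffWord δ n (Fin.init a) * δ (a (Fin.last n)) := by
  induction n with
  | zero => simp
  | succ n ih =>
    rw [diffWord_succ, ih, ← mul_assoc]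
    rfl

@[simp] theorem insertWord_zero (a : Fin 0 → A) : insertWord δ x 0 a = x := rfl

@[simp] theorem insertWord_succ {n : ℕ} (a : Fin (n + 1) → A) :
    insertWord δ x (n + 1) a = x * δ (a 0) * diffWord δ n (Fin.tail a) +
      δ (a 0) * insertWord δ x n (Fin.tail a) := rfl

variable {δ}

/-- Each `δ(a_j a_{j+1})` splits into two words. The word in which `f(a_i)` stands bare comes from
two neighbouring contractions with opposite signs, so only the bare first and last letters survive.
-/
theorem sum_diffWord_contractNth (hδ : ∀ a b, δ (a * b) = δ a * f b + f a * δ b) {n : ℕ}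
    (a : Fin (n + 1) → A) :
    ∑ j : Fin n, (-1 : k) ^ (j : ℕ) • diffWord δ n (Fin.contractNth j.castSucc (· * ·) a) =
      f (a 0) * diffWord δ n (Fin.tail a) -
        (-1 : k) ^ n • (diffWord δ n (Fin.init a) * f (a (Fin.last n))) := by
  induction n with
  | zero => simp
  | succ n ih =>
    have h : ∀ j : Fin n, (-1 : k) ^ (j.succ : ℕ) •
        diffWord δ (n + 1) (Fin.contractNth j.succ.castSucc (· * ·) a) =
        -(δ (a 0) * ((-1 : k) ^ (j : ℕ) •
          diffWord δ n (Fin.contractNth j.castSucc (· * ·) (Fin.tail a)))) := by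
      intro j
      rw [← Fin.succ_castSucc, contractNth_succ_eq, diffWord_succ, Fin.cons_zero, Fin.tail_cons,
        Fin.val_succ, pow_succ, mul_neg_one, neg_smul, mul_smul_comm]
    rw [Fin.sum_univ_succ]
    simp only [h]
    rw [Finset.sum_neg_distrib, ← Finset.mul_sum, ih, Fin.castSucc_zero, contractNth_zero_eq]
    have e₀ : Fin.tail a 0 = a 1 := rfl
    have e₁ : Fin.init a 0 = a 0 := rfl
    have e₂ : Fin.tail (Fin.init a) = Fin.init (Fin.tail a) := rfl
    have e₃ : Fin.tail a (Fin.last n) = a (Fin.last (n + 1)) := rfl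
    simp only [diffWord_succ, Fin.cons_zero, Fin.tail_cons, hδ, e₀, e₁, e₂, e₃, Fin.val_zero,
      pow_zero, one_smul, pow_succ, mul_neg_one, neg_smul, mul_sub, mul_smul_comm]
    noncomm_ring

/-- The cancellation persists when `x` stands away from the bare letter `f(a_i)`. With `x` adjacent,
one neighbouring contraction produces `x f(a_i)` and the other `f(a_i) x`; their difference is the
commutator in `commWord`, the end letters included. -/
theorem sum_insertWord_contractNth (hδ : ∀ a b, δ (a * b) = δ a * f b + f a * δ b) {n : ℕ}
    (a : Fin (n + 1) → A) :
    ∑ j : Fin n, (-1 : k) ^ (j : ℕ) • insertWord δ x n (Fin.contractNth j.castSucc (· * ·) a) =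
      f (a 0) * insertWord δ x n (Fin.tail a) -
        (-1 : k) ^ n • (insertWord δ x n (Fin.init a) * f (a (Fin.last n))) +
        commWord f δ x (n + 1) a := by
  induction n with
  | zero => simp [commWord]
  | succ n ih =>
    have h : ∀ j : Fin n, (-1 : k) ^ (j.succ : ℕ) •
        insertWord δ x (n + 1) (Fin.contractNth j.succ.castSucc (· * ·) a) =
        -(x * δ (a 0) * ((-1 : k) ^ (j : ℕ) •
          diffWord δ n (Fin.contractNth j.castSucc (· * ·) (Fin.tail a)))) -
        δ (a 0) * ((-1 : k) ^ (j : ℕ) •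
          insertWord δ x n (Fin.contractNth j.castSucc (· * ·) (Fin.tail a))) := by
      intro j
      rw [← Fin.succ_castSucc, contractNth_succ_eq, insertWord_succ, Fin.cons_zero, Fin.tail_cons,
        Fin.val_succ, pow_succ, mul_neg_one, neg_smul, smul_add, mul_smul_comm, mul_smul_comm,
        neg_add, sub_eq_add_neg]
    rw [Fin.sum_univ_succ]
    simp only [h]
    rw [Finset.sum_sub_distrib, Finset.sum_neg_distrib, ← Finset.mul_sum, ← Finset.mul_sum, ih,
      sum_diffWord_contractNth f hδ, Fin.castSucc_zero, contractNth_zero_eq]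
    have e₀ : Fin.tail a 0 = a 1 := rfl
    have e₁ : Fin.init a 0 = a 0 := rfl
    have e₂ : Fin.tail (Fin.init a) = Fin.init (Fin.tail a) := rfl
    have e₃ : Fin.tail a (Fin.last n) = a (Fin.last (n + 1)) := rfl
    have e₄ : commWord f δ x (n + 1 + 1) a =
      (x * f (a 0) - f (a 0) * x) * diffWord δ (n + 1) (Fin.tail a) -
      δ (a 0) * commWord f δ x (n + 1) (Fin.tail a) := rfl
    rw [e₄]
    simp only [insertWord_succ, diffWord_succ, Fin.cons_zero, Fin.tail_cons, hδ, e₀, e₁, e₂, e₃,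
      Fin.val_zero, pow_zero, one_smul, pow_succ, mul_neg_one, neg_smul, mul_sub, mul_smul_comm,
      add_mul, smul_add, mul_assoc, mul_add, sub_mul]
    noncomm_ring

end Words

namespace HChain

variable {k A : Type*} [Field k] [Ring A] [Algebra k A]

theorem b_tprod {n : ℕ} (a : Fin (n + 2) → A) : b k A n (PiTensorProduct.tprod k a) =
    ∑ j : Fin (n + 1), (-1 : k) ^ (j : ℕ) •
      PiTensorProduct.tprod k (Fin.contractNth j.castSucc (· * ·) a) +
    (-1 : k) ^ (n + 1) • PiTensorProduct.tprod k
      (Fin.cons (a (Fin.last (n + 1)) * a 0) (Fin.init (Fin.tail a)) : Fin (n + 1) → A) := by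
  rw [b, LinearMap.add_apply, LinearMap.sum_apply]
  simp only [LinearMap.smul_apply, face_tprod, LinearMap.comp_apply, rotate_tprod]
  rw [Fin.castSucc_zero, contractNth_zero_eq, rotateTuple_eq]
  rfl

/-- The value of a trace of words `f(a₀) g(a₁, …, a_n)` on a Hochschild boundary, in terms of the
defect of the telescoping of `g` under contractions. -/
theorem trace_boundary {C M : Type*} [Ring C] [Algebra k C] [AddCommGroup M] [Module k M]
    (f : A →ₐ[k] C) {τ : C →ₗ[k] M} (hτ : ∀ z a, τ (f a * z) = τ (z * f a)) {n : ℕ}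
    (g : MultilinearMap k (fun _ : Fin n => A) C) (a : Fin (n + 2) → A) (R : C)
    (hg : ∑ j : Fin n, (-1 : k) ^ (j : ℕ) • g (Fin.contractNth j.castSucc (· * ·) (Fin.tail a)) =
      f (a 1) * g (Fin.tail (Fin.tail a)) -
        (-1 : k) ^ n • (g (Fin.init (Fin.tail a)) * f (a (Fin.last (n + 1)))) + R) :
    τ (PiTensorProduct.lift (consMul f.toLinearMap g)
      (b k A n (PiTensorProduct.tprod k a))) = -τ (f (a 0) * R) := by
  have h : ∀ j : Fin n, (-1 : k) ^ (j.succ : ℕ) •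
      consMul f.toLinearMap g (Fin.contractNth j.succ.castSucc (· * ·) a) =
      -(f (a 0) * ((-1 : k) ^ (j : ℕ) •
        g (Fin.contractNth j.castSucc (· * ·) (Fin.tail a)))) := by
    intro j
    rw [← Fin.succ_castSucc, contractNth_succ_eq, consMul_apply, Fin.cons_zero, Fin.tail_cons,
      Fin.val_succ, pow_succ, mul_neg_one, neg_smul, mul_smul_comm]
    rfl
  -- The wrap-around face puts `f(a_{n+1})` in front. Moved to the back under `τ`, it cancels the
  -- right end of the telescoped sum; the left end cancels the face `a₀ a₁`.
  have hc := hτ (f (a 0) * g (Fin.init (Fin.tail a))) (a (Fin.last (n + 1)))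
  rw [b_tprod, map_add, map_sum, Fin.sum_univ_succ]
  simp only [map_smul, PiTensorProduct.lift.tprod, h]
  rw [Finset.sum_neg_distrib, ← Finset.mul_sum, hg, Fin.castSucc_zero, contractNth_zero_eq,
    consMul_apply, consMul_apply, Fin.cons_zero, Fin.tail_cons, Fin.cons_zero, Fin.tail_cons,
    AlgHom.toLinearMap_apply, AlgHom.toLinearMap_apply, map_mul, map_mul]
  simp only [Fin.val_zero, pow_zero, one_smul, mul_add, mul_sub, mul_smul_comm, map_add, map_sub,
    map_neg, map_smul, ← mul_assoc] at hc ⊢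
  rw [hc, pow_succ, mul_neg_one, neg_smul]
  abel

end HChain

/-! ### Evaluation of Hochschild chains -/

section HochschildEvaluation

variable {k A V : Type*} [Field k] [Ring A] [Algebra k A] [AddCommGroup V] [Module k V]
  [FiniteDimensional k V]

variable (k A V) in
/-- The sign involution on `End V ⊗ Ω(Rep(A,V))`. -/
def formInvol : E k V ⊗[k] RepForms k A V →ₐ[k] E k V ⊗[k] RepForms k A V :=
  Algebra.TensorProduct.map (AlgHom.id k (E k V)) (Forms.kinvol k (RepRing k A V))

theorem lTensor_formIsTwistedDer {D : RepForms k A V →ₗ[k] RepForms k A V}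
    (h : IsTwistedDer (Forms.kinvol k (RepRing k A V)) D) :
    IsTwistedDer (formInvol k A V) (D.lTensor (E k V)) :=
  lTensor_leibniz D (Forms.kinvol k (RepRing k A V)) h

variable (V) in
theorem evForms_apply (a : A) : evForms k A V a =
    (funForms k A V).toLinearMap.lTensor (E k V) (RepRing.ev k A V a) := rfl

variable (V) in
theorem dEvForms_apply (a : A) : dEvForms k A V a =
    (Forms.d k (RepRing k A V)).lTensor (E k V) (evForms k A V a) := rfl

theorem lTensor_evForms (D : RepForms k A V →ₗ[k] RepForms k A V) (a : A) :
    D.lTensor (E k V) (evForms k A V a) =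
      (D ∘ₗ (funForms k A V).toLinearMap).lTensor (E k V) (RepRing.ev k A V a) :=
  (LinearMap.lTensor_comp_apply _ _ _ _).symm

variable (V) in
theorem formInvol_evForms (a : A) :
    formInvol k A V (evForms k A V a) = evForms k A V a := by
  have e : (Forms.kinvol k (RepRing k A V)).toLinearMap ∘ₗ (funForms k A V).toLinearMap =
    (funForms k A V).toLinearMap := LinearMap.ext Forms.kinvol_algebraMap
  refine (lTensor_evForms (Forms.kinvol k (RepRing k A V)).toLinearMap a).trans ?_
  rw [e, evForms_apply]

variable (V) in
theorem formInvol_dEvForms (a : A) :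
    formInvol k A V (dEvForms k A V a) = -dEvForms k A V a := by
  have e : (Forms.kinvol k (RepRing k A V)).toLinearMap ∘ₗ Forms.d k (RepRing k A V) ∘ₗ
      (funForms k A V).toLinearMap = -(Forms.d k (RepRing k A V) ∘ₗ (funForms k A V).toLinearMap) :=
    LinearMap.ext fun r => (Forms.kinvol_d _).trans
      (congrArg (fun z => -Forms.d k (RepRing k A V) z) (Forms.kinvol_algebraMap r))
  have h : formInvol k A V (dEvForms k A V a) = ((Forms.kinvol k (RepRing k A V)).toLinearMap ∘ₗ
      Forms.d k (RepRing k A V) ∘ₗ (funForms k A V).toLinearMap).lTensor (E k V)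
        (RepRing.ev k A V a) := by
    rw [LinearMap.lTensor_comp_apply, ← lTensor_evForms]
    rfl
  rw [h, e, LinearMap.lTensor_neg, LinearMap.neg_apply, dEvForms_apply, lTensor_evForms]

variable (V) in
theorem dEvForms_mul (a b : A) : dEvForms k A V (a * b) =
    dEvForms k A V a * evForms k A V b + evForms k A V a * dEvForms k A V b := by
  rw [dEvForms_apply, map_mul, lTensor_formIsTwistedDer Forms.d_isTwistedDer, formInvol_evForms]
  rfl

variable (V) in
theorem dEvForms_one : dEvForms k A V (1 : A) = 0 := by
  have h := dEvForms_mul (k := k) V (1 : A) 1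
  simpa using h

variable (V) in
theorem d_dEvForms (a : A) :
    (Forms.d k (RepRing k A V)).lTensor (E k V) (dEvForms k A V a) = 0 := by
  have e : Forms.d k (RepRing k A V) ∘ₗ Forms.d k (RepRing k A V) = 0 := LinearMap.ext Forms.d_d
  rw [dEvForms_apply, ← LinearMap.lTensor_comp_apply, e, LinearMap.lTensor_zero,
    LinearMap.zero_apply]

theorem contr_evForms (x : E k V) (a : A) :
    (Forms.contr (act A x)).lTensor (E k V) (evForms k A V a) = 0 := by
  have e : Forms.contr (act A x) ∘ₗ (funForms k A V).toLinearMap = 0 :=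
    LinearMap.ext (Forms.contr_algebraMap (act A x))
  rw [lTensor_evForms, e, LinearMap.lTensor_zero, LinearMap.zero_apply]

/-- Contracting `dr` with `x⃗` gives `x⃗(r)`, and entry by entry this is the conjugation formula
`x⃗(â) = [x, â]`. -/
theorem contr_dEvForms (x : E k V) (a : A) :
    (Forms.contr (act A x)).lTensor (E k V) (dEvForms k A V a) =
      x ⊗ₜ[k] 1 * evForms k A V a - evForms k A V a * x ⊗ₜ[k] 1 := by
  have e : Forms.contr (act A x) ∘ₗ Forms.d k (RepRing k A V) ∘ₗ (funForms k A V).toLinearMap =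
      (funForms k A V).toLinearMap ∘ₗ (act A x).toLinearMap :=
    LinearMap.ext fun r => (congrArg (Forms.contr (act A x)) (Forms.d_algebraMap k _ r)).trans
      (Forms.contr_D (act A x) r)
  have h : (Forms.contr (act A x)).lTensor (E k V) (dEvForms k A V a) =
      Algebra.TensorProduct.map (AlgHom.id k (E k V)) (funForms k A V)
        ((act A x).toLinearMap.lTensor (E k V) (RepRing.ev k A V a)) := by
    rw [dEvForms_apply, lTensor_evForms, ← LinearMap.lTensor_comp_apply, e,
      LinearMap.lTensor_comp_apply]
    rfl
  rw [h, act_ev, map_sub, map_mul, map_mul, Algebra.TensorProduct.map_tmul, map_one]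
  rfl

variable (V) in
theorem d_diffWord {n : ℕ} (a : Fin n → A) :
    (Forms.d k (RepRing k A V)).lTensor (E k V) (diffWord (dEvForms k A V) n a) = 0 := by
  have hd := lTensor_formIsTwistedDer (Forms.d_isTwistedDer (k := k) (R := RepRing k A V))
  induction n with
  | zero => rw [diffWord_zero, hd.map_one]
  | succ n ih => rw [diffWord_succ, hd, d_dEvForms, ih, zero_mul, mul_zero, add_zero]

theorem add_neg_mul_eq_sub {C : Type*} [Ring C] (u v w : C) : u + -v * w = u - v * w := by
  rw [neg_mul, sub_eq_add_neg]

/-- Contraction is an odd derivation, so each `dâ_i` that it passes contributes a sign; this is the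
alternation built into `commWord`. -/
theorem contr_diffWord (x : E k V) {n : ℕ} (a : Fin n → A) :
    (Forms.contr (act A x)).lTensor (E k V) (diffWord (dEvForms k A V) n a) =
      commWord (evForms k A V) (dEvForms k A V) (x ⊗ₜ[k] 1) n a := by
  have hc := lTensor_formIsTwistedDer (Forms.contr_isTwistedDer (act A x))
  induction n with
  | zero => rw [diffWord_zero, hc.map_one]; rfl
  | succ n ih =>
    rw [diffWord_succ, hc, ih, contr_dEvForms, formInvol_dEvForms]
    exact add_neg_mul_eq_sub _ _ _

variable (V) in
theorem evForms_mem (a : A) :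
    evForms k A V a ∈ endValued V (Forms.deg k (RepRing k A V) 0) :=
  lTensor_mem_endValued (f := (funForms k A V).toLinearMap) Forms.algebraMap_mem_deg _

variable (V) in
theorem dEvForms_mem (a : A) :
    dEvForms k A V a ∈ endValued V (Forms.deg k (RepRing k A V) 1) :=
  lTensor_mem_endValued_of_mem (fun _ hw => Forms.d_mem_deg hw) (evForms_mem V a)

variable (V) in
theorem diffWord_mem {n : ℕ} (a : Fin n → A) :
    diffWord (dEvForms k A V) n a ∈ endValued V (Forms.deg k (RepRing k A V) n) := by
  induction n with
  | zero => rw [diffWord_zero, ← map_one (evForms k A V)]; exact evForms_mem V 1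
  | succ n ih =>
    have h := mul_mem_endValued (fun _ hx _ hy => Forms.mul_mem_deg hx hy)
      (dEvForms_mem V (a 0)) (ih (Fin.tail a))
    rwa [add_comm] at h

/-- The entries of `â` are functions, which are central among forms, so no degree has to be assigned
to `z`. -/
theorem tr_evForms_mul_comm (z : E k V ⊗[k] RepForms k A V) (a : A) :
    tr (evForms k A V a * z) = tr (z * evForms k A V a) := by
  have hz : z ∈ endValued V (⊤ : Submodule k (RepForms k A V)) := by
    have h := lTensor_mem_endValued (V := V) (f := (LinearMap.id : RepForms k A V →ₗ[k] _))
      (P := ⊤) (fun _ => Submodule.mem_top) z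
    rwa [LinearMap.lTensor_id, LinearMap.id_apply] at h
  have h : ∀ x ∈ Forms.deg k (RepRing k A V) 0, ∀ y ∈ (⊤ : Submodule k (RepForms k A V)),
      x * y = (1 : k) • (y * x) := by
    intro x hx y _
    rw [one_smul]
    change x ∈ ⋀[RepRing k A V]^0 (Ω[RepRing k A V⁄k]) at hx
    rw [ExteriorAlgebra.exteriorPower, pow_zero] at hx
    obtain ⟨r, rfl⟩ := Submodule.mem_one.1 hx
    exact Algebra.commutes r y
  rw [tr_mul_comm h (evForms_mem V a) hz, one_smul]

theorem mem_basic {ω : RepForms k A V} : ω ∈ basic k A V ↔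
    ∀ x : E k V, Forms.lie (act A x) ω = 0 ∧ Forms.contr (act A x) ω = 0 := by
  simp only [basic, Submodule.mem_iInf, Submodule.mem_inf, LinearMap.mem_ker]

namespace HChain

theorem trEv_eq (n : ℕ) : trEv k A V n =
    tr ∘ₗ PiTensorProduct.lift (consMul (evForms k A V).toLinearMap
      (diffWord (dEvForms k A V) n)) := by
  have h : ∀ {n : ℕ} (a : Fin n → A), (List.ofFn fun i => dEvForms k A V (a i)).prod =
      diffWord (dEvForms k A V) n a := by
    intro n a
    induction n with
    | zero => simp
    | succ n ih => rw [List.ofFn_succ, List.prod_cons, ih, diffWord_succ]; rfl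
  rw [trEv]
  congr 2
  refine MultilinearMap.ext fun a => ?_
  rw [MultilinearMap.compLinearMap_apply, MultilinearMap.mkPiAlgebraFin_apply, List.ofFn_succ,
    List.prod_cons, consMul_apply, ← h]
  rfl

theorem trEv_tprod {n : ℕ} (a : Fin (n + 1) → A) :
    trEv k A V n (PiTensorProduct.tprod k a) =
      tr (evForms k A V (a 0) * diffWord (dEvForms k A V) n (Fin.tail a)) := by
  rw [trEv_eq, LinearMap.comp_apply, PiTensorProduct.lift.tprod]
  rfl

theorem trEv_mem_deg {n : ℕ} (c : HChain k A n) :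
    trEv k A V n c ∈ Forms.deg k (RepRing k A V) n := by
  induction c using PiTensorProduct.induction_on with
  | smul_tprod r a =>
    rw [map_smul, trEv_tprod]
    refine Submodule.smul_mem _ _ (tr_mem ?_)
    have h := mul_mem_endValued (fun _ hx _ hy => Forms.mul_mem_deg hx hy)
      (evForms_mem (k := k) V (a 0)) (diffWord_mem V (Fin.tail a))
    rwa [zero_add] at h
  | add x y hx hy => rw [map_add]; exact add_mem hx hy

/-- The word `dâ₁ ⋯ dâ_n` telescopes without defect, so `trace_boundary` applies with remainder `0`.
-/
theorem trEv_b {n : ℕ} (c : HChain k A (n + 1)) : trEv k A V n (b k A n c) = 0 := by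
  induction c using PiTensorProduct.induction_on with
  | smul_tprod r a =>
    have h := trace_boundary (evForms k A V) tr_evForms_mul_comm
      (diffWord (dEvForms k A V) n) a 0
      ((sum_diffWord_contractNth (evForms k A V) (dEvForms_mul V) (Fin.tail a)).trans
        (add_zero _).symm)
    rw [map_smul, map_smul, trEv_eq, LinearMap.comp_apply, h, mul_zero, map_zero, neg_zero,
      smul_zero]
  | add x y hx hy => rw [map_add, map_add, hx, hy, add_zero]

/-- The defect in telescoping the words with `x` inserted is `commWord`, which is also the
contraction of `dâ₁ ⋯ dâ_{n+1}`. Hence the contraction depends only on the boundary of the chain. -/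
theorem contr_trEv (x : E k V) {n : ℕ} (c : HChain k A (n + 1)) :
    Forms.contr (act A x) (trEv k A V (n + 1) c) =
      -tr (PiTensorProduct.lift (consMul (evForms k A V).toLinearMap
        (insertWord (dEvForms k A V) (x ⊗ₜ[k] 1) n)) (b k A n c)) := by
  induction c using PiTensorProduct.induction_on with
  | smul_tprod r a =>
    have h := trace_boundary (evForms k A V) tr_evForms_mul_comm
      (insertWord (dEvForms k A V) (x ⊗ₜ[k] 1) n) a _
      (sum_insertWord_contractNth (evForms k A V) (x ⊗ₜ[k] 1) (dEvForms_mul V) (Fin.tail a))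
    have hc := lTensor_formIsTwistedDer (Forms.contr_isTwistedDer (act A x))
    have e : Forms.contr (act A x) (trEv k A V (n + 1) (PiTensorProduct.tprod k a)) =
        tr (evForms k A V (a 0) * commWord (evForms k A V) (dEvForms k A V) (x ⊗ₜ[k] 1) (n + 1)
          (Fin.tail a)) := by
      rw [trEv_tprod, ← tr_lTensor, hc, contr_evForms, zero_mul, zero_add,
        formInvol_evForms, contr_diffWord]
    simp only [map_smul]
    rw [e, ← smul_neg]
    exact congrArg (r • ·) ((neg_neg _).symm.trans (congrArg Neg.neg h.symm))
  | add y z hy hz => simp only [map_add, hy, hz, neg_add]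

theorem contr_trEv_of_mem_cycles (x : E k V) {n : ℕ} {c : HChain k A n} (hc : c ∈ cycles k A n) :
    Forms.contr (act A x) (trEv k A V n c) = 0 := by
  cases n with
  | zero =>
    clear hc
    induction c using PiTensorProduct.induction_on with
    | smul_tprod r a =>
      rw [map_smul, map_smul, trEv_tprod, diffWord_zero, mul_one, ← tr_lTensor, contr_evForms,
        map_zero, smul_zero]
    | add y z hy hz => rw [map_add, map_add, hy, hz, add_zero]
  | succ n =>
    have h : b k A n c = 0 := hc
    rw [contr_trEv, h, map_zero, map_zero, neg_zero]

theorem d_trEv_tprod {n : ℕ} (a : Fin (n + 1) → A) :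
    Forms.d k (RepRing k A V) (trEv k A V n (PiTensorProduct.tprod k a)) =
      tr (diffWord (dEvForms k A V) (n + 1) a) := by
  have hd := lTensor_formIsTwistedDer (Forms.d_isTwistedDer (k := k) (R := RepRing k A V))
  rw [trEv_tprod, ← tr_lTensor, hd, d_diffWord, mul_zero, add_zero, ← dEvForms_apply,
    diffWord_succ]

/-- The trailing word `dâ₁ ⋯ dâ_n` is closed, so applying `d` only puts `â₀` under `d`; prefixing
`1` to the chain has the same effect. -/
theorem trEv_extra {n : ℕ} (c : HChain k A n) :
    trEv k A V (n + 1) (extra k A n c) = Forms.d k (RepRing k A V) (trEv k A V n c) := by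
  induction c using PiTensorProduct.induction_on with
  | smul_tprod r a =>
    rw [map_smul, map_smul, map_smul, map_smul, d_trEv_tprod, extra_tprod, trEv_tprod,
      Fin.cons_zero, Fin.tail_cons, map_one, one_mul]
  | add y z hy hz => simp only [map_add, hy, hz]

/-- After rotation the inserted `1` is in second place, under `d`, and `d` kills it. -/
theorem trEv_cyc_extra {n : ℕ} (c : HChain k A n) :
    trEv k A V (n + 1) (cyc k A (n + 1) (extra k A n c)) = 0 := by
  induction c using PiTensorProduct.induction_on with
  | smul_tprod r a =>
    have e : Fin.init (Fin.cons 1 a : Fin (n + 2) → A) 0 = 1 := rfl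
    rw [cyc, LinearMap.smul_apply, map_smul, map_smul, map_smul, map_smul, extra_tprod,
      rotate_tprod, trEv_tprod, rotateTuple_eq, Fin.tail_cons, diffWord_succ, e, dEvForms_one,
      zero_mul, mul_zero, map_zero, smul_zero, smul_zero]
  | add y z hy hz => simp only [map_add, hy, hz, add_zero]

/-- After `d` every letter is a one-form. Carrying the last one past the other `n` under the trace
gives `(-1)^n`, which the sign of the cyclic operator cancels. -/
theorem d_trEv_cyc {n : ℕ} (c : HChain k A n) :
    Forms.d k (RepRing k A V) (trEv k A V n (cyc k A n c)) =
      Forms.d k (RepRing k A V) (trEv k A V n c) := by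
  induction c using PiTensorProduct.induction_on with
  | smul_tprod r a =>
    have h := tr_mul_comm (s := (-1 : k) ^ (n * 1))
      (fun _ hx _ hy => Forms.mul_comm_of_mem hx hy) (diffWord_mem V (Fin.init a))
      (dEvForms_mem V (a (Fin.last n)))
    simp only [map_smul]
    rw [cyc, LinearMap.smul_apply, map_smul, rotate_tprod, map_smul, d_trEv_tprod, d_trEv_tprod,
      rotateTuple_eq, diffWord_succ, Fin.cons_zero, Fin.tail_cons, diffWord_snoc, h, mul_one]
  | add y z hy hz => simp only [map_add, hy, hz]

theorem trEv_connesB {n : ℕ} (c : HChain k A n) : trEv k A V (n + 1) (connesB k A n c) =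
    ((n : k) + 1) • Forms.d k (RepRing k A V) (trEv k A V n c) := by
  have h : ∀ i : ℕ, Forms.d k (RepRing k A V) (trEv k A V n ((cyc k A n ^ i) c)) =
      Forms.d k (RepRing k A V) (trEv k A V n c) := by
    intro i
    induction i with
    | zero => simp
    | succ i ih => rw [pow_succ', Module.End.mul_apply, d_trEv_cyc, ih]
  rw [connesB_apply, map_sub, trEv_cyc_extra, sub_zero, trEv_extra, norm_apply, map_sum, map_sum]
  simp only [h]
  rw [Finset.sum_const, Finset.card_range, ← Nat.cast_smul_eq_nsmul k, Nat.cast_succ]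

/-- `B c` is again a cycle, so its evaluation `(n+1) d ev(c)` is killed by contraction; since `n +
1` is invertible, Cartan's formula concludes. -/
theorem lie_trEv_of_mem_cycles [CharZero k] (x : E k V) {n : ℕ} {c : HChain k A n}
    (hc : c ∈ cycles k A n) : Forms.lie (act A x) (trEv k A V n c) = 0 := by
  have hn : (n : k) + 1 ≠ 0 := Nat.cast_add_one_ne_zero n
  have h := contr_trEv_of_mem_cycles (V := V) x (connesB_mem_cycles hc)
  rw [trEv_connesB] at h
  exact Forms.lie_eq_zero _ hn (contr_trEv_of_mem_cycles x hc) h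

theorem trEv_mem_basicDeg [CharZero k] {n : ℕ} {c : HChain k A n} (hc : c ∈ cycles k A n) :
    trEv k A V n c ∈ basicDeg k A V n := by
  exact ⟨mem_basic.2 fun x => ⟨lie_trEv_of_mem_cycles x hc, contr_trEv_of_mem_cycles x hc⟩,
    trEv_mem_deg c⟩

end HChain

variable (k A V) in
/-- The trace of the evaluation map on Hochschild homology. -/
def evHH [CharZero k] (n : ℕ) : HH k A n →ₗ[k] basicDeg k A V n :=
  LinearMap.codRestrict (basicDeg k A V n)
    (Submodule.liftQ ((HChain.boundaries k A n).comap (HChain.cycles k A n).subtype)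
      (HChain.trEv k A V n ∘ₗ (HChain.cycles k A n).subtype) (by
        rintro c ⟨y, hy⟩
        rw [LinearMap.mem_ker, LinearMap.comp_apply, ← hy, HChain.trEv_b]))
    fun x => by
      obtain ⟨c, rfl⟩ := Submodule.Quotient.mk_surjective _ x
      exact HChain.trEv_mem_basicDeg c.2

theorem evHH_mk [CharZero k] {n : ℕ} (c : HChain.cycles k A n) :
    (evHH k A V n (Submodule.Quotient.mk c) : RepForms k A V) = HChain.trEv k A V n c := rfl

theorem d_mem_basicDeg {n : ℕ} {ω : RepForms k A V} (hω : ω ∈ basicDeg k A V n) :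
    Forms.d k (RepRing k A V) ω ∈ basicDeg k A V (n + 1) := by
  refine ⟨mem_basic.2 fun x => ?_, Forms.d_mem_deg hω.2⟩
  obtain ⟨hl, hc⟩ := mem_basic.1 hω.1 x
  exact ⟨Forms.lie_d_eq_zero _ hl, Forms.contr_d_eq_zero _ hc hl⟩

end HochschildEvaluation

end NCRep
end

/-! ### The two morphisms of complexes. -/

theorem theorem6 {k A V : Type*} [Field k] [CharZero k] [Ring A] [Algebra k A]
    [AddCommGroup V] [Module k V] [FiniteDimensional k V] :
    -- Connes' operator acts on Hochschild homology as a differential, and the trace of the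
    -- evaluation map is a morphism of complexes to basic forms
    (∃ B : ∀ n : ℕ, NCRep.HH k A n →ₗ[k] NCRep.HH k A (n + 1),
      (∀ (n : ℕ) (c : NCRep.HChain.cycles k A n),
        ∃ h : NCRep.HChain.connesB k A n c ∈ NCRep.HChain.cycles k A (n + 1),
          B n (Submodule.Quotient.mk c) =
            Submodule.Quotient.mk ⟨NCRep.HChain.connesB k A n c, h⟩) ∧
      (∀ (n : ℕ) (x : NCRep.HH k A n), B (n + 1) (B n x) = 0) ∧
      (∀ (n : ℕ), ∀ ω ∈ NCRep.basicDeg k A V n,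
        NCRep.Forms.d k (NCRep.RepRing k A V) ω ∈ NCRep.basicDeg k A V (n + 1) ∧
        NCRep.Forms.d k (NCRep.RepRing k A V) (NCRep.Forms.d k (NCRep.RepRing k A V) ω) = 0) ∧
      ∃ Φ : ∀ n : ℕ, NCRep.HH k A n →ₗ[k] NCRep.basicDeg k A V n,
        (∀ (n : ℕ) (c : NCRep.HChain.cycles k A n),
          (Φ n (Submodule.Quotient.mk c) : NCRep.RepForms k A V) =
            NCRep.HChain.trEv k A V n c) ∧
        ∀ (n : ℕ) (x : NCRep.HH k A n),
          (Φ (n + 1) (B n x) : NCRep.RepForms k A V) =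
            ((n : k) + 1) • NCRep.Forms.d k (NCRep.RepRing k A V) (Φ n x)) ∧
    -- the noncommutative equivariant de Rham complex is a complex
    NCRep.DRt.diff k A ∘ₗ NCRep.DRt.diff k A = 0 ∧
    -- the equivariant algebraic de Rham complex is a complex
    (∀ w ∈ NCRep.eqInvariants k A V,
      (NCRep.dDR k A V + NCRep.dG k A V) w ∈ NCRep.eqInvariants k A V ∧
      (NCRep.dDR k A V + NCRep.dG k A V) ((NCRep.dDR k A V + NCRep.dG k A V) w) = 0) ∧
    -- the trace of the evaluation map is a graded morphism between them
    ∃ Ψ : NCRep.DRt k A →ₗ[k] NCRep.eqInvariants k A V,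
      (∀ ω : NCRep.OmegaT k A,
        (Ψ (Submodule.Quotient.mk ω) : NCRep.EqForms k A V) = NCRep.trEvOmega k A V ω) ∧
      (∀ (p q : ℕ), ∀ x ∈ NCRep.DRt.bideg k A p q,
        (Ψ x : NCRep.EqForms k A V) ∈ NCRep.EqForms.bideg k A V p q) ∧
      ∀ x : NCRep.DRt k A,
        (Ψ (NCRep.DRt.diff k A x) : NCRep.EqForms k A V) =
          (NCRep.dDR k A V + NCRep.dG k A V) (Ψ x) := by
  refine ⟨⟨NCRep.HH.connesB k A,
      fun n c => ⟨NCRep.HChain.connesB_mem_cycles c.2, NCRep.HH.connesB_mk k A c⟩,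
      fun n x => NCRep.HH.connesB_connesB k A x,
      fun n ω hω => ⟨NCRep.d_mem_basicDeg hω, NCRep.Forms.d_d ω⟩,
      NCRep.evHH k A V, fun n c => NCRep.evHH_mk c, fun n x => ?_⟩,
    NCRep.DRt.diff_diff k A,
    fun w hw => ⟨NCRep.dDR_add_dG_mem hw, NCRep.dDR_add_dG_square hw⟩,
    NCRep.evDRt k A V, NCRep.evDRt_mk, fun p q x hx => ?_, fun x => ?_⟩
  · obtain ⟨c, rfl⟩ := Submodule.Quotient.mk_surjective _ x
    rw [NCRep.HH.connesB_mk, NCRep.evHH_mk, NCRep.evHH_mk, NCRep.HChain.trEv_connesB]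
  · obtain ⟨ω, hω, rfl⟩ := hx
    exact NCRep.trEvOmega_mem_bideg hω
  · obtain ⟨ω, rfl⟩ := Submodule.Quotient.mk_surjective _ x
    rw [NCRep.DRt.diff_mk, NCRep.evDRt_mk, NCRep.evDRt_mk, NCRep.trEvOmega_diff]
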